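/- **Conventions.** Work over $\mathbb{Q}(q^{1/4},t^{1/4})$, with $q,t$ independent indeterminates. For a partition $\lambda$ let $\lambda'$ be its conjugate, $|\lambda|=\sum_i\lambda_i$, $n(\lambda)=\sum_i(i-1)\lambda_i$, $\ell(\lambda)$ its length, $\lambda\pm\mathbf 1_i$ the partition with one box added to / removed from row $i$, and set $$f_\lambda=(-1)^{|\lambda|}q^{n(\lambda')+|\lambda|/2}t^{-n(\lambda)-|\lambda|/2},\qquad N_{\lambda,\mu}(x)=\prod_{(i,j)\in\lambda}(1-xq^{-\mu_i+j-1}t^{-\lambda'_j+i})\prod_{(k,l)\in\mu}(1-xq^{\lambda_k-l}t^{\mu'_l-k+1}),$$ $$\mathcal G(x)=\exp\Big(-\sum_{n>0}\frac1n\frac{x^n}{(1-q^n)(1-t^{-n})}\Big),\qquad \delta(z)=\sum_{n\in\mathbb Z}z^n .$$ **Modules.** Let $\mathcal U$ be the quantum algebra of type $W_{1+\infty}$ (Ding–Iohara–Miki algebra), generated by the central elements $\gamma^{\pm1/2}$ and the modes of $x^\pm(z)=\sum_{n\in\mathbb Z}x^\pm_nz^{-n}$, $\psi^{\pm}(z)=\sum_{\pm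 n\ge0}\psi^\pm_nz^{-n}$, with coproduct $\Delta(\gamma^{\pm1/2})=\gamma^{\pm1/2}\otimes\gamma^{\pm1/2}$, $\Delta(x^+(z))=x^+(z)\otimes1+\psi^-(\gamma_{(1)}^{1/2}z)\otimes x^+(\gamma_{(1)}z)$, $\Delta(x^-(z))=x^-(\gamma_{(2)}z)\otimes\psi^+(\gamma_{(2)}^{1/2}z)+1\otimes x^-(z)$, $\Delta(\psi^\pm(z))=\psi^\pm(\gamma_{(2)}^{\pm1/2}z)\otimes\psi^\pm(\gamma_{(1)}^{\mp1/2}z)$, where $\gamma_{(1)}=\gamma\otimes1$, $\gamma_{(2)}=1\otimes\gamma$. (a) $\mathcal F^{(0,1)}_u$ has a basis $(P_\lambda)$ indexed by the partitions, $\gamma^{1/2}=1$, and $$x^+(z)P_\lambda=\sum_{i=1}^{\ell(\lambda)+1}A^+_{\lambda,i}\,\delta(q^{\lambda_i}t^{-i+1}u/z)P_{\lambda+\mathbf 1_i},\qquad x^-(z)P_\lambda=q^{1/2}t^{-1/2}\sum_{i=1}^{\ell(\lambda)}A^-_{\lambda,i}\,\delta(q^{\lambda_i-1}t^{-i+1}u/z)P_{\lambda-\mathbf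 1_i},$$ $$\psi^+(z)P_\lambda=q^{1/2}t^{-1/2}B^+_\lambda(u/z)P_\lambda,\qquad \psi^-(z)P_\lambda=q^{-1/2}t^{1/2}B^-_\lambda(z/u)P_\lambda,$$ $$A^+_{\lambda,i}=(1-t)\prod_{j=1}^{i-1}\frac{(1-q^{\lambda_i-\lambda_j}t^{-i+j+1})(1-q^{\lambda_i-\lambda_j+1}t^{-i+j-1})}{(1-q^{\lambda_i-\lambda_j}t^{-i+j})(1-q^{\lambda_i-\lambda_j+1}t^{-i+j})},$$ $$A^-_{\lambda,i}=(1-t^{-1})\frac{1-q^{\lambda_{i+1}-\lambda_i}}{1-q^{\lambda_{i+1}-\lambda_i+1}t^{-1}}\prod_{j=i+1}^\infty\frac{(1-q^{\lambda_j-\lambda_i+1}t^{-j+i-1})(1-q^{\lambda_{j+1}-\lambda_i}t^{-j+i})}{(1-q^{\lambda_{j+1}-\lambda_i+1}t^{-j+i-1})(1-q^{\lambda_j-\lambda_i}t^{-j+i})},$$ $$B^+_\lambda(z)=\frac{1-q^{\lambda_1-1}tz}{1-q^{\lambda_1}z}\prod_{i\ge1}\frac{(1-q^{\lambda_i}t^{-i}z)(1-q^{\lambda_{i+1}-1}t^{-i+1}z)}{(1-q^{\lambda_{i+1}}t^{-i}z)(1-q^{\lambda_i-1}t^{-i+1}z)},$$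 and $B^-_\lambda(z)$ is obtained from $B^+_\lambda(z)$ by replacing $q,t$ (but not $z$) by $q^{-1},t^{-1}$. (b) $\mathcal F^{(1,N)}_u$ ($N\in\mathbb Z$) is the Fock space $\mathcal F=\mathbb Q(q^{1/4},t^{1/4})[p_1,p_2,\dots]$ with $a_{-n}=p_n$, $a_n=n\frac{1-q^n}{1-t^n}\frac{\partial}{\partial p_n}$ for $n>0$, vacuum $1=P_\emptyset$, $\gamma^{1/2}=(t/q)^{1/4}$, and $$x^+(z)=uz^{-N}q^{-N/2}t^{N/2}\eta(z),\quad x^-(z)=u^{-1}z^Nq^{N/2}t^{-N/2}\xi(z),\quad \psi^\pm(z)=q^{\pm N/2}t^{\mp N/2}\varphi^\pm(z),$$ $$\eta(z)=e^{\sum_{n>0}\frac{1-t^{-n}}na_{-n}z^n}e^{-\sum_{n>0}\frac{1-t^n}na_nz^{-n}},\qquad \xi(z)=e^{-\sum_{n>0}\frac{1-t^{-n}}n(t/q)^{n/2}a_{-n}z^n}e^{\sum_{n>0}\frac{1-t^n}n(t/q)^{n/2}a_nz^{-n}},$$ $$\varphi^+(z)=e^{-\sum_{n>0}\frac{1-t^n}n(1-t^nq^{-n})(q/t)^{n/4}a_nz^{-n}},\qquad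 \varphi^-(z)=e^{\sum_{n>0}\frac{1-t^{-n}}n(1-t^nq^{-n})(q/t)^{n/4}a_{-n}z^n}.$$ **Intertwining operators.** $\Phi:\mathcal F^{(0,1)}_v\otimes\mathcal F^{(1,N)}_u\to\mathcal F^{(1,N+1)}_{-vu}$ and $\Phi^*:\mathcal F^{(1,N+1)}_{-vu}\to\mathcal F^{(1,N)}_v\otimes\mathcal F^{(0,1)}_u$ (with values in the completions) are the linear maps with $a\Phi=\Phi\Delta(a)$ and $\Delta(a)\Phi^*=\Phi^*a$ for all $a\in\mathcal U$, normalized by $\Phi(P_\emptyset\otimes1)=1+\cdots$ and by the coefficient of $1\otimes P_\emptyset$ in $\Phi^*(1)$ being $1$. **Statement.** Let $N_c\ge1$, $L,M\in\mathbb Z$, and let $u,v,w_1,\dots,w_{N_c}$ be independent indeterminates. Put $u_i=u\prod_{k<i}w_k^{-1}$, $v_i=v\prod_{k<i}w_k$ for $1\le i\le N_c+1$. For $1\le i\le N_c$ let $T_i$ be the composition $$\mathcal F^{(1,L-i+1)}_{u_i}\otimes\mathcal F^{(1,M+i-1)}_{v_i}\xrightarrow{\Phi^*\otimes\mathrm{id}}\mathcal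 F^{(1,L-i)}_{u_{i+1}}\otimes\mathcal F^{(0,1)}_{-w_i}\otimes\mathcal F^{(1,M+i-1)}_{v_i}\xrightarrow{\mathrm{id}\otimes\Phi}\mathcal F^{(1,L-i)}_{u_{i+1}}\otimes\mathcal F^{(1,M+i)}_{v_{i+1}} .$$ All infinite sums below are formal, in series in the indeterminates in which $v/u$ and the ratios $w_i/w_j$ ($i<j$) are small: exponents are ordered lexicographically in the order $v,u,w_1,\dots,w_{N_c}$, and rational functions are expanded accordingly. Then the matrix elements of all $T_i$ and of $T_{N_c}\cdots T_1$ are well-defined formal sums, and with $$\mathbf e_i=-w_i,\qquad \Lambda^{2N_c}=\frac vu\prod_{i=1}^{N_c}w_i,\qquad m=-L+M+N_c$$ one has $$\langle P_\emptyset\otimes P_\emptyset|\,T_{N_c}\cdots T_1\,|P_\emptyset\otimes P_\emptyset\rangle=\prod_{1\le i<j\le N_c}\mathcal G(\mathbf e_i/\mathbf e_j)\,\mathcal G(qt^{-1}\mathbf e_i/\mathbf e_j)\cdot Z^{\rm inst}_m(\mathbf e_1,\dots,\mathbf e_{N_c},\Lambda;q,t),$$ where $$Z^{\rm inst}_m=\sum_{\lambda^{(1)},\dots,\lambda^{(N_c)}}\frac{\prod_{\alpha=1}^{N_c}\big((q^{1/2}t^{-1/2})^{-N_c}\Lambda^{2N_c}(-\mathbf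 e_\alpha)^{-m}\big)^{|\lambda^{(\alpha)}|}f_{\lambda^{(\alpha)}}^{-m}}{\prod_{\alpha,\beta=1}^{N_c}N_{\lambda^{(\alpha)},\lambda^{(\beta)}}(\mathbf e_\alpha/\mathbf e_\beta)}$$ is a well-defined formal sum over $N_c$-tuples of partitions. -/

import Mathlib

namespace RefinedVertex

noncomputable section

/-! ## Formal sums in Hahn series -/

/-- The family `f` of Hahn series is summable (in the formal sense) and its sum is `x`. -/
def HasHSum {Γ R α : Type*} [PartialOrder Γ] [AddCommMonoid R]
    (f : α → HahnSeries Γ R) (x : HahnSeries Γ R) : Prop :=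
  ∃ S : HahnSeries.SummableFamily Γ R α, (∀ a, S a = f a) ∧ S.hsum = x

/-- `exp f = ∑ j, f ^ j / j!` for a power series `f` without constant term, over a possibly
noncommutative `K`-algebra `A`.  Only `j ≤ k` contributes to the coefficient of `z ^ k`. -/
def expSeries (K : Type*) {A : Type*} [Field K] [Ring A] [Algebra K A] (f : PowerSeries A) :
    PowerSeries A :=
  PowerSeries.mk fun k =>
    ∑ j ∈ Finset.range (k + 1), ((j.factorial : K)⁻¹) • PowerSeries.coeff k (f ^ j)

/-! ## Partitions

A partition is a `YoungDiagram`; rows and columns are counted from `0` in Lean, so that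
`lam.rowLen i` is the part with (one-based) index `i + 1`, `lam.colLen j` is the part of the
conjugate partition with index `j + 1`, and `lam.colLen 0` is the length. -/

/-- `n(λ) = ∑_{i ≥ 1} (i - 1) λ_i`. -/
def nStat (lam : YoungDiagram) : ℕ :=
  ∑ i ∈ Finset.range (lam.colLen 0), i * lam.rowLen i

/-- `mu` is obtained from `lam` by adding one box to the row with index `i`. -/
def IsAddBox (mu lam : YoungDiagram) (i : ℕ) : Prop :=
  ∀ j, mu.rowLen j = lam.rowLen j + if j = i then 1 else 0

variable {K : Type*} [Field K]

/-- The framing factor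
`f_λ = (-1)^{|λ|} q^{n(λ') + |λ|/2} t^{-n(λ) - |λ|/2}`, with `r = q^{1/4}`, `s = t^{1/4}`. -/
def framing (r s : K) (lam : YoungDiagram) : K :=
  (-1) ^ lam.card * r ^ (4 * (nStat lam.transpose : ℤ) + 2 * lam.card) *
    s ^ (-4 * (nStat lam : ℤ) - 2 * lam.card)

/-- `N_{λ,μ}(x) = ∏_{(i,j) ∈ λ} (1 - x q^{-μ_i+j-1} t^{-λ'_j+i})
  ∏_{(k,l) ∈ μ} (1 - x q^{λ_k-l} t^{μ'_l-k+1})` (one-based box coordinates). -/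
def nek (q t : K) (lam mu : YoungDiagram) (x : K) : K :=
  (∏ b ∈ lam.cells,
    (1 - x * q ^ (-(mu.rowLen b.1 : ℤ) + b.2) * t ^ (-(lam.colLen b.2 : ℤ) + b.1 + 1))) *
  ∏ b ∈ mu.cells,
    (1 - x * q ^ ((lam.rowLen b.1 : ℤ) - b.2 - 1) * t ^ ((mu.colLen b.2 : ℤ) - b.1))

/-- `𝒢(x) = exp (- ∑_{n > 0} x^n / (n (1 - q^n) (1 - t^{-n})))` as a power series in `x`. -/
def calG (q t : K) : PowerSeries K :=
  expSeries K (PowerSeries.mk fun n =>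
    if n = 0 then 0 else -((n : K) * (1 - q ^ n) * (1 - t ^ (-(n : ℤ))))⁻¹)

/-! ## Modules over the quantum algebra

The algebra is generated by `γ^{±1/2}` and the modes of the currents
`x^±(z) = ∑_{n ∈ ℤ} x^±_n z^{-n}`, `ψ^+(z) = ∑_{k ≥ 0} ψ^+_k z^{-k}`,
`ψ^-(z) = ∑_{k ≥ 0} ψ^-_{-k} z^k`.  All modules come with a basis indexed by a type `I`, and an
operator is recorded by its matrix (first index: output, second index: input). Linear maps from a
module with basis `J` to the completion (the full product) of a module with basis `I` are
the same thing as arbitrary matrices `Matrix I J K`. -/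

/-- The matrices by which the generators act on a module with a basis indexed by `I`, on which
`γ^{1/2}` acts as a scalar. -/
structure GenAction (K : Type*) (I : Type*) where
  /-- the scalar by which `γ^{1/2}` acts -/
  gam : K
  /-- the modes `x^+_n` -/
  xp : ℤ → Matrix I I K
  /-- the modes `x^-_n` -/
  xm : ℤ → Matrix I I K
  /-- the modes `ψ^+_k` -/
  psip : ℕ → Matrix I I K
  /-- the modes `ψ^-_{-k}` -/
  psim : ℕ → Matrix I I K

/-- Product of possibly infinite matrices, for products in which every entry is a finite sum. -/
def mmul {I J L : Type*} (A : Matrix I J K) (B : Matrix J L K) : Matrix I L K :=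
  fun i l => ∑ᶠ j, A i j * B j l

open Classical in
/-- The action of the generators on a tensor product through the coproduct
`Δ(γ^{1/2}) = γ^{1/2} ⊗ γ^{1/2}`,
`Δ(x^+(z)) = x^+(z) ⊗ 1 + ψ^-(γ_{(1)}^{1/2} z) ⊗ x^+(γ_{(1)} z)`,
`Δ(x^-(z)) = x^-(γ_{(2)} z) ⊗ ψ^+(γ_{(2)}^{1/2} z) + 1 ⊗ x^-(z)`,
`Δ(ψ^±(z)) = ψ^±(γ_{(2)}^{±1/2} z) ⊗ ψ^±(γ_{(1)}^{∓1/2} z)`. -/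
def GenAction.tensor {I J : Type*} (V : GenAction K I) (W : GenAction K J) :
    GenAction K (I × J) where
  gam := V.gam * W.gam
  xp n := fun a b =>
    (if a.2 = b.2 then V.xp n a.1 b.1 else 0) +
      ∑ᶠ k : ℕ, V.gam ^ (k : ℤ) * (V.gam ^ 2) ^ (-(n + k)) *
        (V.psim k a.1 b.1 * W.xp (n + k) a.2 b.2)
  xm n := fun a b =>
    (∑ᶠ k : ℕ, (W.gam ^ 2) ^ (-(n - k)) * W.gam ^ (-(k : ℤ)) *
        (V.xm (n - k) a.1 b.1 * W.psip k a.2 b.2)) +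
      (if a.1 = b.1 then W.xm n a.2 b.2 else 0)
  psip n := fun a b =>
    ∑ p ∈ Finset.HasAntidiagonal.antidiagonal n, W.gam ^ (-(p.1 : ℤ)) * V.gam ^ (p.2 : ℤ) *
      (V.psip p.1 a.1 b.1 * W.psip p.2 a.2 b.2)
  psim n := fun a b =>
    ∑ p ∈ Finset.HasAntidiagonal.antidiagonal n, W.gam ^ (-(p.1 : ℤ)) * V.gam ^ (p.2 : ℤ) *
      (V.psim p.1 a.1 b.1 * W.psim p.2 a.2 b.2)

/-- `T`, a map from the module `V` to the (completed) module `W`, commutes with the action of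
all generators. -/
structure IsIntertwiner {I J : Type*} (V : GenAction K J) (W : GenAction K I)
    (T : Matrix I J K) : Prop where
  gam : W.gam • T = V.gam • T
  xp : ∀ n, mmul (W.xp n) T = mmul T (V.xp n)
  xm : ∀ n, mmul (W.xm n) T = mmul T (V.xm n)
  psip : ∀ n, mmul (W.psip n) T = mmul T (V.psip n)
  psim : ∀ n, mmul (W.psim n) T = mmul T (V.psim n)

/-! ## The module of level `(0,1)` -/

/-- `A^+_{λ,i+1}`. -/
def coeffAp (q t : K) (lam : YoungDiagram) (i : ℕ) : K :=
  (1 - t) * ∏ j ∈ Finset.range i,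
    ((1 - q ^ ((lam.rowLen i : ℤ) - lam.rowLen j) * t ^ (-(i : ℤ) + j + 1)) *
      (1 - q ^ ((lam.rowLen i : ℤ) - lam.rowLen j + 1) * t ^ (-(i : ℤ) + j - 1)) /
    ((1 - q ^ ((lam.rowLen i : ℤ) - lam.rowLen j) * t ^ (-(i : ℤ) + j)) *
      (1 - q ^ ((lam.rowLen i : ℤ) - lam.rowLen j + 1) * t ^ (-(i : ℤ) + j))))

/-- `A^-_{λ,i+1}`; the factors of the infinite product beyond the length of `λ` are `1`. -/
def coeffAm (q t : K) (lam : YoungDiagram) (i : ℕ) : K :=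
  (1 - t⁻¹) *
    ((1 - q ^ ((lam.rowLen (i + 1) : ℤ) - lam.rowLen i)) /
      (1 - q ^ ((lam.rowLen (i + 1) : ℤ) - lam.rowLen i + 1) * t⁻¹)) *
    ∏ j ∈ Finset.Ico (i + 1) (lam.colLen 0),
      ((1 - q ^ ((lam.rowLen j : ℤ) - lam.rowLen i + 1) * t ^ (-(j : ℤ) + i - 1)) *
        (1 - q ^ ((lam.rowLen (j + 1) : ℤ) - lam.rowLen i) * t ^ (-(j : ℤ) + i)) /
      ((1 - q ^ ((lam.rowLen (j + 1) : ℤ) - lam.rowLen i + 1) * t ^ (-(j : ℤ) + i - 1)) *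
        (1 - q ^ ((lam.rowLen j : ℤ) - lam.rowLen i) * t ^ (-(j : ℤ) + i))))

/-- The power series `1 - c z`. -/
def lin (c : K) : PowerSeries K := 1 - PowerSeries.C c * PowerSeries.X

/-- `B^+_λ(z)`; the factors of the infinite product beyond the length of `λ` are `1`. -/
def seriesBp (q t : K) (lam : YoungDiagram) : PowerSeries K :=
  lin (q ^ ((lam.rowLen 0 : ℤ) - 1) * t) * (lin (q ^ (lam.rowLen 0 : ℤ)))⁻¹ *
    ∏ i ∈ Finset.range (lam.colLen 0),
      (lin (q ^ (lam.rowLen i : ℤ) * t ^ (-(i : ℤ) - 1)) *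
        lin (q ^ ((lam.rowLen (i + 1) : ℤ) - 1) * t ^ (-(i : ℤ))) *
      ((lin (q ^ (lam.rowLen (i + 1) : ℤ) * t ^ (-(i : ℤ) - 1)))⁻¹ *
        (lin (q ^ ((lam.rowLen i : ℤ) - 1) * t ^ (-(i : ℤ))))⁻¹))

/-- `B^-_λ(z)`; the factors of the infinite product beyond the length of `λ` are `1`. -/
def seriesBm (q t : K) (lam : YoungDiagram) : PowerSeries K :=
  lin (q ^ (-(lam.rowLen 0 : ℤ) + 1) * t⁻¹) * (lin (q ^ (-(lam.rowLen 0 : ℤ))))⁻¹ *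
    ∏ i ∈ Finset.range (lam.colLen 0),
      (lin (q ^ (-(lam.rowLen i : ℤ)) * t ^ ((i : ℤ) + 1)) *
        lin (q ^ (-(lam.rowLen (i + 1) : ℤ) + 1) * t ^ (i : ℤ)) *
      ((lin (q ^ (-(lam.rowLen (i + 1) : ℤ)) * t ^ ((i : ℤ) + 1)))⁻¹ *
        (lin (q ^ (-(lam.rowLen i : ℤ) + 1) * t ^ (i : ℤ)))⁻¹))

open Classical in
/-- The module `F_u^{(0,1)}` with its basis `P_λ`, where `r = q^{1/4}`, `s = t^{1/4}`:
`x^+(z) P_λ = ∑ A^+_{λ,i} δ(q^{λ_i} t^{-i+1} u/z) P_{λ+1_i}`,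
`x^-(z) P_λ = q^{1/2} t^{-1/2} ∑ A^-_{λ,i} δ(q^{λ_i-1} t^{-i+1} u/z) P_{λ-1_i}`,
`ψ^+(z) P_λ = q^{1/2} t^{-1/2} B^+_λ(u/z) P_λ`, `ψ^-(z) P_λ = q^{-1/2} t^{1/2} B^-_λ(z/u) P_λ`,
with `δ(z) = ∑_{n ∈ ℤ} z^n`. -/
def vert (r s u : K) : GenAction K YoungDiagram where
  gam := 1
  xp n := fun mu lam =>
    ∑ i ∈ Finset.range (lam.colLen 0 + 1),
      if IsAddBox mu lam i then
        coeffAp (r ^ 4) (s ^ 4) lam i *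
          ((r ^ 4) ^ (lam.rowLen i : ℤ) * (s ^ 4) ^ (-(i : ℤ)) * u) ^ n
      else 0
  xm n := fun mu lam =>
    r ^ 2 * (s ^ 2)⁻¹ * ∑ i ∈ Finset.range (lam.colLen 0),
      if IsAddBox lam mu i then
        coeffAm (r ^ 4) (s ^ 4) lam i *
          ((r ^ 4) ^ ((lam.rowLen i : ℤ) - 1) * (s ^ 4) ^ (-(i : ℤ)) * u) ^ n
      else 0
  psip k := fun mu lam =>
    if mu = lam then
      r ^ 2 * (s ^ 2)⁻¹ * (PowerSeries.coeff k (seriesBp (r ^ 4) (s ^ 4) lam) * u ^ k)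
    else 0
  psim k := fun mu lam =>
    if mu = lam then
      (r ^ 2)⁻¹ * s ^ 2 * (PowerSeries.coeff k (seriesBm (r ^ 4) (s ^ 4) lam) * (u⁻¹) ^ k)
    else 0

/-! ## The Fock module of level `(1,N)` -/

/-- The Fock space, identified with the symmetric functions: the variable `X n` is the power sum
`p_n`, and the monomial with exponent `c` is the state `∏ a_{-n}^{c_n} |0⟩`. -/
abbrev Fock (K : Type*) [Field K] := MvPolynomial ℕ+ K

/-- Index set of the monomial basis of the Fock space; `0` is the vacuum. -/
abbrev FockIdx := ℕ+ →₀ ℕ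

/-- The degree `∑ n c_n` of a basis state. -/
def wt (c : FockIdx) : ℕ := c.sum fun n k => (n : ℕ) * k

/-- The Heisenberg generator `a_{-n}`, `n > 0`: multiplication by `p_n`. -/
def aCre (n : ℕ+) : Module.End K (Fock K) := LinearMap.mulLeft K (MvPolynomial.X n)

/-- The Heisenberg generator `a_n = n (1 - q^n)/(1 - t^n) ∂/∂p_n`, `n > 0`. -/
def aAnn (q t : K) (n : ℕ+) : Module.End K (Fock K) :=
  ((n : ℕ) * (1 - q ^ (n : ℕ)) / (1 - t ^ (n : ℕ)) : K) •
    (MvPolynomial.pderiv n : Derivation K (Fock K) (Fock K)).toLinearMap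

/-- The power series `exp (∑_{n ≥ 1} α_n a_n' z^n)` for operators `a_n'`. -/
def expOp (al : ℕ → K) (a : ℕ+ → Module.End K (Fock K)) :
    PowerSeries (Module.End K (Fock K)) :=
  expSeries K (PowerSeries.mk fun n => if h : 0 < n then al n • a ⟨n, h⟩ else 0)

/-- The matrix of the coefficient of `z^m` in the vertex operator
`exp (∑_{n ≥ 1} α_n a_{-n} z^n) exp (∑_{n ≥ 1} β_n a_n z^{-n})`.
Terms with `k > wt c` or `l > wt d` vanish. -/
def vertexMode (q t : K) (al be : ℕ → K) (m : ℤ) : Matrix FockIdx FockIdx K := fun c d =>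
  ∑ k ∈ Finset.range (wt c + 1), ∑ l ∈ Finset.range (wt d + 1),
    if (k : ℤ) - l = m then
      MvPolynomial.coeff c
        ((PowerSeries.coeff k (expOp al aCre) * PowerSeries.coeff l (expOp be (aAnn q t)))
          (MvPolynomial.monomial d 1))
    else 0

/-- Coefficient of `z^m` in `η(z)`. -/
def etaMode (r s : K) : ℤ → Matrix FockIdx FockIdx K :=
  vertexMode (r ^ 4) (s ^ 4)
    (fun n => (1 - (s ^ 4) ^ (-(n : ℤ))) / n)
    (fun n => -((1 - (s ^ 4) ^ n) / n))

/-- Coefficient of `z^m` in `ξ(z)`. -/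
def xiMode (r s : K) : ℤ → Matrix FockIdx FockIdx K :=
  vertexMode (r ^ 4) (s ^ 4)
    (fun n => -((1 - (s ^ 4) ^ (-(n : ℤ))) / n * r ^ (-2 * (n : ℤ)) * s ^ (2 * (n : ℤ))))
    (fun n => (1 - (s ^ 4) ^ n) / n * r ^ (-2 * (n : ℤ)) * s ^ (2 * (n : ℤ)))

/-- Coefficient of `z^m` in `φ^+(z)`. -/
def phipMode (r s : K) : ℤ → Matrix FockIdx FockIdx K :=
  vertexMode (r ^ 4) (s ^ 4)
    (fun _ => 0)
    (fun n => -((1 - (s ^ 4) ^ n) / n * (1 - (s ^ 4) ^ n * (r ^ 4) ^ (-(n : ℤ))) *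
      r ^ (n : ℤ) * s ^ (-(n : ℤ))))

/-- Coefficient of `z^m` in `φ^-(z)`. -/
def phimMode (r s : K) : ℤ → Matrix FockIdx FockIdx K :=
  vertexMode (r ^ 4) (s ^ 4)
    (fun n => (1 - (s ^ 4) ^ (-(n : ℤ))) / n * (1 - (s ^ 4) ^ n * (r ^ 4) ^ (-(n : ℤ))) *
      r ^ (n : ℤ) * s ^ (-(n : ℤ)))
    (fun _ => 0)

/-- The module `F_u^{(1,N)}`:
`γ^{1/2} = (t/q)^{1/4}`, `x^+(z) = u z^{-N} q^{-N/2} t^{N/2} η(z)`,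
`x^-(z) = u^{-1} z^N q^{N/2} t^{-N/2} ξ(z)`, `ψ^+(z) = q^{N/2} t^{-N/2} φ^+(z)`,
`ψ^-(z) = q^{-N/2} t^{N/2} φ^-(z)`. -/
def horiz (r s : K) (N : ℤ) (u : K) : GenAction K FockIdx where
  gam := s / r
  xp n := (u * r ^ (-2 * N) * s ^ (2 * N)) • etaMode r s (-n + N)
  xm n := (u⁻¹ * r ^ (2 * N) * s ^ (-2 * N)) • xiMode r s (-n - N)
  psip k := (r ^ (2 * N) * s ^ (-2 * N)) • phipMode r s (-(k : ℤ))
  psim k := (r ^ (-2 * N) * s ^ (2 * N)) • phimMode r s (k : ℤ)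

/-! ## Trivalent intertwining operators -/

/-- `T` is the normalized intertwining operator
`Φ : F_v^{(0,1)} ⊗ F_u^{(1,N)} → F_w^{(1,N+1)}`, `Φ(P_∅ ⊗ 1) = 1 + ⋯`. -/
structure IsPhi (r s : K) (N : ℤ) (v u w : K)
    (T : Matrix FockIdx (YoungDiagram × FockIdx) K) : Prop where
  intertwines : IsIntertwiner ((vert r s v).tensor (horiz r s N u)) (horiz r s (N + 1) w) T
  normalized : T 0 (⊥, 0) = 1

/-- `T` is the normalized intertwining operator
`Φ^* : F_w^{(1,N+1)} → F_v^{(1,N)} ⊗ F_u^{(0,1)}`, `Φ^*(1) = (1 + ⋯) ⊗ P_∅ + ⋯`. -/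
structure IsPhiStar (r s : K) (N : ℤ) (w v u : K)
    (T : Matrix (FockIdx × YoungDiagram) FockIdx K) : Prop where
  intertwines : IsIntertwiner (horiz r s (N + 1) w) ((horiz r s N v).tensor (vert r s u)) T
  normalized : T (0, ⊥) 0 = 1

/-! ## Compositions -/

section Composition

variable {Γ k : Type*} [AddCommGroup Γ] [LinearOrder Γ] [IsOrderedAddMonoid Γ] [Field k]

/-- `T = (id ⊗ Φ) ∘ (Φ^* ⊗ id)`. -/
def IsFourPoint (Ps : Matrix (FockIdx × YoungDiagram) FockIdx (HahnSeries Γ k))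
    (P : Matrix FockIdx (YoungDiagram × FockIdx) (HahnSeries Γ k))
    (T : Matrix (FockIdx × FockIdx) (FockIdx × FockIdx) (HahnSeries Γ k)) : Prop :=
  ∀ a b, HasHSum (fun lam : YoungDiagram => Ps (a.1, lam) b.1 * P a.2 (lam, b.2)) (T a b)

/-- `R = A ∘ B`. -/
def IsComp {I J L : Type*} (A : Matrix I J (HahnSeries Γ k)) (B : Matrix J L (HahnSeries Γ k))
    (R : Matrix I L (HahnSeries Γ k)) : Prop :=
  ∀ a c, HasHSum (fun b => A a b * B b c) (R a c)

/-- `Z` is the instanton partition function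
`Z^inst_m = ∑_{λ^{(1)},…,λ^{(n)}} ∏_α ((q^{1/2} t^{-1/2})^{-n} Λ^{2n} (-e_α)^{-m})^{|λ^{(α)}|}
  f_{λ^{(α)}}^{-m} / ∏_{α,β} N_{λ^{(α)},λ^{(β)}}(e_α/e_β)`,
as a formal series; `x` stands for `Λ^{2n}`, the only power of `Λ` that occurs. -/
def IsZinst (r s : HahnSeries Γ k) (n : ℕ) (m : ℤ) (e : Fin n → HahnSeries Γ k)
    (x : HahnSeries Γ k) (Z : HahnSeries Γ k) : Prop :=
  HasHSum (fun lam : Fin n → YoungDiagram =>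
    (∏ α, (((r ^ 2 * (s ^ 2)⁻¹) ^ (-(n : ℤ)) * x * (-e α) ^ (-m)) ^ (lam α).card *
      framing r s (lam α) ^ (-m))) /
    ∏ α, ∏ β, nek (r ^ 4) (s ^ 4) (lam α) (lam β) (e α / e β)) Z

end Composition

/-! ## The coefficient field and the parameters -/

/-- `ℚ(q^{1/4}, t^{1/4})`. -/
abbrev BaseField := FractionRing (MvPolynomial (Fin 2) ℚ)

/-- `q^{1/4}`. -/
def qRoot : BaseField := algebraMap (MvPolynomial (Fin 2) ℚ) BaseField (MvPolynomial.X 0)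

/-- `t^{1/4}`. -/
def tRoot : BaseField := algebraMap (MvPolynomial (Fin 2) ℚ) BaseField (MvPolynomial.X 1)

/-- The field of formal series in the independent indeterminates `v, u, w_1, …, w_n` over
`ℚ(q^{1/4}, t^{1/4})`. Exponents are ordered lexicographically in this order of the
indeterminates, so that `v/u` and all `w_i/w_j` with `i < j` have positive order: rational functions are
expanded in nonnegative powers of `w_i/w_j`, `i < j`, and `v/u` counts boxes of partitions. -/
abbrev Series (n : ℕ) := HahnSeries (Lex (Fin (n + 2) → ℤ)) BaseField

/-- The indeterminate with the given index. -/
def indet {n : ℕ} (i : Fin (n + 2)) : Series n := HahnSeries.single (toLex (Pi.single i 1)) 1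

/-- The indeterminate `v`. -/
def vVar (n : ℕ) : Series n := indet 0

/-- The indeterminate `u`. -/
def uVar (n : ℕ) : Series n := indet 1

/-- The indeterminate `w_{i+1}`. -/
def wVar {n : ℕ} (i : Fin n) : Series n := indet i.succ.succ

/-- `q^{1/4}` as a series. -/
def qR (n : ℕ) : Series n := HahnSeries.C qRoot

/-- `t^{1/4}` as a series. -/
def tR (n : ℕ) : Series n := HahnSeries.C tRoot

/-- `u_{i+1} = u ∏_{k ≤ i} w_k^{-1}`. -/
def uSeq (n : ℕ) (i : ℕ) : Series n :=
  uVar n * ∏ k ∈ Finset.univ.filter (fun k : Fin n => (k : ℕ) < i), (wVar k)⁻¹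

/-- `v_{i+1} = v ∏_{k ≤ i} w_k`. -/
def vSeq (n : ℕ) (i : ℕ) : Series n :=
  vVar n * ∏ k ∈ Finset.univ.filter (fun k : Fin n => (k : ℕ) < i), wVar k

/-- `𝒢(x)` for a series `x` of positive order. -/
def evalG {n : ℕ} (x : Series n) : Series n :=
  PowerSeries.heval x (calG (qRoot ^ 4) (tRoot ^ 4))

end

end RefinedVertex

open RefinedVertex

/-!
The identity is proved by describing both intertwining operators explicitly. In the component
labelled by a partition `λ`, the relations for `ψ^±` say that the commutators of `Φ_λ` and `Φ^*_λ`
with the Heisenberg generators `a_n` and `a_{-n}` are scalar multiples of `Φ_λ` and `Φ^*_λ`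
(`IsPhi.isVertexOp`, `IsPhiStar.isVertexOp`), which determines these operators up to their vacuum entries. The vacuum
entries are found from the relation for `x^-`: comparing residues at the pole belonging to the last
row of `λ` gives a recursion in the number of boxes, and the product of the vacuum entries of `Φ_λ`
and `Φ^*_λ` is a monomial times `f_λ^{N'-N} / N_{λλ}(1)` (`vacuum_mul_vacuum`).

A vertex operator maps a coherent state to a multiple of a coherent state
(`IsVertexOp.hasHSum_mul_coh`), the factor being the contraction of the two. Hence the composition
`T_i ⋯ T_1` maps the vacuum to a sum over `i`-tuples of partitions of coherent states
(`IsVertexChain.hasHSum_vacuum`), whose coefficients are products of vacuum entries and of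
contractions of the pairs `α < β`. With `x = e_α / e_β`, the operators `Φ^*` contribute the
contraction at `x` and the operators `Φ` that at `q x / t`. Each is `𝒢` divided by a Nekrasov
factor `N_{λ^{(α)},λ^{(β)}}` (`Generic.pairSeries_mul`), because of a character identity for the
sum over the boxes of two partitions (`char_identity`). The functional equation
`N_{μλ}(1/x) ∝ N_{λμ}(q x / t)` (`nek_inv`) turns the second Nekrasov factor into the factor for
the pair `(β, α)`, and the monomials combine to the summand of `Z^inst` (`prod_nek_eq`).

All rearrangements of infinite sums are justified by one criterion
(`exists_hasHSum_of_inCone`): the exponents that occur lie in a cone generated by finitely many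
positive elements, namely the exponents of `u/w_1`, of the ratios `w_i/w_{i+1}`, and, for each `i`,
of the monomial containing `v/u` that every box of the `i`-th partition carries. By Dickson's
lemma a family is summable as soon as only finitely many members start within a bounded part of
that cone.
-/

namespace RefinedVertex

noncomputable section

/-! ### Exponentials of power series -/

section Exp

variable {K A : Type*} [Field K] [Ring A] [Algebra K A]

/-- The Euler operator `z d/dz` on power series; unlike `PowerSeries.derivative` it makes sense over
a noncommutative ring. -/
def euler (f : PowerSeries A) : PowerSeries A :=
  PowerSeries.mk fun k => (k : A) * PowerSeries.coeff k f

@[simp] theorem coeff_euler (f : PowerSeries A) (k : ℕ) :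
    PowerSeries.coeff k (euler f) = (k : A) * PowerSeries.coeff k f := by
  simp [euler]

theorem euler_add (f g : PowerSeries A) : euler (f + g) = euler f + euler g := by
  ext k; simp [mul_add]

theorem euler_mul (f g : PowerSeries A) : euler (f * g) = euler f * g + f * euler g := by
  ext k
  simp only [coeff_euler, map_add, PowerSeries.coeff_mul, Finset.mul_sum]
  rw [← Finset.sum_add_distrib]
  refine Finset.sum_congr rfl fun p hp => ?_
  rw [Finset.HasAntidiagonal.mem_antidiagonal] at hp
  rw [← hp, Nat.cast_add, add_mul]
  congr 1
  · rw [mul_assoc]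
  · rw [← mul_assoc, ← mul_assoc, (Nat.cast_commute p.2 _).eq]

theorem commute_euler {f : PowerSeries A}
    (hc : ∀ i j, Commute (PowerSeries.coeff i f) (PowerSeries.coeff j f)) :
    Commute f (euler f) := by
  ext k
  simp only [coeff_euler, PowerSeries.coeff_mul]
  rw [← Finset.Nat.sum_antidiagonal_swap]
  refine Finset.sum_congr rfl fun p _ => ?_
  simp only [Prod.fst_swap, Prod.snd_swap]
  rw [← mul_assoc, ← (Nat.cast_commute p.1 _).eq, mul_assoc, (hc _ _).eq, mul_assoc]

theorem euler_pow {f : PowerSeries A}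
    (hc : ∀ i j, Commute (PowerSeries.coeff i f) (PowerSeries.coeff j f)) (j : ℕ) :
    euler (f ^ (j + 1)) = (j + 1 : ℕ) • (euler f * f ^ j) := by
  induction j with
  | zero => simp
  | succ j ih =>
    rw [pow_succ, euler_mul, ih, ((commute_euler hc).pow_left (j + 1)).eq, smul_mul_assoc,
      mul_assoc, ← pow_succ, add_smul (j + 1) 1, one_smul]

theorem coeff_pow_of_lt {f : PowerSeries A} (hf : PowerSeries.coeff 0 f = 0) (j k : ℕ)
    (h : k < j) : PowerSeries.coeff k (f ^ j) = 0 := by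
  induction j generalizing k with
  | zero => omega
  | succ j ih =>
    rw [pow_succ, PowerSeries.coeff_mul]
    refine Finset.sum_eq_zero fun p hp => ?_
    rw [Finset.HasAntidiagonal.mem_antidiagonal] at hp
    rcases Nat.eq_zero_or_pos p.2 with h0 | h0
    · rw [h0, hf, mul_zero]
    · rw [ih _ (by omega), zero_mul]

@[simp] theorem coeff_zero_expSeries (f : PowerSeries A) :
    PowerSeries.coeff 0 (expSeries K f) = 1 := by
  simp [expSeries]

/-- The differential equation `z F' = (z f') F` of `F = exp f`. -/
theorem euler_expSeries [CharZero K] {f : PowerSeries A} (hf : PowerSeries.coeff 0 f = 0)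
    (hc : ∀ i j, Commute (PowerSeries.coeff i f) (PowerSeries.coeff j f)) :
    euler (expSeries K f) = euler f * expSeries K f := by
  ext k
  rw [coeff_euler, PowerSeries.coeff_mul]
  simp only [expSeries, PowerSeries.coeff_mk]
  have h1 : ∀ j, (k : A) * PowerSeries.coeff k (f ^ (j + 1)) =
      (j + 1 : ℕ) • PowerSeries.coeff k (euler f * f ^ j) := by
    intro j
    rw [← coeff_euler, euler_pow hc, map_nsmul]
  have h2 : ∀ j, (k : A) * (((j + 1).factorial : K)⁻¹ • PowerSeries.coeff k (f ^ (j + 1))) =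
      ((j.factorial : K)⁻¹ • PowerSeries.coeff k (euler f * f ^ j)) := by
    intro j
    rw [mul_smul_comm, h1, ← Nat.cast_smul_eq_nsmul K, smul_smul, Nat.factorial_succ]
    congr 1
    have : ((j + 1 : ℕ) : K) ≠ 0 := by exact_mod_cast Nat.succ_ne_zero j
    have : (j.factorial : K) ≠ 0 := by exact_mod_cast Nat.factorial_ne_zero j
    push_cast at *
    field_simp
  rw [Finset.mul_sum, Finset.sum_range_succ']
  simp only [h2]
  have h3 : (k : A) * (((Nat.factorial 0 : ℕ) : K)⁻¹ • PowerSeries.coeff k (f ^ 0)) = 0 := by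
    rcases Nat.eq_zero_or_pos k with h | h
    · simp [h]
    · simp [PowerSeries.coeff_one, h.ne']
  rw [h3, add_zero]
  simp only [PowerSeries.coeff_mul, Finset.smul_sum]
  rw [Finset.sum_comm]
  refine Finset.sum_congr rfl fun p hp => ?_
  rw [Finset.HasAntidiagonal.mem_antidiagonal] at hp
  rcases Nat.eq_zero_or_pos p.1 with h0 | h0
  · simp [h0]
  rw [Finset.mul_sum]
  have hs : Finset.range (p.2 + 1) ⊆ Finset.range k := by
    intro x; simp only [Finset.mem_range]; omega
  rw [← Finset.sum_subset hs]
  · exact Finset.sum_congr rfl fun j _ => (mul_smul_comm _ _ _).symm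
  · intro j _ hj
    rw [Finset.mem_range] at hj
    rw [coeff_pow_of_lt hf _ _ (by omega), mul_zero, smul_zero]

/-- The recursion `k F_k = ∑ i f_i F_{k-i}` for the coefficients of `F = exp f`. -/
theorem coeff_expSeries_rec [CharZero K] {f : PowerSeries A} (hf : PowerSeries.coeff 0 f = 0)
    (hc : ∀ i j, Commute (PowerSeries.coeff i f) (PowerSeries.coeff j f)) (k : ℕ) :
    (k : A) * PowerSeries.coeff k (expSeries K f) =
      ∑ p ∈ Finset.HasAntidiagonal.antidiagonal k, (p.1 : A) * PowerSeries.coeff p.1 f *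
        PowerSeries.coeff p.2 (expSeries K f) := by
  have := congrArg (PowerSeries.coeff k) (euler_expSeries (K := K) hf hc)
  rw [coeff_euler, PowerSeries.coeff_mul] at this
  simpa using this

theorem map_expSeries {B : Type*} [Ring B] [Algebra K B] (φ : A →ₐ[K] B) (f : PowerSeries A) :
    PowerSeries.map (φ : A →+* B) (expSeries K f) =
      expSeries K (PowerSeries.map (φ : A →+* B) f) := by
  ext k
  simp [expSeries, ← map_pow]

theorem expSeries_zero : expSeries K (0 : PowerSeries A) = 1 := by
  ext k
  rw [expSeries, PowerSeries.coeff_mk, Finset.sum_eq_single 0]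
  · simp
  · intro j _ hj; simp [hj]
  · simp

end Exp

section Lin

variable {K : Type*} [Field K]

/-- `-log (1 - a z) = ∑ a^n z^n / n`. -/
def logLin (a : K) : PowerSeries K := PowerSeries.mk fun n => a ^ n / n

@[simp] theorem coeff_logLin (a : K) (n : ℕ) : PowerSeries.coeff n (logLin a) = a ^ n / n := by
  simp [logLin]

@[simp] theorem coeff_zero_lin (a : K) : PowerSeries.coeff 0 (lin a) = 1 := by
  simp [lin]

theorem lin_ne_zero (a : K) : lin a ≠ 0 := by
  intro h
  have := coeff_zero_lin a
  rw [h] at this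
  simp at this

theorem lin_mul_inv (a : K) : lin a * (lin a)⁻¹ = 1 :=
  PowerSeries.mul_inv_cancel _ (by simp [lin])

theorem lin_mul_geom (a : K) : lin a * PowerSeries.mk (fun n => a ^ n) = 1 := by
  ext k
  rw [lin, sub_mul, one_mul, mul_assoc, map_sub, PowerSeries.coeff_C_mul, PowerSeries.coeff_mk]
  cases k with
  | zero => simp
  | succ k =>
    rw [PowerSeries.coeff_succ_X_mul, PowerSeries.coeff_mk, PowerSeries.coeff_one]
    simp [pow_succ']

theorem lin_inv_eq (a : K) : (lin a)⁻¹ = PowerSeries.mk (fun n => a ^ n) := by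
  apply mul_left_cancel₀ (lin_ne_zero a)
  rw [lin_mul_inv, lin_mul_geom]

end Lin

section ExpField

variable {K : Type*} [Field K] [CharZero K]

/-- The differential equation `z F' = f F` and the constant coefficient determine `F`. -/
theorem eq_of_euler_eq {f F G : PowerSeries K} (hf : PowerSeries.coeff 0 f = 0)
    (hF : euler F = f * F) (hG : euler G = f * G)
    (h0 : PowerSeries.coeff 0 F = PowerSeries.coeff 0 G) : F = G := by
  ext k
  induction k using Nat.strong_induction_on with
  | _ k ih =>
    rcases Nat.eq_zero_or_pos k with hk | hk
    · rw [hk]; exact h0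
    have hk' : (k : K) ≠ 0 := by exact_mod_cast hk.ne'
    apply mul_left_cancel₀ hk'
    rw [← coeff_euler, ← coeff_euler, hF, hG, PowerSeries.coeff_mul, PowerSeries.coeff_mul]
    refine Finset.sum_congr rfl fun p hp => ?_
    rw [Finset.HasAntidiagonal.mem_antidiagonal] at hp
    rcases Nat.eq_zero_or_pos p.1 with h | h
    · rw [h, hf, zero_mul, zero_mul]
    · rw [ih _ (by omega)]

theorem coeff_zero_euler (f : PowerSeries K) : PowerSeries.coeff 0 (euler f) = 0 := by simp

theorem eq_expSeries {f F : PowerSeries K} (hf : PowerSeries.coeff 0 f = 0)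
    (hF : euler F = euler f * F) (h0 : PowerSeries.coeff 0 F = 1) : F = expSeries K f :=
  eq_of_euler_eq (coeff_zero_euler f) hF
    (euler_expSeries hf fun _ _ => Commute.all _ _) (by simp [h0])

theorem expSeries_add {f g : PowerSeries K} (hf : PowerSeries.coeff 0 f = 0)
    (hg : PowerSeries.coeff 0 g = 0) :
    expSeries K (f + g) = expSeries K f * expSeries K g := by
  symm
  apply eq_expSeries (by rw [map_add, hf, hg, add_zero])
  · rw [euler_mul, euler_expSeries hf fun _ _ => Commute.all _ _,
      euler_expSeries hg fun _ _ => Commute.all _ _, euler_add]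
    ring
  · simp [PowerSeries.coeff_mul]

theorem expSeries_sum {ι : Type*} (s : Finset ι) (f : ι → PowerSeries K)
    (hf : ∀ i ∈ s, PowerSeries.coeff 0 (f i) = 0) :
    expSeries K (∑ i ∈ s, f i) = ∏ i ∈ s, expSeries K (f i) := by
  classical
  induction s using Finset.induction_on with
  | empty => simp [expSeries_zero]
  | insert a s ha ih =>
    rw [Finset.sum_insert ha, Finset.prod_insert ha, expSeries_add, ih]
    · exact fun i hi => hf i (Finset.mem_insert_of_mem hi)
    · exact hf a (Finset.mem_insert_self _ _)
    · rw [map_sum]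
      exact Finset.sum_eq_zero fun i hi => hf i (Finset.mem_insert_of_mem hi)

theorem expSeries_neg_logLin (a : K) : expSeries K (-logLin a) = lin a := by
  symm
  apply eq_expSeries (by rw [map_neg, coeff_logLin]; simp)
  · have h : euler (-logLin a) * lin a = euler (lin a) * ((lin a)⁻¹ * lin a) := by
      rw [← mul_assoc]
      congr 1
      rw [lin_inv_eq]
      ext k
      have h1 : euler (lin a) = -(PowerSeries.C a * PowerSeries.X) := by
        ext k
        rw [lin, coeff_euler, map_sub, map_neg, PowerSeries.coeff_C_mul, PowerSeries.coeff_X,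
          PowerSeries.coeff_one]
        rcases k with _ | _ | k <;> simp
      rw [h1, neg_mul, mul_assoc, map_neg, PowerSeries.coeff_C_mul]
      cases k with
      | zero => simp
      | succ k =>
        rw [PowerSeries.coeff_succ_X_mul, PowerSeries.coeff_mk]
        have : (((k + 1 : ℕ)) : K) ≠ 0 := by exact_mod_cast Nat.succ_ne_zero k
        simp only [coeff_euler, map_neg, coeff_logLin]
        field_simp
        ring
    rw [h, mul_comm (lin a)⁻¹, lin_mul_inv, mul_one]
  · simp

theorem expSeries_logLin (a : K) : expSeries K (logLin a) = (lin a)⁻¹ := by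
  apply mul_left_cancel₀ (lin_ne_zero a)
  rw [lin_mul_inv, ← expSeries_neg_logLin, ← expSeries_add (by rw [map_neg, coeff_logLin]; simp)
    (by rw [coeff_logLin]; simp), neg_add_cancel,
    expSeries_zero]

end ExpField

/-! ### Commutators from exponentiated commutation relations -/

section Antidiagonal

variable {M : Type*} [AddCommMonoid M]

theorem sum_antidiagonal_assoc (F : ℕ → ℕ → ℕ → M) (k : ℕ) :
    ∑ p ∈ Finset.HasAntidiagonal.antidiagonal k,
      ∑ q ∈ Finset.HasAntidiagonal.antidiagonal p.1, F q.1 q.2 p.2 =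
    ∑ p ∈ Finset.HasAntidiagonal.antidiagonal k,
      ∑ q ∈ Finset.HasAntidiagonal.antidiagonal p.2, F p.1 q.1 q.2 := by
  rw [Finset.sum_sigma', Finset.sum_sigma']
  refine Finset.sum_nbij' (fun x => ⟨(x.2.1, x.2.2 + x.1.2), (x.2.2, x.1.2)⟩)
    (fun x => ⟨(x.1.1 + x.2.1, x.2.2), (x.1.1, x.2.1)⟩) ?_ ?_ ?_ ?_ ?_
  · rintro ⟨⟨a, b⟩, ⟨c, d⟩⟩; simp; omega
  · rintro ⟨⟨a, b⟩, ⟨c, d⟩⟩; simp; omega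
  · rintro ⟨⟨a, b⟩, ⟨c, d⟩⟩ h; simp at h; simp [h.2]
  · rintro ⟨⟨a, b⟩, ⟨c, d⟩⟩ h; simp at h; simp [h.2]
  · rintro ⟨⟨a, b⟩, ⟨c, d⟩⟩ h; rfl

theorem sum_antidiagonal_left_comm (F : ℕ → ℕ → ℕ → M) (k : ℕ) :
    ∑ p ∈ Finset.HasAntidiagonal.antidiagonal k,
      ∑ q ∈ Finset.HasAntidiagonal.antidiagonal p.2, F p.1 q.1 q.2 =
    ∑ p ∈ Finset.HasAntidiagonal.antidiagonal k,
      ∑ q ∈ Finset.HasAntidiagonal.antidiagonal p.2, F q.1 p.1 q.2 := by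
  rw [← sum_antidiagonal_assoc, ← sum_antidiagonal_assoc (fun a b c => F b a c)]
  refine Finset.sum_congr rfl fun p _ => ?_
  rw [← Finset.Nat.sum_antidiagonal_swap]
  rfl

end Antidiagonal

section Commutator

variable {K V W : Type*} [Field K] [CharZero K] [AddCommGroup V] [Module K V]
  [AddCommGroup W] [Module K W]

/-- Let `D(z) = exp (∑ g_n a_n z^n)` on `V` and `D'(z) = exp (∑ g_n b_n z^n)` on `W`, each given
by the recursion for its coefficients, and let the scalar series
`B₁`, `B₂` be `exp (∑ g_n c_n z^n)` with `c = c₁`, `c = c₂`.  If `B₁ D' T = B₂ T D`, then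
`b_n T - T a_n = (c₂ - c₁)_n T` for all `n > 0`: take logarithms. -/
theorem commutator_of_exp_commutator (T : V →ₗ[K] W) (D a : ℕ → Module.End K V)
    (D' b : ℕ → Module.End K W) (g c₁ c₂ B₁ B₂ : ℕ → K)
    (hD0 : D 0 = 1) (hD'0 : D' 0 = 1) (hB₁0 : B₁ 0 = 1) (hB₂0 : B₂ 0 = 1)
    (hD : ∀ k : ℕ, (k : K) • D k =
      ∑ p ∈ Finset.HasAntidiagonal.antidiagonal k, (p.1 * g p.1 : K) • (a p.1 * D p.2))
    (hD' : ∀ k : ℕ, (k : K) • D' k =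
      ∑ p ∈ Finset.HasAntidiagonal.antidiagonal k, (p.1 * g p.1 : K) • (b p.1 * D' p.2))
    (hB₁ : ∀ k : ℕ, (k : K) * B₁ k =
      ∑ p ∈ Finset.HasAntidiagonal.antidiagonal k, (p.1 * g p.1 : K) * (c₁ p.1 * B₁ p.2))
    (hB₂ : ∀ k : ℕ, (k : K) * B₂ k =
      ∑ p ∈ Finset.HasAntidiagonal.antidiagonal k, (p.1 * g p.1 : K) * (c₂ p.1 * B₂ p.2))
    (hg : ∀ k, 0 < k → g k ≠ 0)
    (hrel : ∀ k v, ∑ p ∈ Finset.HasAntidiagonal.antidiagonal k, B₁ p.1 • D' p.2 (T v) =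
      ∑ p ∈ Finset.HasAntidiagonal.antidiagonal k, B₂ p.1 • T (D p.2 v))
    (k : ℕ) (hk : 0 < k) (v : V) : b k (T v) = T (a k v) + (c₂ k - c₁ k) • T v := by
  induction k using Nat.strong_induction_on generalizing v with
  | _ k ih =>
  -- `k G_k`, for the common value `G_k` of the two sides of `hrel`, in two ways
  have e1 : (k : K) • ∑ p ∈ Finset.HasAntidiagonal.antidiagonal k, B₁ p.1 • D' p.2 (T v) =
      ∑ p ∈ Finset.HasAntidiagonal.antidiagonal k, (p.1 * g p.1 : K) •
        (c₁ p.1 • (∑ q ∈ Finset.HasAntidiagonal.antidiagonal p.2, B₁ q.1 • D' q.2 (T v)) +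
          b p.1 (∑ q ∈ Finset.HasAntidiagonal.antidiagonal p.2, B₁ q.1 • D' q.2 (T v))) := by
    have h1 : (k : K) • ∑ p ∈ Finset.HasAntidiagonal.antidiagonal k, B₁ p.1 • D' p.2 (T v) =
        ∑ p ∈ Finset.HasAntidiagonal.antidiagonal k, ((((p.1 : K) * B₁ p.1) • D' p.2 (T v)) +
          B₁ p.1 • (((p.2 : K) • D' p.2) (T v))) := by
      rw [Finset.smul_sum]
      refine Finset.sum_congr rfl fun p hp => ?_
      rw [Finset.HasAntidiagonal.mem_antidiagonal] at hp
      rw [← hp, LinearMap.smul_apply, Nat.cast_add]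
      module
    rw [h1]
    simp only [hB₁, hD', LinearMap.sum_apply, LinearMap.smul_apply, Module.End.mul_apply,
      Finset.sum_add_distrib, smul_add, Finset.sum_smul, Finset.smul_sum, map_sum, map_smul]
    congr 1
    · rw [sum_antidiagonal_assoc fun i j l =>
        (((i : K) * g i) * (c₁ i * B₁ j)) • D' l (T v)]
      refine Finset.sum_congr rfl fun p _ => Finset.sum_congr rfl fun q _ => ?_
      module
    · rw [sum_antidiagonal_left_comm fun i j l => B₁ i • (((j : K) * g j) • b j (D' l (T v)))]
      refine Finset.sum_congr rfl fun p _ => Finset.sum_congr rfl fun q _ => ?_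
      module
  have e2 : (k : K) • ∑ p ∈ Finset.HasAntidiagonal.antidiagonal k, B₂ p.1 • T (D p.2 v) =
      ∑ p ∈ Finset.HasAntidiagonal.antidiagonal k, (p.1 * g p.1 : K) •
        (c₂ p.1 • (∑ q ∈ Finset.HasAntidiagonal.antidiagonal p.2, B₂ q.1 • T (D q.2 v)) +
          ∑ q ∈ Finset.HasAntidiagonal.antidiagonal p.2, B₂ q.1 • T (a p.1 (D q.2 v))) := by
    have h1 : (k : K) • ∑ p ∈ Finset.HasAntidiagonal.antidiagonal k, B₂ p.1 • T (D p.2 v) =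
        ∑ p ∈ Finset.HasAntidiagonal.antidiagonal k, ((((p.1 : K) * B₂ p.1) • T (D p.2 v)) +
          B₂ p.1 • T (((p.2 : K) • D p.2) v)) := by
      rw [Finset.smul_sum]
      refine Finset.sum_congr rfl fun p hp => ?_
      rw [Finset.HasAntidiagonal.mem_antidiagonal] at hp
      rw [← hp, LinearMap.smul_apply, map_smul, Nat.cast_add]
      module
    rw [h1]
    simp only [hB₂, hD, LinearMap.sum_apply, LinearMap.smul_apply, Module.End.mul_apply,
      Finset.sum_add_distrib, smul_add, Finset.sum_smul, Finset.smul_sum, map_sum, map_smul]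
    congr 1
    · rw [sum_antidiagonal_assoc fun i j l =>
        (((i : K) * g i) * (c₂ i * B₂ j)) • T (D l v)]
      refine Finset.sum_congr rfl fun p _ => Finset.sum_congr rfl fun q _ => ?_
      module
    · rw [sum_antidiagonal_left_comm fun i j l => B₂ i • (((j : K) * g j) • T (a j (D l v)))]
      refine Finset.sum_congr rfl fun p _ => Finset.sum_congr rfl fun q _ => ?_
      module
  rw [hrel, e2] at e1
  simp only [hrel] at e1
  have hmem : (k, 0) ∈ Finset.HasAntidiagonal.antidiagonal k := by simp
  rw [← Finset.add_sum_erase _ _ hmem, ← Finset.add_sum_erase _ _ hmem] at e1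
  have h3 : ∀ p ∈ (Finset.HasAntidiagonal.antidiagonal k).erase (k, 0),
      ((p.1 : K) * g p.1) •
        (c₂ p.1 • (∑ q ∈ Finset.HasAntidiagonal.antidiagonal p.2, B₂ q.1 • T (D q.2 v)) +
          ∑ q ∈ Finset.HasAntidiagonal.antidiagonal p.2, B₂ q.1 • T (a p.1 (D q.2 v))) =
      ((p.1 : K) * g p.1) •
        (c₁ p.1 • (∑ q ∈ Finset.HasAntidiagonal.antidiagonal p.2, B₂ q.1 • T (D q.2 v)) +
          b p.1 (∑ q ∈ Finset.HasAntidiagonal.antidiagonal p.2, B₂ q.1 • T (D q.2 v))) := by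
    rintro ⟨i, j⟩ hp
    simp only [Finset.mem_erase, Finset.HasAntidiagonal.mem_antidiagonal, ne_eq,
      Prod.mk.injEq] at hp
    rcases Nat.eq_zero_or_pos i with hi | hi
    · simp [hi]
    congr 1
    simp only [map_sum, map_smul, Finset.smul_sum]
    rw [← Finset.sum_add_distrib, ← Finset.sum_add_distrib]
    refine Finset.sum_congr rfl fun q _ => ?_
    rw [ih i (by omega) hi]
    module
  rw [Finset.sum_congr rfl h3] at e1
  have h4 := add_right_cancel e1
  have hk' : ((k : K) * g k) ≠ 0 := mul_ne_zero (by exact_mod_cast hk.ne') (hg k hk)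
  have h5 := smul_right_injective W hk' h4
  simp only [Finset.Nat.antidiagonal_zero, Finset.sum_singleton, hB₂0, hD0, one_smul,
    Module.End.one_apply] at h5
  rw [sub_smul]
  rw [← sub_eq_zero] at h5 ⊢
  rw [← neg_eq_zero, ← h5]
  abel

end Commutator

/-! ### The Fock space and its inner product -/

theorem finsupp_prod_add_single {R : Type*} [CommMonoid R] {f : ℕ+ → ℕ → R}
    (h0 : ∀ n, f n 0 = 1) (a : FockIdx) (n : ℕ+) :
    (a + Finsupp.single n 1).prod f * f n (a n) = f n (a n + 1) * a.prod f := by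
  classical
  have h1 : a.prod f = ∏ i ∈ insert n a.support, f i (a i) :=
    Finsupp.prod_of_support_subset _ (Finset.subset_insert _ _) _ fun i _ => h0 i
  have h2 : (a + Finsupp.single n 1).prod f =
      ∏ i ∈ insert n a.support, f i ((a + Finsupp.single n 1 : FockIdx) i) := by
    refine Finsupp.prod_of_support_subset _ ?_ _ fun i _ => h0 i
    intro i hi
    rw [Finset.mem_insert, Finsupp.mem_support_iff]
    by_contra hc
    push Not at hc
    rw [Finsupp.mem_support_iff, Finsupp.add_apply, hc.2, Finsupp.single_eq_of_ne hc.1] at hi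
    exact hi rfl
  rw [h1, h2, ← Finset.mul_prod_erase _ _ (Finset.mem_insert_self n a.support),
    ← Finset.mul_prod_erase _ (fun i => f i (a i)) (Finset.mem_insert_self n a.support)]
  have h3 : ∏ i ∈ (insert n a.support).erase n, f i ((a + Finsupp.single n 1 : FockIdx) i) =
      ∏ i ∈ (insert n a.support).erase n, f i (a i) := by
    refine Finset.prod_congr rfl fun i hi => ?_
    rw [Finsupp.add_apply, Finsupp.single_eq_of_ne (Finset.ne_of_mem_erase hi), add_zero]
  rw [h3, Finsupp.add_apply, Finsupp.single_eq_same]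
  ac_rfl

theorem fockIdx_induction {P : FockIdx → Prop} (h0 : P 0)
    (h1 : ∀ a n, P a → P (a + Finsupp.single n 1)) (a : FockIdx) : P a := by
  induction a using Finsupp.induction with
  | zero => exact h0
  | single_add n k a _ _ ih =>
    clear * - h1 ih
    induction k with
    | zero => simpa using ih
    | succ k ihk =>
      have := h1 _ n ihk
      rwa [add_assoc, add_comm a, ← add_assoc, ← Finsupp.single_add] at this

theorem wt_eq_weight (c : FockIdx) : Finsupp.weight (fun n : ℕ+ => (n : ℕ)) c = wt c := by
  rw [Finsupp.weight_apply, wt]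
  exact Finsupp.sum_congr fun n _ => by simp [mul_comm]

@[simp] theorem wt_zero : wt 0 = 0 := by simp [wt]

@[simp] theorem wt_add (a b : FockIdx) : wt (a + b) = wt a + wt b := by
  simp [← wt_eq_weight]

@[simp] theorem wt_single (n : ℕ+) (k : ℕ) : wt (Finsupp.single n k) = n * k := by
  simp [wt]

section Norm

variable {K : Type*} [Field K]

/-- The norm `∏ κ_n^{a_n} a_n!` of the basis state `∏ a_{-n}^{a_n} |0⟩`, where
`[a_n, a_{-n}] = κ_n`. -/
def fockNorm (κ : ℕ+ → K) (a : FockIdx) : K := a.prod fun n k => κ n ^ k * (k.factorial : K)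

@[simp] theorem fockNorm_zero (κ : ℕ+ → K) : fockNorm κ 0 = 1 := by simp [fockNorm]

theorem fockNorm_ne_zero [CharZero K] {κ : ℕ+ → K} (hκ : ∀ n, κ n ≠ 0) (a : FockIdx) :
    fockNorm κ a ≠ 0 := by
  rw [fockNorm, Finsupp.prod, Finset.prod_ne_zero_iff]
  intro n _
  exact mul_ne_zero (pow_ne_zero _ (hκ n)) (by exact_mod_cast Nat.factorial_ne_zero _)

theorem fockNorm_add_single [CharZero K] {κ : ℕ+ → K} (hκ : ∀ n, κ n ≠ 0) (a : FockIdx)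
    (n : ℕ+) :
    fockNorm κ (a + Finsupp.single n 1) = κ n * (a n + 1) * fockNorm κ a := by
  have h := finsupp_prod_add_single (f := fun n k => κ n ^ k * (k.factorial : K))
    (by simp) a n
  have h1 : κ n ^ a n * ((a n).factorial : K) ≠ 0 :=
    mul_ne_zero (pow_ne_zero _ (hκ n)) (by exact_mod_cast Nat.factorial_ne_zero _)
  apply mul_right_cancel₀ h1
  rw [fockNorm, h, Nat.factorial_succ, fockNorm]
  push_cast
  ring

/-- The linear functional on the Fock space with prescribed values on the basis states. -/
def fockEval (S : FockIdx → K) : Fock K →ₗ[K] K :=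
  (MvPolynomial.basisMonomials ℕ+ K).constr K S

theorem fockEval_monomial (S : FockIdx → K) (a : FockIdx) (x : K) :
    fockEval S (MvPolynomial.monomial a x) = x * S a := by
  have : MvPolynomial.monomial a x = x • MvPolynomial.basisMonomials ℕ+ K a := by
    simp [MvPolynomial.smul_monomial]
  rw [this, map_smul, fockEval, Module.Basis.constr_basis, smul_eq_mul]

theorem fockEval_eq_finsum (S : FockIdx → K) (p : Fock K) :
    fockEval S p = ∑ᶠ a, MvPolynomial.coeff a p * S a := by
  rw [finsum_eq_sum_of_support_subset (s := p.support)]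
  · conv_lhs => rw [MvPolynomial.as_sum p, map_sum]
    exact Finset.sum_congr rfl fun i _ => fockEval_monomial _ _ _
  · intro a ha
    rw [Function.mem_support] at ha
    simpa using left_ne_zero_of_mul ha

/-- The inner product for which the basis states are orthogonal of norm `fockNorm`. -/
def fockIp (κ : ℕ+ → K) (x y : Fock K) : K :=
  fockEval (fun a => fockNorm κ a * MvPolynomial.coeff a y) x

theorem fockIp_monomial_left (κ : ℕ+ → K) (a : FockIdx) (y : Fock K) :
    fockIp κ (MvPolynomial.monomial a 1) y = fockNorm κ a * MvPolynomial.coeff a y := by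
  rw [fockIp, fockEval_monomial, one_mul]

theorem fockIp_comm (κ : ℕ+ → K) (x y : Fock K) : fockIp κ x y = fockIp κ y x := by
  rw [fockIp, fockIp, fockEval_eq_finsum, fockEval_eq_finsum]
  exact finsum_congr fun a => by ring

theorem fockIp_sum_right {ι : Type*} (κ : ℕ+ → K) (x : Fock K) (s : Finset ι) (y : ι → Fock K) :
    fockIp κ x (∑ i ∈ s, y i) = ∑ i ∈ s, fockIp κ x (y i) := by
  simp only [fockIp_comm κ x]
  rw [fockIp, map_sum]; rfl

theorem fockIp_smul_right (κ : ℕ+ → K) (x : Fock K) (c : K) (y : Fock K) :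
    fockIp κ x (c • y) = c * fockIp κ x y := by
  simp only [fockIp_comm κ x]
  rw [fockIp, map_smul]; rfl

/-- Two operators are adjoint for `fockIp`. -/
def IsFockAdj (κ : ℕ+ → K) (E F : Module.End K (Fock K)) : Prop :=
  ∀ x y, fockIp κ (E x) y = fockIp κ x (F y)

theorem IsFockAdj.coeff_eq {κ : ℕ+ → K} {E F : Module.End K (Fock K)} (h : IsFockAdj κ E F)
    (a j : FockIdx) :
    fockNorm κ a * MvPolynomial.coeff a (E (MvPolynomial.monomial j 1)) =
      fockNorm κ j * MvPolynomial.coeff j (F (MvPolynomial.monomial a 1)) := by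
  rw [← fockIp_monomial_left, ← fockIp_monomial_left, ← h, fockIp_comm]

theorem isFockAdj_of_monomial {κ : ℕ+ → K} {E F : Module.End K (Fock K)}
    (h : ∀ a j, fockNorm κ a * MvPolynomial.coeff a (E (MvPolynomial.monomial j 1)) =
      fockNorm κ j * MvPolynomial.coeff j (F (MvPolynomial.monomial a 1))) :
    IsFockAdj κ E F := by
  have h1 : ∀ y j, fockIp κ (E (MvPolynomial.monomial j 1)) y =
      fockIp κ (MvPolynomial.monomial j 1) (F y) := by
    intro y j
    rw [MvPolynomial.as_sum y]
    simp only [map_sum, fockIp_sum_right]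
    refine Finset.sum_congr rfl fun a _ => ?_
    have : (MvPolynomial.monomial a) (MvPolynomial.coeff a y) =
      MvPolynomial.coeff a y • MvPolynomial.monomial a (1 : K) := by
      simp [MvPolynomial.smul_monomial]
    rw [this, map_smul, fockIp_smul_right, fockIp_smul_right, fockIp_monomial_left, ← h,
      fockIp_comm, fockIp_monomial_left]
  intro x y
  rw [MvPolynomial.as_sum x, fockIp_comm, fockIp_comm _ _ (F y)]
  simp only [map_sum, fockIp_sum_right]
  refine Finset.sum_congr rfl fun a _ => ?_
  have : (MvPolynomial.monomial a) (MvPolynomial.coeff a x) =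
    MvPolynomial.coeff a x • MvPolynomial.monomial a (1 : K) := by
    simp [MvPolynomial.smul_monomial]
  rw [this, map_smul, fockIp_smul_right, fockIp_smul_right, fockIp_comm, h1, fockIp_comm]

theorem IsFockAdj.mul {κ : ℕ+ → K} {E F E' F' : Module.End K (Fock K)} (h : IsFockAdj κ E F)
    (h' : IsFockAdj κ E' F') : IsFockAdj κ (E * E') (F' * F) := by
  intro x y
  rw [Module.End.mul_apply, Module.End.mul_apply, h, h']

theorem IsFockAdj.smul {κ : ℕ+ → K} {E F : Module.End K (Fock K)} (h : IsFockAdj κ E F) (c : K) :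
    IsFockAdj κ (c • E) (c • F) := by
  intro x y
  rw [LinearMap.smul_apply, LinearMap.smul_apply, fockIp_comm, fockIp_smul_right, fockIp_comm, h,
    fockIp_smul_right]

theorem IsFockAdj.sum {ι : Type*} {κ : ℕ+ → K} (s : Finset ι) {E F : ι → Module.End K (Fock K)}
    (h : ∀ i ∈ s, IsFockAdj κ (E i) (F i)) :
    IsFockAdj κ (∑ i ∈ s, E i) (∑ i ∈ s, F i) := by
  intro x y
  rw [LinearMap.sum_apply, LinearMap.sum_apply, fockIp_comm, fockIp_sum_right, fockIp_sum_right]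
  exact Finset.sum_congr rfl fun i hi => by rw [fockIp_comm, h i hi]

theorem isFockAdj_one (κ : ℕ+ → K) : IsFockAdj κ 1 1 := fun _ _ => rfl

theorem isFockAdj_zero (κ : ℕ+ → K) : IsFockAdj κ 0 0 := by
  simpa using (isFockAdj_one κ).smul 0

end Norm

/-! ### Exponentials of Heisenberg generators -/

section Heisenberg

variable {K : Type*} [Field K]

/-- The commutator `[a_n, a_{-n}] = n (1 - q^n) / (1 - t^n)`. -/
def kap (q t : K) (n : ℕ+) : K := (n : ℕ) * (1 - q ^ (n : ℕ)) / (1 - t ^ (n : ℕ))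

theorem aAnn_monomial (q t : K) (n : ℕ+) (j : FockIdx) :
    aAnn q t n (MvPolynomial.monomial j 1) =
      MvPolynomial.monomial (j - Finsupp.single n 1) (kap q t n * j n) := by
  rw [aAnn, LinearMap.smul_apply]
  change _ • MvPolynomial.pderiv n (MvPolynomial.monomial j 1) = _
  rw [MvPolynomial.pderiv_monomial, MvPolynomial.smul_monomial, one_mul]
  rfl

theorem aCre_monomial (n : ℕ+) (j : FockIdx) (x : K) :
    aCre n (MvPolynomial.monomial j x) = MvPolynomial.monomial (j + Finsupp.single n 1) x := by
  rw [aCre, LinearMap.mulLeft_apply, MvPolynomial.X, MvPolynomial.monomial_mul, one_mul, add_comm]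

theorem isFockAdj_aAnn [CharZero K] {q t : K} (hκ : ∀ n, kap q t n ≠ 0) (n : ℕ+) :
    IsFockAdj (kap q t) (aAnn q t n) (aCre n) := by
  classical
  apply isFockAdj_of_monomial
  intro a j
  rw [aAnn_monomial, aCre_monomial, MvPolynomial.coeff_monomial, MvPolynomial.coeff_monomial]
  by_cases h : a + Finsupp.single n 1 = j
  · subst h
    rw [if_pos rfl, if_pos (by simp), fockNorm_add_single hκ]
    simp
    ring
  · rw [if_neg h]
    by_cases hj : j n = 0
    · simp [hj]
    · have h' : j - Finsupp.single n 1 ≠ a := by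
        intro h'
        apply h
        rw [← h']
        exact tsub_add_cancel_of_le (by rw [Finsupp.single_le_iff]; omega)
      rw [if_neg h', mul_zero, mul_zero]

/-- The generators `a_n'`, `n > 0`, indexed by all natural numbers. -/
def natSeq {A : Type*} [Zero A] (a : ℕ+ → A) (n : ℕ) : A := if h : 0 < n then a ⟨n, h⟩ else 0

theorem natSeq_coe {A : Type*} [Zero A] (a : ℕ+ → A) (n : ℕ+) : natSeq a n = a n := by
  rw [natSeq, dif_pos n.pos]; rfl

theorem natSeq_of_pos {A : Type*} [Zero A] (a : ℕ+ → A) {n : ℕ} (h : 0 < n) :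
    natSeq a n = a ⟨n, h⟩ := by
  simp [natSeq, h]

theorem natSeq_zero {A : Type*} [Zero A] (a : ℕ+ → A) : natSeq a 0 = 0 := by
  simp [natSeq]

theorem expOp_eq (al : ℕ → K) (a : ℕ+ → Module.End K (Fock K)) :
    expOp al a = expSeries K (PowerSeries.mk fun n => al n • natSeq a n) := by
  rw [expOp]
  congr 2
  ext1 n
  rw [natSeq]
  split_ifs <;> simp

theorem coeff_expOp_zero (al : ℕ → K) (a : ℕ+ → Module.End K (Fock K)) :
    PowerSeries.coeff 0 (expOp al a) = 1 := by
  rw [expOp_eq]; exact coeff_zero_expSeries _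

theorem coeff_expOp_rec [CharZero K] (al : ℕ → K) {a : ℕ+ → Module.End K (Fock K)}
    (hc : ∀ i j, Commute (a i) (a j)) (k : ℕ) :
    (k : K) • PowerSeries.coeff k (expOp al a) =
      ∑ p ∈ Finset.HasAntidiagonal.antidiagonal k, (p.1 * al p.1 : K) •
        (natSeq a p.1 * PowerSeries.coeff p.2 (expOp al a)) := by
  have hcomm : ∀ i j, Commute (natSeq a i) (natSeq a j) := by
    intro i j
    unfold natSeq
    split_ifs
    · exact hc _ _
    · exact Commute.zero_right _
    · exact Commute.zero_left _
    · exact Commute.zero_left _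
  have h := coeff_expSeries_rec (K := K) (f := PowerSeries.mk fun n => al n • natSeq a n)
    (by simp [natSeq_zero]) (fun i j => by
      simp only [PowerSeries.coeff_mk]
      exact ((hcomm i j).smul_left _).smul_right _) k
  rw [← expOp_eq] at h
  rw [← nsmul_eq_mul] at h
  rw [Nat.cast_smul_eq_nsmul, h]
  refine Finset.sum_congr rfl fun p _ => ?_
  rw [PowerSeries.coeff_mk, mul_smul, ← nsmul_eq_mul, smul_mul_assoc, smul_mul_assoc,
    Nat.cast_smul_eq_nsmul]

theorem commute_aCre (i j : ℕ+) : Commute (aCre (K := K) i) (aCre j) := by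
  refine LinearMap.ext fun x => ?_
  simp [aCre, mul_left_comm]

theorem aAnn_comm [CharZero K] {q t : K} (hκ : ∀ n, kap q t n ≠ 0) (i j : ℕ+) :
    Commute (aAnn q t i) (aAnn q t j) := by
  refine (MvPolynomial.basisMonomials ℕ+ K).ext fun d => ?_
  refine MvPolynomial.ext _ _ fun a => ?_
  have h1 := ((isFockAdj_aAnn hκ i).mul (isFockAdj_aAnn hκ j)).coeff_eq a d
  have h2 := ((isFockAdj_aAnn hκ j).mul (isFockAdj_aAnn hκ i)).coeff_eq a d
  rw [(commute_aCre j i).eq, ← h2] at h1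
  simpa using mul_left_cancel₀ (fockNorm_ne_zero hκ a) h1

/-- `exp (∑ α_n p_n z^n)`, a power series over the ring of symmetric functions. -/
def crePoly (al : ℕ → K) : PowerSeries (Fock K) :=
  expSeries K (PowerSeries.mk fun n => al n • natSeq MvPolynomial.X n)

theorem coeff_expOp_aCre (al : ℕ → K) (k : ℕ) :
    PowerSeries.coeff k (expOp al aCre) =
      LinearMap.mulLeft K (PowerSeries.coeff k (crePoly al)) := by
  have h := map_expSeries (K := K) (Algebra.lmul K (Fock K))
    (PowerSeries.mk fun n => al n • natSeq MvPolynomial.X n)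
  have h2 : PowerSeries.map (Algebra.lmul K (Fock K) : Fock K →+* Module.End K (Fock K))
      (PowerSeries.mk fun n => al n • natSeq MvPolynomial.X n) =
      PowerSeries.mk fun n => al n • natSeq aCre n := by
    ext1 n
    rw [PowerSeries.coeff_map, PowerSeries.coeff_mk, PowerSeries.coeff_mk]
    simp only [RingHom.coe_coe, map_smul]
    congr 1
    unfold natSeq
    split_ifs
    · rfl
    · simp
  rw [h2, ← expOp_eq] at h
  rw [← h, PowerSeries.coeff_map]
  rfl

theorem isFockAdj_expOp [CharZero K] {q t : K} (hκ : ∀ n, kap q t n ≠ 0) (al : ℕ → K) (k : ℕ) :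
    IsFockAdj (kap q t) (PowerSeries.coeff k (expOp al (aAnn q t)))
      (PowerSeries.coeff k (expOp al aCre)) := by
  have hc : ∀ n, IsFockAdj (kap q t) (al n • natSeq (aAnn q t) n) (al n • natSeq aCre n) := by
    intro n
    apply IsFockAdj.smul
    unfold natSeq
    split_ifs
    · exact isFockAdj_aAnn hκ _
    · exact isFockAdj_zero _
  have hp : ∀ j k, IsFockAdj (kap q t)
      (PowerSeries.coeff k ((PowerSeries.mk fun n => al n • natSeq (aAnn q t) n) ^ j))
      (PowerSeries.coeff k ((PowerSeries.mk fun n => al n • natSeq aCre n) ^ j)) := by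
    intro j
    induction j with
    | zero =>
      intro k
      simp only [pow_zero, PowerSeries.coeff_one]
      split_ifs
      · exact isFockAdj_one _
      · exact isFockAdj_zero _
    | succ j ih =>
      intro k
      rw [pow_succ, pow_succ', PowerSeries.coeff_mul, PowerSeries.coeff_mul,
        ← Finset.Nat.sum_antidiagonal_swap (f := fun p : ℕ × ℕ => PowerSeries.coeff p.1
          (PowerSeries.mk fun n => al n • natSeq (aCre (K := K)) n) * PowerSeries.coeff p.2
          ((PowerSeries.mk fun n => al n • natSeq (aCre (K := K)) n) ^ j))]
      apply IsFockAdj.sum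
      intro p _
      simp only [Prod.fst_swap, Prod.snd_swap, PowerSeries.coeff_mk]
      exact (ih _).mul (hc _)
  rw [expOp_eq, expOp_eq, expSeries, expSeries, PowerSeries.coeff_mk, PowerSeries.coeff_mk]
  exact IsFockAdj.sum _ fun j _ => (hp j k).smul _

theorem isWeightedHomogeneous_crePoly (al : ℕ → K) (k : ℕ) :
    MvPolynomial.IsWeightedHomogeneous (fun n : ℕ+ => (n : ℕ))
      (PowerSeries.coeff k (crePoly al)) k := by
  have hc : ∀ n, MvPolynomial.IsWeightedHomogeneous (fun n : ℕ+ => (n : ℕ))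
      (al n • natSeq MvPolynomial.X n : Fock K) n := by
    intro n
    rw [MvPolynomial.smul_eq_C_mul]
    apply MvPolynomial.IsWeightedHomogeneous.C_mul
    unfold natSeq
    split_ifs with h
    · exact MvPolynomial.isWeightedHomogeneous_X K (fun n : ℕ+ => (n : ℕ)) ⟨n, h⟩
    · exact MvPolynomial.isWeightedHomogeneous_zero _ _ _
  have hp : ∀ j k, MvPolynomial.IsWeightedHomogeneous (fun n : ℕ+ => (n : ℕ))
      (PowerSeries.coeff k
        ((PowerSeries.mk fun n => (al n • natSeq MvPolynomial.X n : Fock K)) ^ j)) k := by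
    intro j
    induction j with
    | zero =>
      intro k
      simp only [pow_zero, PowerSeries.coeff_one]
      split_ifs with h
      · rw [h]; exact MvPolynomial.isWeightedHomogeneous_one _ _
      · exact MvPolynomial.isWeightedHomogeneous_zero _ _ _
    | succ j ih =>
      intro k
      rw [pow_succ, PowerSeries.coeff_mul]
      refine MvPolynomial.IsWeightedHomogeneous.sum _ _ _ fun p hp => ?_
      rw [Finset.HasAntidiagonal.mem_antidiagonal] at hp
      rw [PowerSeries.coeff_mk]
      have := (ih p.1).mul (hc p.2)
      rwa [hp] at this
  rw [crePoly, expSeries, PowerSeries.coeff_mk]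
  refine MvPolynomial.IsWeightedHomogeneous.sum _ _ _ fun j _ => ?_
  rw [MvPolynomial.smul_eq_C_mul]
  exact (hp j k).C_mul _

theorem wt_eq_of_coeff_expOp_aCre {al : ℕ → K} {k : ℕ} {c d : FockIdx}
    (h : MvPolynomial.coeff c
      (PowerSeries.coeff k (expOp al aCre) (MvPolynomial.monomial d 1)) ≠ 0) :
    wt c = k + wt d := by
  rw [coeff_expOp_aCre, LinearMap.mulLeft_apply] at h
  have h1 := (isWeightedHomogeneous_crePoly al k).mul
    (MvPolynomial.isWeightedHomogeneous_monomial (R := K) (fun n : ℕ+ => (n : ℕ)) d 1 rfl)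
  rw [← wt_eq_weight, ← wt_eq_weight]
  exact h1 h

theorem wt_eq_of_coeff_expOp_aAnn [CharZero K] {q t : K} (hκ : ∀ n, kap q t n ≠ 0) {al : ℕ → K}
    {k : ℕ} {c d : FockIdx} (h : MvPolynomial.coeff c
      (PowerSeries.coeff k (expOp al (aAnn q t)) (MvPolynomial.monomial d 1)) ≠ 0) :
    wt d = k + wt c := by
  have h1 := (isFockAdj_expOp hκ al k).coeff_eq c d
  refine wt_eq_of_coeff_expOp_aCre (al := al) fun h0 => ?_
  rw [h0, mul_zero] at h1
  exact mul_ne_zero (fockNorm_ne_zero hκ c) h h1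

end Heisenberg

/-! ### Entries of vertex operators -/

section Modes

variable {K : Type*} [Field K] [CharZero K]

theorem expOp_zero (a : ℕ+ → Module.End K (Fock K)) : expOp (fun _ => (0 : K)) a = 1 := by
  have : (PowerSeries.mk fun n => (0 : K) • natSeq a n) = 0 := by ext1 n; simp
  rw [expOp_eq, this, expSeries_zero]

theorem vertexMode_annihilation {q t : K} (hκ : ∀ n, kap q t n ≠ 0) (be : ℕ → K) (k : ℕ)
    (c d : FockIdx) :
    vertexMode q t (fun _ => 0) be (-(k : ℤ)) c d = MvPolynomial.coeff c
      (PowerSeries.coeff k (expOp be (aAnn q t)) (MvPolynomial.monomial d 1)) := by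
  rw [vertexMode, expOp_zero, Finset.sum_eq_single 0]
  · simp only [PowerSeries.coeff_zero_one, one_mul]
    have h1 : ∀ l : ℕ, ((0 : ℕ) : ℤ) - l = -(k : ℤ) ↔ l = k := by intro l; omega
    simp only [h1]
    rw [Finset.sum_ite_eq']
    split_ifs with h
    · rfl
    · by_contra h2
      have := wt_eq_of_coeff_expOp_aAnn hκ (Ne.symm h2)
      rw [Finset.mem_range] at h
      omega
  · intro j _ hj
    refine Finset.sum_eq_zero fun l _ => ?_
    simp [PowerSeries.coeff_one, hj]
  · simp

theorem vertexMode_creation (q t : K) (al : ℕ → K) (k : ℕ) (c d : FockIdx) :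
    vertexMode q t al (fun _ => 0) (k : ℤ) c d = MvPolynomial.coeff c
      (PowerSeries.coeff k (expOp al aCre) (MvPolynomial.monomial d 1)) := by
  rw [vertexMode, expOp_zero, Finset.sum_comm, Finset.sum_eq_single 0]
  · simp only [PowerSeries.coeff_zero_one, mul_one]
    have h1 : ∀ l : ℕ, (l : ℤ) - ((0 : ℕ) : ℤ) = (k : ℤ) ↔ l = k := by intro l; omega
    simp only [h1]
    rw [Finset.sum_ite_eq']
    split_ifs with h
    · rfl
    · by_contra h2
      have := wt_eq_of_coeff_expOp_aCre (Ne.symm h2)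
      rw [Finset.mem_range] at h
      omega
  · intro j _ hj
    refine Finset.sum_eq_zero fun l _ => ?_
    simp [PowerSeries.coeff_one, hj]
  · simp

theorem vertexMode_zero_left {q t : K} (hκ : ∀ n, kap q t n ≠ 0) (al be : ℕ → K) (l : ℕ)
    (d : FockIdx) :
    vertexMode q t al be (-(l : ℤ)) 0 d = fockNorm (kap q t) d *
      MvPolynomial.coeff d (PowerSeries.coeff l (crePoly be)) := by
  have h0 := (isFockAdj_expOp hκ be l).coeff_eq 0 d
  rw [fockNorm_zero, one_mul, coeff_expOp_aCre, LinearMap.mulLeft_apply] at h0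
  rw [MvPolynomial.monomial_zero', MvPolynomial.C_1, mul_one] at h0
  rw [← h0, vertexMode, wt_zero]
  simp only [zero_add, Finset.sum_range_one, coeff_expOp_zero, one_mul]
  have h1 : ∀ i : ℕ, ((0 : ℕ) : ℤ) - i = -(l : ℤ) ↔ i = l := by intro l; omega
  simp only [h1]
  rw [Finset.sum_ite_eq']
  split_ifs with h
  · rfl
  · by_contra h2
    have := wt_eq_of_coeff_expOp_aAnn hκ (Ne.symm h2)
    rw [Finset.mem_range] at h
    omega

theorem vertexMode_zero_left_of_pos {q t : K} (al be : ℕ → K) {m : ℤ} (hm : 0 < m)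
    (d : FockIdx) : vertexMode q t al be m 0 d = 0 := by
  rw [vertexMode, wt_zero]
  refine Finset.sum_eq_zero fun k hk => Finset.sum_eq_zero fun l _ => if_neg ?_
  simp only [zero_add, Finset.range_one, Finset.mem_singleton] at hk
  omega

theorem vertexMode_zero_right_of_neg {q t : K} (al be : ℕ → K) {m : ℤ} (hm : m < 0)
    (c : FockIdx) : vertexMode q t al be m c 0 = 0 := by
  rw [vertexMode, wt_zero]
  refine Finset.sum_eq_zero fun k _ => Finset.sum_eq_zero fun l hl => if_neg ?_
  simp only [zero_add, Finset.range_one, Finset.mem_singleton] at hl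
  omega

end Modes

/-! ### Vertex operators characterized by their commutators -/

section VertexOp

variable {K : Type*} [Field K]

/-- The part that matters below of the statement that the matrix `M` satisfies
`[a_n, M] = c_n M` (field `ann`) and `[a_{-n}, M] = c'_n M` (field `cre`, only for the row
of the vacuum) on a Fock space with `[a_n, a_{-n}] = κ_n`. These relations determine `M` up to the
scalar `M 0 0`. -/
structure IsVertexOp (κ c c' : ℕ+ → K) (M : Matrix FockIdx FockIdx K) : Prop where
  ann : ∀ n a b, κ n * (a n + 1) * M (a + Finsupp.single n 1) b =
    κ n * b n * M a (b - Finsupp.single n 1) + c n * M a b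
  cre : ∀ n b, M 0 (b + Finsupp.single n 1) = -c' n * M 0 b

/-- The coherent-state coefficients `∏ y_n^{b_n} / b_n!`. -/
def coh (y : ℕ+ → K) (b : FockIdx) : K := b.prod fun n k => y n ^ k * ((k.factorial : K))⁻¹

@[simp] theorem coh_zero_idx (y : ℕ+ → K) : coh y 0 = 1 := by simp [coh]

theorem coh_add_single [CharZero K] (y : ℕ+ → K) (b : FockIdx) (n : ℕ+) :
    (b n + 1) * coh y (b + Finsupp.single n 1) = y n * coh y b := by
  classical
  have hf : ∀ k : ℕ, (k.factorial : K) ≠ 0 := fun k => by exact_mod_cast Nat.factorial_ne_zero k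
  have hs : ((b n : K) + 1) ≠ 0 := by exact_mod_cast Nat.succ_ne_zero (b n)
  by_cases hy : y n = 0
  · have h1 : coh y (b + Finsupp.single n 1) = 0 := by
      rw [coh, Finsupp.prod]
      refine Finset.prod_eq_zero (i := n) (by simp) ?_
      simp [hy]
    rw [h1, hy, mul_zero, zero_mul]
  · have h := finsupp_prod_add_single (f := fun n k => y n ^ k * ((k.factorial : K))⁻¹)
      (by simp) b n
    have h1 : y n ^ b n * ((b n).factorial : K)⁻¹ ≠ 0 :=
      mul_ne_zero (pow_ne_zero _ hy) (inv_ne_zero (hf _))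
    apply mul_right_cancel₀ h1
    rw [coh, mul_assoc, h, Nat.factorial_succ, coh]
    push_cast
    field_simp
    ring

/-- `⟨0| M |b⟩ = M_{00} ∏ (-c'_n)^{b_n}`, with the factorials of `coh` undone by `fockNorm 1`. -/
theorem IsVertexOp.zero_left [CharZero K] {κ c c' : ℕ+ → K} {M : Matrix FockIdx FockIdx K}
    (h : IsVertexOp κ c c' M) (b : FockIdx) :
    M 0 b = M 0 0 * b.prod fun n k => (-c' n) ^ k := by
  classical
  induction b using fockIdx_induction with
  | h0 => simp
  | h1 b n ih =>
    rw [h.cre, ih, Finsupp.prod_add_index' (by simp) (fun _ _ _ => pow_add _ _ _)]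
    simp
    ring

theorem IsVertexOp.zero_right [CharZero K] {κ c c' : ℕ+ → K} (hκ : ∀ n, κ n ≠ 0)
    {M : Matrix FockIdx FockIdx K} (h : IsVertexOp κ c c' M) (a : FockIdx) :
    fockNorm κ a * M a 0 = M 0 0 * a.prod fun n k => c n ^ k := by
  classical
  induction a using fockIdx_induction with
  | h0 => simp
  | h1 a n ih =>
    rw [Finsupp.prod_add_index' (by simp) (fun _ _ _ => pow_add _ _ _),
      fockNorm_add_single hκ, mul_assoc, mul_comm (fockNorm κ a), ← mul_assoc, h.ann]
    simp
    linear_combination c n * ih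

end VertexOp

section Derivation

variable {K : Type*} [Field K] [CharZero K]

theorem annihilation_commutator {q t : K} (hκ : ∀ n, kap q t n ≠ 0)
    (M : Matrix FockIdx FockIdx K) (g c₁ c₂ B₁ B₂ : ℕ → K)
    (hB₁0 : B₁ 0 = 1) (hB₂0 : B₂ 0 = 1)
    (hB₁ : ∀ k : ℕ, (k : K) * B₁ k =
      ∑ p ∈ Finset.HasAntidiagonal.antidiagonal k, (p.1 * g p.1 : K) * (c₁ p.1 * B₁ p.2))
    (hB₂ : ∀ k : ℕ, (k : K) * B₂ k =
      ∑ p ∈ Finset.HasAntidiagonal.antidiagonal k, (p.1 * g p.1 : K) * (c₂ p.1 * B₂ p.2))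
    (hg : ∀ k, 0 < k → g k ≠ 0)
    (hrel : ∀ (k : ℕ) a b, ∑ p ∈ Finset.HasAntidiagonal.antidiagonal k, B₁ p.1 *
        ∑ᶠ j, vertexMode q t (fun _ => 0) g (-(p.2 : ℤ)) a j * M j b =
      ∑ p ∈ Finset.HasAntidiagonal.antidiagonal k, B₂ p.1 *
        ∑ᶠ j, M a j * vertexMode q t (fun _ => 0) g (-(p.2 : ℤ)) j b)
    (n : ℕ+) (a b : FockIdx) : kap q t n * (a n + 1) * M (a + Finsupp.single n 1) b =
      kap q t n * b n * M a (b - Finsupp.single n 1) + (c₂ n - c₁ n) * M a b := by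
  let T : Fock K →ₗ[K] Module.Dual K (Fock K) := (MvPolynomial.basisMonomials ℕ+ K).constr K
    fun b => fockEval fun a => fockNorm (kap q t) a * M a b
  have hTb : ∀ b, T (MvPolynomial.monomial b 1) =
      fockEval fun a => fockNorm (kap q t) a * M a b := by
    intro b
    have := (MvPolynomial.basisMonomials ℕ+ K).constr_basis K
      (fun b => (fockEval fun a => fockNorm (kap q t) a * M a b)) b
    simpa using this
  have hTa : ∀ (v : Fock K) (a : FockIdx), T v (MvPolynomial.monomial a 1) =
      fockNorm (kap q t) a * fockEval (M a) v := by
    intro v a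
    have : (LinearMap.applyₗ (MvPolynomial.monomial a (1 : K))).comp T =
        fockNorm (kap q t) a • fockEval (M a) := by
      refine (MvPolynomial.basisMonomials ℕ+ K).ext fun b => ?_
      simp [hTb, fockEval_monomial]
    exact LinearMap.congr_fun this v
  have key := commutator_of_exp_commutator T
    (fun k => PowerSeries.coeff k (expOp g (aAnn q t))) (natSeq (aAnn q t))
    (fun k => LinearMap.dualMap (PowerSeries.coeff k (expOp g (aCre (K := K)))))
    (fun k => LinearMap.dualMap (natSeq (aCre (K := K)) k)) g c₁ c₂ B₁ B₂
    (coeff_expOp_zero _ _) (by rw [coeff_expOp_zero]; rfl) hB₁0 hB₂0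
    (coeff_expOp_rec g (aAnn_comm hκ)) (fun k => by
      refine LinearMap.ext fun f => LinearMap.ext fun x => ?_
      have := LinearMap.congr_fun (coeff_expOp_rec g (commute_aCre (K := K)) k) x
      have h2 := congrArg f this
      simp only [LinearMap.smul_apply, map_smul, LinearMap.sum_apply, map_sum,
        Module.End.mul_apply] at h2
      simp only [LinearMap.smul_apply, LinearMap.sum_apply, Module.End.mul_apply,
        LinearMap.dualMap_apply]
      rw [h2]
      refine Finset.sum_congr rfl fun p _ => ?_
      congr 2
      have h3 : Commute (natSeq (aCre (K := K)) p.1) (PowerSeries.coeff p.2 (expOp g aCre)) := by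
        rw [coeff_expOp_aCre]
        unfold natSeq
        split_ifs
        · refine LinearMap.ext fun x => ?_
          simp [aCre, mul_left_comm]
        · exact Commute.zero_left _
      exact LinearMap.congr_fun h3.eq x) hB₁ hB₂ hg
    (fun k v => by
      have : ∑ p ∈ Finset.HasAntidiagonal.antidiagonal k, B₁ p.1 •
            (LinearMap.dualMap (PowerSeries.coeff p.2 (expOp g (aCre (K := K))))).comp T =
          ∑ p ∈ Finset.HasAntidiagonal.antidiagonal k, B₂ p.1 •
            T.comp (PowerSeries.coeff p.2 (expOp g (aAnn q t))) := by
        refine (MvPolynomial.basisMonomials ℕ+ K).ext fun b =>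
          (MvPolynomial.basisMonomials ℕ+ K).ext fun a => ?_
        have h := congrArg (fun x => fockNorm (kap q t) a * x) (hrel k a b)
        simp only [vertexMode_annihilation hκ, Finset.mul_sum] at h
        simp only [LinearMap.sum_apply, LinearMap.smul_apply, LinearMap.comp_apply,
          LinearMap.dualMap_apply, MvPolynomial.coe_basisMonomials, hTa, smul_eq_mul]
        convert h using 2 with p hp p hp
        · rw [hTb, fockEval_eq_finsum, mul_left_comm]
          congr 1
          have h4 : ∀ j, MvPolynomial.coeff a (PowerSeries.coeff p.2 (expOp g (aAnn q t))
              (MvPolynomial.monomial j 1)) * M j b = (fockNorm (kap q t) a)⁻¹ *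
                (MvPolynomial.coeff j (PowerSeries.coeff p.2 (expOp g aCre)
              (MvPolynomial.monomial a 1)) * (fockNorm (kap q t) j * M j b)) := by
            intro j
            have h5 := (isFockAdj_expOp hκ g p.2).coeff_eq a j
            rw [← mul_assoc (MvPolynomial.coeff _ _), mul_comm (MvPolynomial.coeff _ _)
              (fockNorm _ _), ← h5]
            field_simp [fockNorm_ne_zero hκ a]
          simp only [h4]
          rw [← smul_eq_mul (a := fockNorm (kap q t) a)]
          simp only [← smul_eq_mul (a := (fockNorm (kap q t) a)⁻¹)]
          rw [← smul_finsum, smul_smul, mul_inv_cancel₀ (fockNorm_ne_zero hκ a), one_smul]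
        · rw [fockEval_eq_finsum, mul_left_comm]
          congr 2
          exact finsum_congr fun j => mul_comm _ _
      have h2 := LinearMap.congr_fun this v
      simpa only [LinearMap.sum_apply, LinearMap.smul_apply, LinearMap.comp_apply] using h2)
    n n.pos (MvPolynomial.monomial b 1)
  have key2 := LinearMap.congr_fun key (MvPolynomial.monomial a 1)
  rw [natSeq_coe, natSeq_coe, LinearMap.dualMap_apply, aCre_monomial, LinearMap.add_apply,
    LinearMap.smul_apply, hTa, hTa, hTa, fockEval_monomial, aAnn_monomial, fockEval_monomial,
    fockEval_monomial, fockNorm_add_single hκ] at key2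
  apply mul_left_cancel₀ (fockNorm_ne_zero hκ a)
  rw [smul_eq_mul] at key2
  linear_combination key2

theorem creation_commutator {q t : K}
    (M : Matrix FockIdx FockIdx K) (g c₁ c₂ B₁ B₂ : ℕ → K)
    (hB₁0 : B₁ 0 = 1) (hB₂0 : B₂ 0 = 1)
    (hB₁ : ∀ k : ℕ, (k : K) * B₁ k =
      ∑ p ∈ Finset.HasAntidiagonal.antidiagonal k, (p.1 * g p.1 : K) * (c₁ p.1 * B₁ p.2))
    (hB₂ : ∀ k : ℕ, (k : K) * B₂ k =
      ∑ p ∈ Finset.HasAntidiagonal.antidiagonal k, (p.1 * g p.1 : K) * (c₂ p.1 * B₂ p.2))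
    (hg : ∀ k, 0 < k → g k ≠ 0)
    (hrel : ∀ (k : ℕ) b, ∑ p ∈ Finset.HasAntidiagonal.antidiagonal k, B₁ p.1 *
        ∑ᶠ j, vertexMode q t g (fun _ => 0) (p.2 : ℤ) 0 j * M j b =
      ∑ p ∈ Finset.HasAntidiagonal.antidiagonal k, B₂ p.1 *
        ∑ᶠ j, M 0 j * vertexMode q t g (fun _ => 0) (p.2 : ℤ) j b)
    (n : ℕ+) (b : FockIdx) : M 0 (b + Finsupp.single n 1) = -(c₂ n - c₁ n) * M 0 b := by
  have hzero : ∀ (k : ℕ) j b, vertexMode q t g (fun _ => 0) (k : ℤ) 0 j * M j b =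
      if j = 0 then (if k = 0 then M 0 b else 0) else 0 := by
    intro k j b
    rw [vertexMode_creation]
    by_cases h : MvPolynomial.coeff 0
        (PowerSeries.coeff k (expOp g aCre) (MvPolynomial.monomial j (1 : K))) = 0
    · rw [h, zero_mul]
      split_ifs with h1 h2
      · rw [h1, h2, coeff_expOp_zero] at h
        simp at h
      · rfl
      · rfl
    · have hw := wt_eq_of_coeff_expOp_aCre h
      rw [wt_zero] at hw
      have hk : k = 0 := by omega
      subst hk
      rw [coeff_expOp_zero] at h ⊢
      rw [Module.End.one_apply, MvPolynomial.coeff_monomial] at h ⊢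
      have hj : j = 0 := by by_contra hj; simp [hj] at h
      simp [hj]
  have key := commutator_of_exp_commutator (fockEval (M 0))
    (fun k => PowerSeries.coeff k (expOp g (aCre (K := K)))) (natSeq (aCre (K := K)))
    (fun k => if k = 0 then 1 else 0) (fun _ => 0) g c₁ c₂ B₁ B₂
    (coeff_expOp_zero _ _) (by simp) hB₁0 hB₂0 (coeff_expOp_rec g (commute_aCre (K := K)))
    (fun k => by
      by_cases hk : k = 0
      · simp [hk]
      · simp [hk]) hB₁ hB₂ hg
    (fun k v => by
      have : ∑ p ∈ Finset.HasAntidiagonal.antidiagonal k, B₁ p.1 •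
            ((if p.2 = 0 then 1 else 0 : Module.End K K)).comp (fockEval (M 0)) =
          ∑ p ∈ Finset.HasAntidiagonal.antidiagonal k, B₂ p.1 •
            (fockEval (M 0)).comp (PowerSeries.coeff p.2 (expOp g (aCre (K := K)))) := by
        refine (MvPolynomial.basisMonomials ℕ+ K).ext fun b => ?_
        have h := hrel k b
        simp only [hzero] at h
        simp only [LinearMap.sum_apply, LinearMap.smul_apply, LinearMap.comp_apply,
          MvPolynomial.coe_basisMonomials, smul_eq_mul]
        convert h using 2 with p hp p hp
        · rw [finsum_eq_single _ 0 (fun j hj => by simp [hj]), if_pos rfl]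
          split_ifs <;> simp [fockEval_monomial]
        · rw [fockEval_eq_finsum]
          congr 1
          refine finsum_congr fun j => ?_
          rw [vertexMode_creation, mul_comm]
      have h2 := LinearMap.congr_fun this v
      simpa only [LinearMap.sum_apply, LinearMap.smul_apply, LinearMap.comp_apply] using h2)
    n n.pos (MvPolynomial.monomial b 1)
  rw [natSeq_coe, aCre_monomial, fockEval_monomial, fockEval_monomial, smul_eq_mul] at key
  simp only [LinearMap.zero_apply, one_mul] at key
  linear_combination -key

end Derivation

/-! ### Residues of rational generating functions -/

section Residue

variable {K : Type*} [Field K]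

/-- The polynomial `1 - b X`. -/
def linPoly (b : K) : Polynomial K := 1 - Polynomial.C b * Polynomial.X

theorem coe_linPoly (b : K) : ((linPoly b : Polynomial K) : PowerSeries K) = lin b := by
  simp [linPoly, lin]

theorem eval_linPoly (b x : K) : (linPoly b).eval x = 1 - b * x := by simp [linPoly]

theorem natDegree_linPoly_le (b : K) : (linPoly b).natDegree ≤ 1 := by
  rw [linPoly]
  refine (Polynomial.natDegree_sub_le _ _).trans ?_
  simp only [Polynomial.natDegree_one, zero_le, sup_of_le_right]
  exact (Polynomial.natDegree_C_mul_le _ _).trans Polynomial.natDegree_X_le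

theorem natDegree_prod_linPoly_le {ι : Type*} (s : Finset ι) (b : ι → K) :
    (∏ i ∈ s, linPoly (b i)).natDegree ≤ s.card := by
  refine (Polynomial.natDegree_prod_le _ _).trans ?_
  refine (Finset.sum_le_sum fun i _ => natDegree_linPoly_le (b i)).trans ?_
  simp

theorem coe_prod_linPoly {ι : Type*} (s : Finset ι) (b : ι → K) :
    ((∏ i ∈ s, linPoly (b i) : Polynomial K) : PowerSeries K) = ∏ i ∈ s, lin (b i) := by
  rw [← Polynomial.coeToPowerSeries.ringHom_apply, map_prod]
  exact Finset.prod_congr rfl fun i _ => coe_linPoly _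

theorem coeff_polynomial_mul_geom (p : Polynomial K) {b : K} (hb : b ≠ 0) {m : ℕ}
    (hm : p.natDegree ≤ m) :
    PowerSeries.coeff m ((p : PowerSeries K) * PowerSeries.mk fun n => b ^ n) =
      b ^ m * p.eval b⁻¹ := by
  rw [PowerSeries.coeff_mul, Finset.Nat.sum_antidiagonal_eq_sum_range_succ_mk,
    Polynomial.eval_eq_sum_range' (Nat.lt_succ_of_le hm), Finset.mul_sum]
  refine Finset.sum_congr rfl fun i hi => ?_
  rw [Finset.mem_range] at hi
  rw [Polynomial.coeff_coe, PowerSeries.coeff_mk, mul_left_comm, inv_pow]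
  congr 1
  rw [eq_mul_inv_iff_mul_eq₀ (pow_ne_zero _ hb), ← pow_add]
  congr 1
  omega

/-- If the coefficients of a rational function with denominator `∏ (1 - b_i X)` are eventually
`∑ κ_i b_i^m`, then `κ_{i₀}` is the residue at `1 / b_{i₀}`. The `b_i` need not be distinct: the
factors with `i ≠ i₀` annihilate all geometric sequences except the one of `b_{i₀}`. -/
theorem residue_eq {I J : Finset ℕ} {i₀ : ℕ} (hi₀ : i₀ ∈ I) (a b κ : ℕ → K)
    (hb : ∀ i ∈ I, b i ≠ 0) (F : PowerSeries K) (C : K)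
    (hF : (∏ i ∈ I, lin (b i)) * F = PowerSeries.C C * ∏ j ∈ J, lin (a j)) (m₀ : ℕ)
    (hκ : ∀ m, m₀ ≤ m → PowerSeries.coeff m F = ∑ i ∈ I, κ i * b i ^ m) :
    κ i₀ * ∏ i ∈ I.erase i₀, (1 - b i / b i₀) = C * ∏ j ∈ J, (1 - a j / b i₀) := by
  set P : Polynomial K := ∏ i ∈ I.erase i₀, linPoly (b i) with hP
  have hPd : P.natDegree ≤ I.card :=
    (natDegree_prod_linPoly_le _ _).trans (Finset.card_le_card (Finset.erase_subset _ _))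
  set N : Polynomial K := ∏ j ∈ J, linPoly (a j) with hN
  -- beyond the degrees of `P` and `N`, and so large that only geometric coefficients of `F` enter
  set m := m₀ + I.card + J.card with hm
  -- the coefficient of `X^m` in `∏_{i ≠ i₀} (1 - b_i X) F`, once from the geometric sequences and
  -- once, by `e2`, from the denominator `1 - b_{i₀} X` that remains
  have e1 : PowerSeries.coeff m ((P : PowerSeries K) * F) =
      ∑ i ∈ I, κ i * PowerSeries.coeff m ((P : PowerSeries K) * PowerSeries.mk fun n => b i ^ n) := by
    simp only [PowerSeries.coeff_mul, Finset.mul_sum]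
    rw [Finset.sum_comm]
    refine Finset.sum_congr rfl fun p hp => ?_
    rw [Finset.HasAntidiagonal.mem_antidiagonal] at hp
    rw [Polynomial.coeff_coe]
    by_cases h : P.natDegree < p.1
    · simp [Polynomial.coeff_eq_zero_of_natDegree_lt h]
    · rw [hκ _ (by omega), Finset.mul_sum]
      refine Finset.sum_congr rfl fun i _ => ?_
      rw [PowerSeries.coeff_mk]
      ring
  have e2 : (P : PowerSeries K) * F =
      PowerSeries.C C * ((N : PowerSeries K) * PowerSeries.mk fun n => b i₀ ^ n) := by
    rw [← coe_prod_linPoly J a, ← Finset.mul_prod_erase _ _ hi₀, ← coe_prod_linPoly] at hF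
    apply mul_left_cancel₀ (lin_ne_zero (b i₀))
    rw [← mul_assoc, hF, ← lin_inv_eq, mul_left_comm, mul_left_comm (lin (b i₀)), lin_mul_inv,
      mul_one]
  rw [e2, PowerSeries.coeff_C_mul, coeff_polynomial_mul_geom N (hb _ hi₀)
    ((natDegree_prod_linPoly_le _ _).trans (by omega)), Finset.sum_eq_single i₀] at e1
  · rw [coeff_polynomial_mul_geom P (hb _ hi₀) (by omega), hP, hN, Polynomial.eval_prod,
      Polynomial.eval_prod] at e1
    simp only [eval_linPoly, ← div_eq_mul_inv] at e1
    apply mul_left_cancel₀ (pow_ne_zero m (hb _ hi₀))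
    linear_combination -e1
  · intro i hi hne
    rw [coeff_polynomial_mul_geom P (hb _ hi) (by omega), hP, Polynomial.eval_prod,
      Finset.prod_eq_zero (Finset.mem_erase.mpr ⟨hne, hi⟩), mul_zero, mul_zero]
    rw [eval_linPoly, mul_inv_cancel₀ (hb _ hi), sub_self]
  · exact fun h => absurd hi₀ h

end Residue

/-! ### The generating function of a partition -/

theorem rowLen_eq_zero_of_le {lam : YoungDiagram} {i : ℕ} (h : lam.colLen 0 ≤ i) :
    lam.rowLen i = 0 := by
  by_contra h0
  have : (i, 0) ∈ lam := YoungDiagram.mem_iff_lt_rowLen.mpr (Nat.pos_of_ne_zero h0)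
  rw [YoungDiagram.mem_iff_lt_colLen] at this
  omega

theorem rowLen_pos_iff {lam : YoungDiagram} {i : ℕ} : 0 < lam.rowLen i ↔ i < lam.colLen 0 := by
  rw [← YoungDiagram.mem_iff_lt_rowLen, YoungDiagram.mem_iff_lt_colLen]

section Character

variable {K : Type*} [Field K]

/-- `E_λ = 1 - (1 - q) (1 - t⁻¹) ∑_{(i,j) ∈ λ} q^{j-1} t^{1-i}`, summed along the rows. Up to
sign and a factor that does not depend on `λ`, the vertex operators attached to `λ` have the
charges `E_λ(q^n, t^n)`, `E_λ(q^{-n}, t^{-n})`. -/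
def partChar (q t : K) (lam : YoungDiagram) : K :=
  1 - (1 - t⁻¹) * ∑ i ∈ Finset.range (lam.colLen 0), t⁻¹ ^ i * (1 - q ^ lam.rowLen i)

theorem partChar_eq (q t : K) (lam : YoungDiagram) {M : ℕ} (hM : lam.colLen 0 ≤ M) :
    partChar q t lam = t⁻¹ ^ M +
      (1 - t⁻¹) * ∑ i ∈ Finset.range M, t⁻¹ ^ i * q ^ lam.rowLen i := by
  have h1 : ∑ i ∈ Finset.range (lam.colLen 0), t⁻¹ ^ i * (1 - q ^ lam.rowLen i) =
      ∑ i ∈ Finset.range M, t⁻¹ ^ i * (1 - q ^ lam.rowLen i) := by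
    apply Finset.sum_subset (Finset.range_mono hM)
    intro i _ hi
    rw [Finset.mem_range, not_lt] at hi
    rw [rowLen_eq_zero_of_le hi, pow_zero, sub_self, mul_zero]
  have h2 := mul_neg_geom_sum t⁻¹ M
  rw [partChar, h1]
  simp only [mul_sub, mul_one, Finset.sum_sub_distrib]
  linear_combination -h2

/-- The sum of the exponents of the first `M` factors of `B^+_λ` telescopes. -/
theorem seriesBp_exponent_telescope {q t : K} (hq : q ≠ 0) (ht : t ≠ 0) (l : ℕ → ℤ) (M : ℕ) :
    -(q ^ (l 0 - 1) * t) + q ^ l 0 + ∑ i ∈ Finset.range M,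
      (-(q ^ l i * t ^ (-(i : ℤ) - 1)) - q ^ (l (i + 1) - 1) * t ^ (-(i : ℤ)) +
        (q ^ l (i + 1) * t ^ (-(i : ℤ) - 1) + q ^ (l i - 1) * t ^ (-(i : ℤ)))) =
      (1 - t / q) * (t⁻¹ ^ M * q ^ l M +
        (1 - t⁻¹) * ∑ i ∈ Finset.range M, t⁻¹ ^ i * q ^ l i) := by
  have hpow : ∀ i : ℕ, t ^ (-(i : ℤ)) = t⁻¹ ^ i := fun i => by
    rw [zpow_neg, zpow_natCast, inv_pow]
  induction M with
  | zero =>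
    simp [zpow_sub₀ hq]
    field_simp
    ring
  | succ M ih =>
    rw [Finset.sum_range_succ, ← add_assoc, ih, Finset.sum_range_succ, pow_succ]
    simp only [zpow_sub₀ hq, zpow_sub₀ ht, hpow, zpow_one]
    field_simp
    ring

variable [CharZero K]

theorem seriesBp_eq_exp {q t : K} (hq : q ≠ 0) (ht : t ≠ 0) (lam : YoungDiagram) :
    seriesBp q t lam = expSeries K (PowerSeries.mk fun n =>
      (1 - (t / q) ^ n) * partChar (q ^ n) (t ^ n) lam / n) := by
  have hz : ∀ x : K, PowerSeries.coeff 0 (logLin x) = 0 := fun x => by rw [coeff_logLin]; simp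
  have hnz : ∀ x : K, PowerSeries.coeff 0 (-logLin x) = 0 := fun x => by rw [map_neg, hz, neg_zero]
  rw [seriesBp]
  simp only [← expSeries_logLin]
  simp only [← expSeries_neg_logLin]
  have h2 : ∀ x y : K, expSeries K (-logLin x) * expSeries K (-logLin y) =
      expSeries K (-logLin x - logLin y) := fun x y => by
    rw [sub_eq_add_neg, expSeries_add (hnz _) (hnz _)]
  have h3 : ∀ x y : K, expSeries K (-logLin x) * expSeries K (logLin y) =
      expSeries K (-logLin x + logLin y) := fun x y => by rw [expSeries_add (hnz _) (hz _)]
  have h4 : ∀ x y : K, expSeries K (logLin x) * expSeries K (logLin y) =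
      expSeries K (logLin x + logLin y) := fun x y => by rw [expSeries_add (hz _) (hz _)]
  simp only [h2, h3, h4]
  have h5 : ∀ x y z w : K, expSeries K (-logLin x - logLin y) * expSeries K (logLin z + logLin w) =
      expSeries K (-logLin x - logLin y + (logLin z + logLin w)) := fun x y z w => by
    rw [← expSeries_add (by rw [map_sub, hnz, hz, sub_zero])
      (by rw [map_add, hz, hz, add_zero])]
  simp only [h5]
  rw [← expSeries_sum _ _ (fun i _ => by
    rw [map_add, map_sub, map_add, hz, hz, hz, hnz]; ring), ← expSeries_add
    (by rw [map_add, hz, hnz, add_zero])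
    (by
      rw [map_sum]
      refine Finset.sum_eq_zero fun i _ => ?_
      rw [map_add, map_sub, map_add, hz, hz, hz, hnz]; ring)]
  congr 1
  ext n
  rw [PowerSeries.coeff_mk, partChar_eq _ _ _ le_rfl]
  have h6 := seriesBp_exponent_telescope (pow_ne_zero n hq) (pow_ne_zero n ht)
    (fun i => (lam.rowLen i : ℤ)) (lam.colLen 0)
  have hc : ∀ (x : K) (z : ℤ), (x ^ z) ^ n = (x ^ n) ^ z := fun x z => by
    rw [← zpow_natCast, ← zpow_natCast, zpow_comm]
  have hc' : ∀ (x : K) (k : ℕ), (x ^ k) ^ n = (x ^ n) ^ k := fun x k => pow_right_comm x k n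
  simp only [rowLen_eq_zero_of_le le_rfl, Nat.cast_zero, zpow_zero, mul_one, zpow_natCast] at h6
  simp only [zpow_natCast, div_pow] at h6 ⊢
  rw [← h6]
  simp only [map_add, map_sub, map_neg, map_sum, coeff_logLin, mul_pow, hc, add_div, sub_div,
    neg_div, Finset.sum_div, hc']

theorem seriesBm_eq_seriesBp (q t : K) (lam : YoungDiagram) :
    seriesBm q t lam = seriesBp q⁻¹ t⁻¹ lam := by
  have h : ∀ (x : K) (z : ℤ), x⁻¹ ^ z = x ^ (-z) := fun x z => by rw [inv_zpow, zpow_neg]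
  rw [seriesBm, seriesBp]
  simp only [h, neg_sub, neg_neg, sub_neg_eq_add]
  simp only [← neg_add_eq_sub, add_comm (1 : ℤ)]

end Character

/-! ### Commutators of the intertwining operators with the Heisenberg algebra -/

theorem finite_wt_le (d : ℕ) : {c : FockIdx | wt c ≤ d}.Finite := by
  classical
  have hfin : (Finset.finsupp (Finset.Icc (1 : ℕ+) d.succPNat)
    (fun _ => Finset.range (d + 1)) : Set FockIdx).Finite := Finset.finite_toSet _
  refine hfin.subset fun c hc => ?_
  have hle : ∀ n, n ∈ c.support → (n : ℕ) * c n ≤ d := fun n hn =>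
    (Finset.single_le_sum (f := fun n : ℕ+ => (n : ℕ) * c n) (fun _ _ => Nat.zero_le _) hn).trans hc
  rw [Finset.mem_coe, Finset.mem_finsupp_iff]
  constructor
  · intro n hn
    have h1 := hle n hn
    have h2 := Nat.pos_of_ne_zero (Finsupp.mem_support_iff.mp hn)
    rw [Finset.mem_Icc]
    refine ⟨one_le, ?_⟩
    rw [← PNat.coe_le_coe, Nat.succPNat_coe]
    nlinarith
  · intro n _
    rw [Finset.mem_range]
    by_cases hn : c n = 0
    · omega
    · have h1 := hle n (Finsupp.mem_support_iff.mpr hn)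
      have h2 := n.pos
      nlinarith

theorem finsum_prod_eq_right {α β M : Type*} [AddCommMonoid M] (f : α × β → M) (b : β)
    (h : ∀ a b', b' ≠ b → f (a, b') = 0) : ∑ᶠ x, f x = ∑ᶠ a, f (a, b) := by
  have hinj : Function.Injective fun a : α => (a, b) := fun a a' h => (Prod.mk.inj h).1
  rw [← finsum_mem_range (f := f) hinj, ← finsum_mem_univ]
  apply finsum_mem_inter_support_eq
  ext ⟨a, b'⟩
  simp only [Set.mem_inter_iff, Set.mem_univ, Function.mem_support, true_and, Set.mem_range,
    Prod.mk.injEq, exists_eq_left, ne_eq, iff_and_self]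
  intro h0
  by_contra hb
  exact h0 (h a b' fun h' => hb h'.symm)

theorem finsum_prod_eq_left {α β M : Type*} [AddCommMonoid M] (f : α × β → M) (a : α)
    (h : ∀ a' b, a' ≠ a → f (a', b) = 0) : ∑ᶠ x, f x = ∑ᶠ b, f (a, b) := by
  exact (finsum_comp_equiv (Equiv.prodComm β α) (f := f)).symm.trans
    (finsum_prod_eq_right (fun x : β × α => f x.swap) a fun b a' h' => h a' b h')

section Generic

variable {K : Type*} [Field K]

/-- `r` and `s` are nonzero and multiplicatively independent. -/
structure Generic (r s : K) : Prop where
  r_ne : r ≠ 0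
  s_ne : s ≠ 0
  indep : ∀ a b : ℤ, r ^ a * s ^ b = 1 → a = 0 ∧ b = 0

theorem Generic.one_sub_ne {r s : K} (h : Generic r s) (a b : ℤ) (hab : a ≠ 0 ∨ b ≠ 0) :
    1 - (r ^ 4) ^ a * (s ^ 4) ^ b ≠ 0 := by
  intro h0
  have h1 : r ^ (4 * a) * s ^ (4 * b) = 1 := by
    rw [zpow_mul, zpow_mul]
    exact_mod_cast (sub_eq_zero.mp h0).symm
  have := h.indep _ _ h1
  omega

theorem Generic.one_sub_q_ne {r s : K} (h : Generic r s) {n : ℕ} (hn : n ≠ 0) :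
    1 - (r ^ 4) ^ n ≠ 0 := by
  simpa using h.one_sub_ne n 0 (by omega)

theorem Generic.one_sub_t_ne {r s : K} (h : Generic r s) {n : ℕ} (hn : n ≠ 0) :
    1 - (s ^ 4) ^ n ≠ 0 := by
  simpa using h.one_sub_ne 0 n (by omega)

theorem Generic.one_sub_t_inv_ne {r s : K} (h : Generic r s) {n : ℕ} (hn : n ≠ 0) :
    1 - (s ^ 4)⁻¹ ^ n ≠ 0 := by
  simpa using h.one_sub_ne 0 (-n) (by omega)

theorem Generic.one_sub_t_div_q_ne {r s : K} (h : Generic r s) {n : ℕ} (hn : n ≠ 0) :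
    1 - (s ^ 4) ^ n * (r ^ 4) ^ (-(n : ℤ)) ≠ 0 := by
  have := h.one_sub_ne (-n) n (by omega)
  rwa [zpow_natCast, mul_comm] at this

theorem Generic.kap_ne [CharZero K] {r s : K} (h : Generic r s) (n : ℕ+) :
    kap (r ^ 4) (s ^ 4) n ≠ 0 := by
  rw [kap]
  exact div_ne_zero (mul_ne_zero (by exact_mod_cast n.ne_zero) (h.one_sub_q_ne n.ne_zero))
    (h.one_sub_t_ne n.ne_zero)

end Generic

section Charges

variable {K : Type*} [Field K]

/-- The scalar `c_n` in `[a_n, Φ_λ] = c_n Φ_λ`. -/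
def phiAnn (q t v : K) (lam : YoungDiagram) (n : ℕ+) : K :=
  -(v ^ (n : ℕ) * partChar (q ^ (n : ℕ)) (t ^ (n : ℕ)) lam / (1 - t ^ (n : ℕ)))

/-- The scalar `c'_n` in `[a_{-n}, Φ_λ] = c'_n Φ_λ`. -/
def phiCre (q t v : K) (lam : YoungDiagram) (n : ℕ+) : K :=
  -((q / t / v) ^ (n : ℕ) * partChar (q⁻¹ ^ (n : ℕ)) (t⁻¹ ^ (n : ℕ)) lam / (1 - t⁻¹ ^ (n : ℕ)))

variable [CharZero K]

theorem trivial_rec (g : ℕ → K) (k : ℕ) : (k : K) * (if k = 0 then 1 else 0) =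
    ∑ p ∈ Finset.HasAntidiagonal.antidiagonal k, (p.1 * g p.1 : K) *
      ((0 : ℕ → K) p.1 * (if p.2 = 0 then 1 else 0)) := by
  by_cases h : k = 0 <;> simp [h]

theorem sum_antidiagonal_delta (X : ℕ → K) (k : ℕ) :
    ∑ p ∈ Finset.HasAntidiagonal.antidiagonal k, (if p.1 = 0 then 1 else 0) * X p.2 = X k := by
  rw [Finset.sum_eq_single (0, k)]
  · simp
  · rintro ⟨i, j⟩ hp hne
    rw [Finset.HasAntidiagonal.mem_antidiagonal] at hp
    simp only [ite_mul, one_mul, zero_mul, ite_eq_right_iff]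
    rintro rfl
    simp at hp
    exact absurd (by rw [hp]) hne
  · simp

theorem seriesBp_rec {q t : K} (hq : q ≠ 0) (ht : t ≠ 0) (lam : YoungDiagram) (x : K)
    (g c : ℕ → K) (hgc : ∀ n, 0 < n → n * (g n * c n) =
      (1 - (t / q) ^ n) * partChar (q ^ n) (t ^ n) lam * x ^ n) (k : ℕ) :
    (k : K) * (PowerSeries.coeff k (seriesBp q t lam) * x ^ k) =
    ∑ p ∈ Finset.HasAntidiagonal.antidiagonal k, (p.1 * g p.1 : K) *
      (c p.1 * (PowerSeries.coeff p.2 (seriesBp q t lam) * x ^ p.2)) := by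
  rw [seriesBp_eq_exp hq ht, ← mul_assoc, coeff_expSeries_rec (by simp)
    (fun _ _ => Commute.all _ _), Finset.sum_mul]
  refine Finset.sum_congr rfl fun p hp => ?_
  rw [Finset.HasAntidiagonal.mem_antidiagonal] at hp
  rcases Nat.eq_zero_or_pos p.1 with h | h
  · simp [h]
  · have h1 := hgc p.1 h
    have h2 : (p.1 : K) ≠ 0 := by exact_mod_cast h.ne'
    rw [PowerSeries.coeff_mk, mul_div_cancel₀ _ h2]
    have h3 : x ^ k = x ^ p.1 * x ^ p.2 := by rw [← hp, pow_add]
    rw [h3]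
    linear_combination -(PowerSeries.coeff p.2 (expSeries K (PowerSeries.mk fun n =>
      (1 - (t / q) ^ n) * partChar (q ^ n) (t ^ n) lam / n))) * x ^ p.2 * h1

theorem coeff_zero_seriesBp {q t : K} (hq : q ≠ 0) (ht : t ≠ 0) (lam : YoungDiagram) :
    PowerSeries.coeff 0 (seriesBp q t lam) = 1 := by
  rw [seriesBp_eq_exp hq ht]; exact coeff_zero_expSeries _

variable {r s : K}

theorem Generic.annihilation_charge (hG : Generic r s) (lam : YoungDiagram) (v : K) {n : ℕ}
    (hn : 0 < n) :
    (n : K) * (-((1 - (s ^ 4) ^ n) / n * (1 - (s ^ 4) ^ n * (r ^ 4) ^ (-(n : ℤ))) *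
      r ^ (n : ℤ) * s ^ (-(n : ℤ))) *
      -(v ^ n * partChar ((r ^ 4) ^ n) ((s ^ 4) ^ n) lam / (1 - (s ^ 4) ^ n))) =
    (1 - (s ^ 4 / r ^ 4) ^ n) * partChar ((r ^ 4) ^ n) ((s ^ 4) ^ n) lam * (v * r / s) ^ n := by
  have h1 := hG.one_sub_t_ne hn.ne'
  have h2 : (n : K) ≠ 0 := by exact_mod_cast hn.ne'
  have h3 := hG.r_ne
  have h4 := hG.s_ne
  simp only [zpow_neg, zpow_natCast, div_pow, mul_pow]
  field_simp

theorem Generic.creation_charge (hG : Generic r s) (lam : YoungDiagram) {v : K} (hv : v ≠ 0)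
    {n : ℕ} (hn : 0 < n) :
    (n : K) * ((1 - (s ^ 4) ^ (-(n : ℤ))) / n * (1 - (s ^ 4) ^ n * (r ^ 4) ^ (-(n : ℤ))) *
      r ^ (n : ℤ) * s ^ (-(n : ℤ)) *
      -((r ^ 4 / s ^ 4 / v) ^ n * partChar ((r ^ 4)⁻¹ ^ n) ((s ^ 4)⁻¹ ^ n) lam /
        (1 - (s ^ 4)⁻¹ ^ n))) =
    (1 - ((s ^ 4)⁻¹ / (r ^ 4)⁻¹) ^ n) * partChar ((r ^ 4)⁻¹ ^ n) ((s ^ 4)⁻¹ ^ n) lam *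
      (r / s / v) ^ n := by
  have h1 := hG.one_sub_t_inv_ne hn.ne'
  have h2 : (n : K) ≠ 0 := by exact_mod_cast hn.ne'
  have h3 := hG.r_ne
  have h4 := hG.s_ne
  simp only [zpow_neg, zpow_natCast, div_pow, inv_pow] at h1 ⊢
  generalize partChar (((r ^ 4) ^ n)⁻¹) (((s ^ 4) ^ n)⁻¹) lam = E
  have hR0 : r ^ n ≠ 0 := pow_ne_zero _ h3
  have hS0 : s ^ n ≠ 0 := pow_ne_zero _ h4
  rw [pow_right_comm r, pow_right_comm s] at *
  generalize r ^ n = R at *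
  generalize s ^ n = S at *
  have hV0 : v ^ n ≠ 0 := pow_ne_zero _ hv
  have h5 : S ^ 4 - 1 ≠ 0 := by
    intro h6
    apply h1
    rw [sub_eq_zero.mp h6, inv_one, sub_self]
  have h7 : 1 - (S ^ 4)⁻¹ = (S ^ 4 - 1) / S ^ 4 := by field_simp
  rw [h7]
  field_simp
  ring

end Charges

/-! ### The intertwining operators are vertex operators -/

section Intertwiners

variable {K : Type*} [Field K] [CharZero K] {r s : K}

theorem mul_finsum_field {α : Type*} (c : K) (f : α → K) : c * ∑ᶠ a, f a = ∑ᶠ a, c * f a := by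
  simpa using smul_finsum c f

theorem Generic.finite_annihilation_right (hG : Generic r s) (be : ℕ → K) (k : ℕ) (b : FockIdx)
    (f : FockIdx → K) : (Function.support fun j =>
      f j * vertexMode (r ^ 4) (s ^ 4) (fun _ => 0) be (-(k : ℤ)) j b).Finite := by
  refine (finite_wt_le (wt b)).subset fun j hj => ?_
  have h := right_ne_zero_of_mul (Function.mem_support.mp hj)
  rw [vertexMode_annihilation hG.kap_ne] at h
  have := wt_eq_of_coeff_expOp_aAnn hG.kap_ne h
  rw [Set.mem_ofPred_eq]
  omega

theorem Generic.finite_annihilation_left (hG : Generic r s) (be : ℕ → K) (k : ℕ) (a : FockIdx)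
    (f : FockIdx → K) : (Function.support fun j =>
      vertexMode (r ^ 4) (s ^ 4) (fun _ => 0) be (-(k : ℤ)) a j * f j).Finite := by
  refine (finite_wt_le (k + wt a)).subset fun j hj => ?_
  have h := left_ne_zero_of_mul (Function.mem_support.mp hj)
  rw [vertexMode_annihilation hG.kap_ne] at h
  exact (wt_eq_of_coeff_expOp_aAnn hG.kap_ne h).le

theorem finite_creation_right (q t : K) (al : ℕ → K) (k : ℕ) (b : FockIdx)
    (f : FockIdx → K) : (Function.support fun j =>
      f j * vertexMode q t al (fun _ => 0) (k : ℤ) j b).Finite := by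
  refine (finite_wt_le (k + wt b)).subset fun j hj => ?_
  have h := right_ne_zero_of_mul (Function.mem_support.mp hj)
  rw [vertexMode_creation] at h
  exact (wt_eq_of_coeff_expOp_aCre h).le

theorem finite_creation_left (q t : K) (al : ℕ → K) (k : ℕ) (a : FockIdx)
    (f : FockIdx → K) : (Function.support fun j =>
      vertexMode q t al (fun _ => 0) (k : ℤ) a j * f j).Finite := by
  refine (finite_wt_le (wt a)).subset fun j hj => ?_
  have h := left_ne_zero_of_mul (Function.mem_support.mp hj)
  rw [vertexMode_creation] at h
  have := wt_eq_of_coeff_expOp_aCre h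
  rw [Set.mem_ofPred_eq]
  omega

theorem zpow_two_mul_add_one {a : K} (ha : a ≠ 0) (N : ℤ) :
    a ^ (2 * (N + 1)) = a ^ (2 * N) * a ^ 2 := by
  rw [mul_add, zpow_add₀ ha, mul_one]
  norm_cast

theorem zpow_neg_two_mul_add_one {a : K} (ha : a ≠ 0) (N : ℤ) :
    a ^ (-2 * (N + 1)) = a ^ (-2 * N) * (a ^ 2)⁻¹ := by
  rw [mul_add, zpow_add₀ ha, mul_one, zpow_neg]
  norm_cast

/-- `-(1 - t^n) (1 - t^n q^{-n}) (q / t)^{n/4} / n`, the exponent of `φ^+`. -/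
def phipExp (r s : K) (n : ℕ) : K :=
  -((1 - (s ^ 4) ^ n) / n * (1 - (s ^ 4) ^ n * (r ^ 4) ^ (-(n : ℤ))) * r ^ (n : ℤ) * s ^ (-(n : ℤ)))

/-- `(1 - t^{-n}) (1 - t^n q^{-n}) (q / t)^{n/4} / n`, the exponent of `φ^-`. -/
def phimExp (r s : K) (n : ℕ) : K :=
  (1 - (s ^ 4) ^ (-(n : ℤ))) / n * (1 - (s ^ 4) ^ n * (r ^ 4) ^ (-(n : ℤ))) * r ^ (n : ℤ) *
    s ^ (-(n : ℤ))

theorem Generic.phipExp_ne (hG : Generic r s) (n : ℕ) (hn : 0 < n) : phipExp r s n ≠ 0 := by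
  have h2 : (n : K) ≠ 0 := by exact_mod_cast hn.ne'
  exact neg_ne_zero.mpr (mul_ne_zero (mul_ne_zero (mul_ne_zero (div_ne_zero
    (hG.one_sub_t_ne hn.ne') h2) (hG.one_sub_t_div_q_ne hn.ne')) (zpow_ne_zero _ hG.r_ne))
    (zpow_ne_zero _ hG.s_ne))

theorem Generic.phimExp_ne (hG : Generic r s) (n : ℕ) (hn : 0 < n) : phimExp r s n ≠ 0 := by
  have h2 : (n : K) ≠ 0 := by exact_mod_cast hn.ne'
  have h3 : 1 - (s ^ 4) ^ (-(n : ℤ)) ≠ 0 := by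
    simpa using hG.one_sub_t_inv_ne hn.ne'
  exact mul_ne_zero (mul_ne_zero (mul_ne_zero (div_ne_zero
    h3 h2) (hG.one_sub_t_div_q_ne hn.ne')) (zpow_ne_zero _ hG.r_ne))
    (zpow_ne_zero _ hG.s_ne)

variable {N : ℤ} {u v w : K}

theorem IsPhi.psip_rel (hG : Generic r s) {T : Matrix FockIdx (YoungDiagram × FockIdx) K}
    (hT : IsPhi r s N v u w T) (lam : YoungDiagram) (k : ℕ) (a b : FockIdx) :
    ∑ᶠ j, vertexMode (r ^ 4) (s ^ 4) (fun _ => 0) (phipExp r s) (-(k : ℤ)) a j * T j (lam, b) =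
      ∑ p ∈ Finset.HasAntidiagonal.antidiagonal k,
        (PowerSeries.coeff p.1 (seriesBp (r ^ 4) (s ^ 4) lam) * (v * r / s) ^ p.1) *
        ∑ᶠ j, T a (lam, j) *
          vertexMode (r ^ 4) (s ^ 4) (fun _ => 0) (phipExp r s) (-(p.2 : ℤ)) j b := by
  have h3 := hG.r_ne
  have h4 := hG.s_ne
  have h := congrFun (congrFun (hT.intertwines.psip k) a) (lam, b)
  simp only [mmul, horiz, GenAction.tensor, vert, Matrix.smul_apply, smul_eq_mul] at h
  rw [finsum_prod_eq_left _ lam (fun a' b' h' => by simp [h'])] at h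
  have hc : r ^ (2 * (N + 1)) * s ^ (-2 * (N + 1)) ≠ 0 :=
    mul_ne_zero (zpow_ne_zero _ h3) (zpow_ne_zero _ h4)
  apply mul_left_cancel₀ hc
  simp only [mul_assoc (r ^ (2 * (N + 1)) * s ^ (-2 * (N + 1)))] at h
  rw [← mul_finsum_field] at h
  refine h.trans ?_
  simp only [Finset.mul_sum, mul_finsum_field]
  rw [finsum_sum_comm]
  · refine Finset.sum_congr rfl fun p _ => finsum_congr fun j => ?_
    rw [zpow_two_mul_add_one h3, zpow_neg_two_mul_add_one h4, if_pos trivial, one_zpow, mul_div_assoc, mul_pow, zpow_neg, zpow_natCast, ← inv_pow,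
      inv_div]
    unfold phipMode phipExp
    ring
  · intro p _
    refine (hG.finite_annihilation_right (phipExp r s) p.2 b fun j => T a (lam, j)).subset
      fun j hj => ?_
    rw [Function.mem_support] at hj ⊢
    intro h0
    apply hj
    rcases mul_eq_zero.mp h0 with h0 | h0
    · rw [h0, zero_mul]
    · unfold phipMode
      unfold phipExp at h0
      rw [h0]; simp

theorem IsPhi.psim_rel (hG : Generic r s) {T : Matrix FockIdx (YoungDiagram × FockIdx) K}
    (hT : IsPhi r s N v u w T) (lam : YoungDiagram) (k : ℕ) (a b : FockIdx) :
    ∑ᶠ j, vertexMode (r ^ 4) (s ^ 4) (phimExp r s) (fun _ => 0) (k : ℤ) a j * T j (lam, b) =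
      ∑ p ∈ Finset.HasAntidiagonal.antidiagonal k,
        (PowerSeries.coeff p.1 (seriesBp (r ^ 4)⁻¹ (s ^ 4)⁻¹ lam) * (r / s / v) ^ p.1) *
        ∑ᶠ j, T a (lam, j) *
          vertexMode (r ^ 4) (s ^ 4) (phimExp r s) (fun _ => 0) (p.2 : ℤ) j b := by
  have h3 := hG.r_ne
  have h4 := hG.s_ne
  have h := congrFun (congrFun (hT.intertwines.psim k) a) (lam, b)
  simp only [mmul, horiz, GenAction.tensor, vert, Matrix.smul_apply, smul_eq_mul] at h
  rw [finsum_prod_eq_left _ lam (fun a' b' h' => by simp [h'])] at h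
  have hc : r ^ (-2 * (N + 1)) * s ^ (2 * (N + 1)) ≠ 0 :=
    mul_ne_zero (zpow_ne_zero _ h3) (zpow_ne_zero _ h4)
  apply mul_left_cancel₀ hc
  simp only [mul_assoc (r ^ (-2 * (N + 1)) * s ^ (2 * (N + 1)))] at h
  rw [← mul_finsum_field] at h
  refine h.trans ?_
  simp only [Finset.mul_sum, mul_finsum_field]
  rw [finsum_sum_comm]
  · refine Finset.sum_congr rfl fun p _ => finsum_congr fun j => ?_
    rw [zpow_two_mul_add_one h4, zpow_neg_two_mul_add_one h3, if_pos trivial, one_zpow, div_eq_mul_inv _ v, mul_pow, zpow_neg, zpow_natCast,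
      ← inv_pow, inv_div, seriesBm_eq_seriesBp]
    unfold phimMode phimExp
    ring
  · intro p _
    refine (finite_creation_right (r ^ 4) (s ^ 4) (phimExp r s) p.2 b
      fun j => T a (lam, j)).subset fun j hj => ?_
    rw [Function.mem_support] at hj ⊢
    intro h0
    apply hj
    rcases mul_eq_zero.mp h0 with h0 | h0
    · rw [h0, zero_mul]
    · unfold phimMode
      unfold phimExp at h0
      rw [h0]; simp

theorem IsPhi.isVertexOp (hG : Generic r s) (hv : v ≠ 0)
    {T : Matrix FockIdx (YoungDiagram × FockIdx) K}
    (hT : IsPhi r s N v u w T) (lam : YoungDiagram) :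
    IsVertexOp (kap (r ^ 4) (s ^ 4)) (phiAnn (r ^ 4) (s ^ 4) v lam) (phiCre (r ^ 4) (s ^ 4) v lam)
      (fun a b => T a (lam, b)) := by
  have hq : r ^ 4 ≠ 0 := pow_ne_zero _ hG.r_ne
  have ht : s ^ 4 ≠ 0 := pow_ne_zero _ hG.s_ne
  constructor
  · intro n a b
    have := annihilation_commutator hG.kap_ne (fun a b => T a (lam, b)) (phipExp r s) 0
      (fun n => -(v ^ n * partChar ((r ^ 4) ^ n) ((s ^ 4) ^ n) lam / (1 - (s ^ 4) ^ n)))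
      (fun k => if k = 0 then 1 else 0)
      (fun k => PowerSeries.coeff k (seriesBp (r ^ 4) (s ^ 4) lam) * (v * r / s) ^ k)
      (by simp) (by rw [coeff_zero_seriesBp hq ht, pow_zero, one_mul]) (trivial_rec _)
      (seriesBp_rec hq ht lam _ _ _ fun n hn => hG.annihilation_charge lam v hn)
      hG.phipExp_ne (fun k a b => by
        rw [sum_antidiagonal_delta (fun k => ∑ᶠ j, vertexMode (r ^ 4) (s ^ 4) (fun _ => 0)
          (phipExp r s) (-(k : ℤ)) a j * T j (lam, b))]
        exact hT.psip_rel hG lam k a b) n a b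
    rw [Pi.zero_apply, sub_zero] at this
    exact this
  · intro n b
    have := creation_commutator (q := r ^ 4) (t := s ^ 4) (fun a b => T a (lam, b)) (phimExp r s) 0
      (fun n => -((r ^ 4 / s ^ 4 / v) ^ n * partChar ((r ^ 4)⁻¹ ^ n) ((s ^ 4)⁻¹ ^ n) lam /
        (1 - (s ^ 4)⁻¹ ^ n)))
      (fun k => if k = 0 then 1 else 0)
      (fun k => PowerSeries.coeff k (seriesBp (r ^ 4)⁻¹ (s ^ 4)⁻¹ lam) * (r / s / v) ^ k)
      (by simp) (by rw [coeff_zero_seriesBp (inv_ne_zero hq) (inv_ne_zero ht), pow_zero, one_mul])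
      (trivial_rec _)
      (seriesBp_rec (inv_ne_zero hq) (inv_ne_zero ht) lam _ _ _
        fun n hn => hG.creation_charge lam hv hn)
      hG.phimExp_ne (fun k b => by
        rw [sum_antidiagonal_delta (fun k => ∑ᶠ j, vertexMode (r ^ 4) (s ^ 4) (phimExp r s)
          (fun _ => 0) (k : ℤ) 0 j * T j (lam, b))]
        exact hT.psim_rel hG lam k 0 b) n b
    rw [Pi.zero_apply, sub_zero] at this
    exact this

theorem IsPhiStar.psip_rel (hG : Generic r s) {T : Matrix (FockIdx × YoungDiagram) FockIdx K}
    (hT : IsPhiStar r s N w v u T) (lam : YoungDiagram) (k : ℕ) (a b : FockIdx) :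
    ∑ p ∈ Finset.HasAntidiagonal.antidiagonal k,
        (PowerSeries.coeff p.1 (seriesBp (r ^ 4) (s ^ 4) lam) * (u * s / r) ^ p.1) *
        ∑ᶠ j, vertexMode (r ^ 4) (s ^ 4) (fun _ => 0) (phipExp r s) (-(p.2 : ℤ)) a j *
          T (j, lam) b =
      ∑ᶠ j, T (a, lam) j *
        vertexMode (r ^ 4) (s ^ 4) (fun _ => 0) (phipExp r s) (-(k : ℤ)) j b := by
  have h3 := hG.r_ne
  have h4 := hG.s_ne
  have h := congrFun (congrFun (hT.intertwines.psip k) (a, lam)) b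
  simp only [mmul, horiz, GenAction.tensor, vert, Matrix.smul_apply, smul_eq_mul] at h
  rw [finsum_prod_eq_right _ lam (fun a' b' h' => by simp [Ne.symm h'])] at h
  have hc : r ^ (2 * (N + 1)) * s ^ (-2 * (N + 1)) ≠ 0 :=
    mul_ne_zero (zpow_ne_zero _ h3) (zpow_ne_zero _ h4)
  apply mul_left_cancel₀ hc
  simp only [mul_left_comm _ (r ^ (2 * (N + 1)) * s ^ (-2 * (N + 1)))] at h
  rw [← mul_finsum_field] at h
  refine Eq.trans ?_ h
  simp only [Finset.mul_sum, mul_finsum_field, Finset.sum_mul]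
  rw [finsum_sum_comm, ← Finset.Nat.sum_antidiagonal_swap]
  · refine Finset.sum_congr rfl fun p _ => finsum_congr fun j => ?_
    rw [zpow_two_mul_add_one h3, zpow_neg_two_mul_add_one h4, if_pos trivial, one_zpow, mul_div_assoc, mul_pow, zpow_natCast]
    unfold phipMode phipExp
    simp only [Prod.fst_swap, Prod.snd_swap]
    ring
  · intro p _
    refine (hG.finite_annihilation_left (phipExp r s) p.1 a fun j => T (j, lam) b).subset
      fun j hj => ?_
    rw [Function.mem_support] at hj ⊢
    intro h0
    apply hj
    rcases mul_eq_zero.mp h0 with h0 | h0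
    · unfold phipMode
      unfold phipExp at h0
      rw [h0]; simp
    · rw [h0, mul_zero]

theorem IsPhiStar.psim_rel (hG : Generic r s) {T : Matrix (FockIdx × YoungDiagram) FockIdx K}
    (hT : IsPhiStar r s N w v u T) (lam : YoungDiagram) (k : ℕ) (a b : FockIdx) :
    ∑ p ∈ Finset.HasAntidiagonal.antidiagonal k,
        (PowerSeries.coeff p.1 (seriesBp (r ^ 4)⁻¹ (s ^ 4)⁻¹ lam) * (s / r / u) ^ p.1) *
        ∑ᶠ j, vertexMode (r ^ 4) (s ^ 4) (phimExp r s) (fun _ => 0) (p.2 : ℤ) a j *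
          T (j, lam) b =
      ∑ᶠ j, T (a, lam) j *
        vertexMode (r ^ 4) (s ^ 4) (phimExp r s) (fun _ => 0) (k : ℤ) j b := by
  have h3 := hG.r_ne
  have h4 := hG.s_ne
  have h := congrFun (congrFun (hT.intertwines.psim k) (a, lam)) b
  simp only [mmul, horiz, GenAction.tensor, vert, Matrix.smul_apply, smul_eq_mul] at h
  rw [finsum_prod_eq_right _ lam (fun a' b' h' => by simp [Ne.symm h'])] at h
  have hc : r ^ (-2 * (N + 1)) * s ^ (2 * (N + 1)) ≠ 0 :=
    mul_ne_zero (zpow_ne_zero _ h3) (zpow_ne_zero _ h4)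
  apply mul_left_cancel₀ hc
  simp only [mul_left_comm _ (r ^ (-2 * (N + 1)) * s ^ (2 * (N + 1)))] at h
  rw [← mul_finsum_field] at h
  refine Eq.trans ?_ h
  simp only [Finset.mul_sum, mul_finsum_field, Finset.sum_mul]
  rw [finsum_sum_comm, ← Finset.Nat.sum_antidiagonal_swap]
  · refine Finset.sum_congr rfl fun p _ => finsum_congr fun j => ?_
    rw [zpow_two_mul_add_one h4, zpow_neg_two_mul_add_one h3, if_pos trivial, one_zpow, div_eq_mul_inv _ u, mul_pow, zpow_natCast,
      seriesBm_eq_seriesBp]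
    unfold phimMode phimExp
    simp only [Prod.fst_swap, Prod.snd_swap]
    ring
  · intro p _
    refine (finite_creation_left (r ^ 4) (s ^ 4) (phimExp r s) p.1 a
      fun j => T (j, lam) b).subset fun j hj => ?_
    rw [Function.mem_support] at hj ⊢
    intro h0
    apply hj
    rcases mul_eq_zero.mp h0 with h0 | h0
    · unfold phimMode
      unfold phimExp at h0
      rw [h0]; simp
    · rw [h0, mul_zero]

/-- The charges of `Φ^*_λ` are minus those of `Φ_λ` at shifted arguments: `φ^±` appears on the
opposite side of the intertwining relation. -/
theorem IsPhiStar.isVertexOp (hG : Generic r s) (hu : u ≠ 0)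
    {T : Matrix (FockIdx × YoungDiagram) FockIdx K}
    (hT : IsPhiStar r s N w v u T) (lam : YoungDiagram) :
    IsVertexOp (kap (r ^ 4) (s ^ 4))
      (fun n => -phiAnn (r ^ 4) (s ^ 4) (u * s ^ 2 / r ^ 2) lam n)
      (fun n => -phiCre (r ^ 4) (s ^ 4) (u * r ^ 2 / s ^ 2) lam n)
      (fun a b => T (a, lam) b) := by
  have hq : r ^ 4 ≠ 0 := pow_ne_zero _ hG.r_ne
  have ht : s ^ 4 ≠ 0 := pow_ne_zero _ hG.s_ne
  have hr := hG.r_ne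
  have hs := hG.s_ne
  constructor
  · intro n a b
    have := annihilation_commutator hG.kap_ne (fun a b => T (a, lam) b) (phipExp r s)
      (fun n => -((u * s ^ 2 / r ^ 2) ^ n * partChar ((r ^ 4) ^ n) ((s ^ 4) ^ n) lam /
        (1 - (s ^ 4) ^ n))) 0
      (fun k => PowerSeries.coeff k (seriesBp (r ^ 4) (s ^ 4) lam) * (u * s / r) ^ k)
      (fun k => if k = 0 then 1 else 0)
      (by rw [coeff_zero_seriesBp hq ht, pow_zero, one_mul]) (by simp)
      (seriesBp_rec hq ht lam _ _ _ fun n hn => by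
        have := hG.annihilation_charge lam (u * s ^ 2 / r ^ 2) hn
        have e : u * s ^ 2 / r ^ 2 * r / s = u * s / r := by field_simp
        rw [e] at this
        exact this) (trivial_rec _)
      hG.phipExp_ne (fun k a b => by
        rw [sum_antidiagonal_delta (fun k => ∑ᶠ j, T (a, lam) j * vertexMode (r ^ 4) (s ^ 4)
          (fun _ => 0) (phipExp r s) (-(k : ℤ)) j b)]
        exact hT.psip_rel hG lam k a b) n a b
    rw [Pi.zero_apply, zero_sub] at this
    exact this
  · intro n b
    have hrec := seriesBp_rec (inv_ne_zero hq) (inv_ne_zero ht) lam (r / s / (u * r ^ 2 / s ^ 2))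
      (phimExp r s) (fun n => -((r ^ 4 / s ^ 4 / (u * r ^ 2 / s ^ 2)) ^ n *
        partChar ((r ^ 4)⁻¹ ^ n) ((s ^ 4)⁻¹ ^ n) lam / (1 - (s ^ 4)⁻¹ ^ n)))
      (fun n hn => hG.creation_charge lam
        (div_ne_zero (mul_ne_zero hu (pow_ne_zero _ hr)) (pow_ne_zero _ hs)) hn)
    have e : r / s / (u * r ^ 2 / s ^ 2) = s / r / u := by field_simp
    rw [e] at hrec
    have := creation_commutator (q := r ^ 4) (t := s ^ 4) (fun a b => T (a, lam) b) (phimExp r s)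
      (fun n => -((r ^ 4 / s ^ 4 / (u * r ^ 2 / s ^ 2)) ^ n *
        partChar ((r ^ 4)⁻¹ ^ n) ((s ^ 4)⁻¹ ^ n) lam / (1 - (s ^ 4)⁻¹ ^ n))) 0
      (fun k => PowerSeries.coeff k (seriesBp (r ^ 4)⁻¹ (s ^ 4)⁻¹ lam) * (s / r / u) ^ k)
      (fun k => if k = 0 then 1 else 0)
      (by rw [coeff_zero_seriesBp (inv_ne_zero hq) (inv_ne_zero ht), pow_zero, one_mul]) (by simp)
      hrec
      (trivial_rec _)
      hG.phimExp_ne (fun k b => by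
        rw [sum_antidiagonal_delta (fun k => ∑ᶠ j, T (0, lam) j * vertexMode (r ^ 4) (s ^ 4)
          (phimExp r s) (fun _ => 0) (k : ℤ) j b)]
        exact hT.psim_rel hG lam k 0 b) n b
    rw [Pi.zero_apply, zero_sub] at this
    exact this

end Intertwiners

/-! ### The relation for `x^-` between vacuum entries -/

section VacuumEntries

variable {K : Type*} [Field K] [CharZero K]

theorem fockEval_prod_pow (c : ℕ+ → K) (p : Fock K) :
    fockEval (fun a => a.prod fun n k => c n ^ k) p = MvPolynomial.aeval c p := by
  induction p using MvPolynomial.induction_on' with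
  | monomial a x => rw [fockEval_monomial, MvPolynomial.aeval_monomial]; rfl
  | add p p' h h' => rw [map_add, map_add, h, h']

theorem aeval_coeff_crePoly (c : ℕ+ → K) (be : ℕ → K) (l : ℕ) :
    MvPolynomial.aeval c (PowerSeries.coeff l (crePoly be)) =
      PowerSeries.coeff l (expSeries K (PowerSeries.mk fun n => be n * natSeq c n)) := by
  have h := congrArg (PowerSeries.coeff l) (map_expSeries (K := K)
    (MvPolynomial.aeval c : Fock K →ₐ[K] K)
    (PowerSeries.mk fun n => be n • natSeq (MvPolynomial.X (R := K)) n))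
  rw [PowerSeries.coeff_map] at h
  refine h.trans ?_
  congr 2
  ext n
  rw [PowerSeries.coeff_map, PowerSeries.coeff_mk, PowerSeries.coeff_mk]
  rcases Nat.eq_zero_or_pos n with h0 | h0
  · subst h0; simp [natSeq_zero]
  · rw [natSeq_of_pos _ h0, natSeq_of_pos _ h0]
    simp only [map_smul, smul_eq_mul, RingHom.coe_coe]
    exact congrArg _ (MvPolynomial.aeval_X _ _)

/-- The vacuum-to-vacuum entry of the product of a vertex operator with `M`. -/
theorem IsVertexOp.finsum_vertexMode_zero {q t : K} (hκ : ∀ n, kap q t n ≠ 0)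
    {c c' : ℕ+ → K} {M : Matrix FockIdx FockIdx K} (h : IsVertexOp (kap q t) c c' M)
    (al be : ℕ → K) (l : ℕ) :
    ∑ᶠ j, vertexMode q t al be (-(l : ℤ)) 0 j * M j 0 =
      M 0 0 * PowerSeries.coeff l (expSeries K (PowerSeries.mk fun n => be n * natSeq c n)) := by
  rw [← aeval_coeff_crePoly, ← fockEval_prod_pow, fockEval_eq_finsum, mul_finsum_field]
  refine finsum_congr fun j => ?_
  rw [vertexMode_zero_left hκ, mul_right_comm, h.zero_right hκ]
  ring

/-- `exp (∑ E_λ(q^n, t^n) x^n z^n / n)` for the character `E_λ`. -/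
def charExp (q t x : K) (lam : YoungDiagram) : PowerSeries K :=
  expSeries K (PowerSeries.mk fun n => partChar (q ^ n) (t ^ n) lam * x ^ n / n)

/-- The inverse of `charExp`. -/
def charExpNeg (q t x : K) (lam : YoungDiagram) : PowerSeries K :=
  expSeries K (PowerSeries.mk fun n => -(partChar (q ^ n) (t ^ n) lam * x ^ n / n))

theorem charExpNeg_mul_charExp (q t x : K) (lam : YoungDiagram) :
    charExpNeg q t x lam * charExp q t x lam = 1 := by
  rw [charExp, charExpNeg, ← expSeries_add (by rw [PowerSeries.coeff_mk]; simp)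
    (by rw [PowerSeries.coeff_mk]; simp), ← expSeries_zero (K := K)]
  congr 1
  ext n
  simp

theorem charExp_mul (q t x : K) (lam : YoungDiagram) {M : ℕ} (hM : lam.colLen 0 ≤ M) :
    (∏ i ∈ Finset.range (M + 1), lin (q ^ lam.rowLen i * t⁻¹ ^ i * x)) * charExp q t x lam =
      ∏ i ∈ Finset.range M, lin (q ^ lam.rowLen i * t⁻¹ ^ (i + 1) * x) := by
  have hz : ∀ x : K, PowerSeries.coeff 0 (logLin x) = 0 := fun x => by rw [coeff_logLin]; simp
  have hnz : ∀ x : K, PowerSeries.coeff 0 (-logLin x) = 0 := fun x => by rw [map_neg, hz, neg_zero]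
  simp only [← expSeries_neg_logLin]
  rw [← expSeries_sum _ _ fun _ _ => hnz _, ← expSeries_sum _ _ fun _ _ => hnz _, charExp,
    ← expSeries_add (by rw [map_sum]; exact Finset.sum_eq_zero fun _ _ => hnz _)
      (by rw [PowerSeries.coeff_mk]; simp)]
  congr 1
  ext n
  simp only [map_add, map_sum, map_neg, coeff_logLin, PowerSeries.coeff_mk]
  rw [Finset.sum_range_succ, rowLen_eq_zero_of_le hM, pow_zero, one_mul, partChar_eq _ _ lam hM]
  have h1 : ∀ i, (t ^ n)⁻¹ ^ i = (t⁻¹ ^ i) ^ n := fun i => by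
    rw [← inv_pow, ← pow_mul, ← pow_mul, mul_comm]
  have h2 : ∀ i, (q ^ n) ^ lam.rowLen i = (q ^ lam.rowLen i) ^ n := fun i => by
    rw [← pow_mul, ← pow_mul, mul_comm]
  simp only [h1, h2, mul_pow, add_mul, sub_mul, one_mul, add_div, sub_div,
    Finset.mul_sum, Finset.sum_mul, Finset.sum_div, Finset.sum_neg_distrib, pow_succ]
  have h3 : ∀ i ∈ Finset.range M, (t ^ n)⁻¹ * ((t⁻¹ ^ i) ^ n * (q ^ lam.rowLen i) ^ n) * x ^ n / n =
      (q ^ lam.rowLen i) ^ n * ((t⁻¹ ^ i) ^ n * t⁻¹ ^ n) * x ^ n / n := fun i _ => by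
    rw [inv_pow]; ring
  have h4 : ∀ i ∈ Finset.range M, (t⁻¹ ^ i) ^ n * (q ^ lam.rowLen i) ^ n * x ^ n / n =
      (q ^ lam.rowLen i) ^ n * (t⁻¹ ^ i) ^ n * x ^ n / n := fun i _ => by ring
  rw [Finset.sum_sub_distrib, Finset.sum_congr rfl h3, Finset.sum_congr rfl h4]
  ring

theorem charExpNeg_mul (q t x : K) (lam : YoungDiagram) {M : ℕ} (hM : lam.colLen 0 ≤ M) :
    (∏ i ∈ Finset.range M, lin (q ^ lam.rowLen i * t⁻¹ ^ (i + 1) * x)) * charExpNeg q t x lam =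
      ∏ i ∈ Finset.range (M + 1), lin (q ^ lam.rowLen i * t⁻¹ ^ i * x) := by
  rw [← charExp_mul q t x lam hM, mul_assoc, mul_comm (charExp _ _ _ _), charExpNeg_mul_charExp,
    mul_one]

theorem eq_of_rowLen_eq {mu nu : YoungDiagram} (h : ∀ i, mu.rowLen i = nu.rowLen i) : mu = nu := by
  ext ⟨i, j⟩
  rw [YoungDiagram.mem_cells, YoungDiagram.mem_cells, YoungDiagram.mem_iff_lt_rowLen,
    YoungDiagram.mem_iff_lt_rowLen, h]

theorem IsAddBox.right_unique {lam mu nu : YoungDiagram} {i : ℕ} (h : IsAddBox lam mu i)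
    (h' : IsAddBox lam nu i) : mu = nu :=
  eq_of_rowLen_eq fun j => by have := h j; have := h' j; omega

theorem IsAddBox.left_unique {lam mu nu : YoungDiagram} {i : ℕ} (h : IsAddBox mu lam i)
    (h' : IsAddBox nu lam i) : mu = nu :=
  eq_of_rowLen_eq fun j => by have := h j; have := h' j; omega

theorem IsAddBox.lt_colLen {lam mu : YoungDiagram} {i : ℕ} (h : IsAddBox lam mu i) :
    i < lam.colLen 0 := by
  rw [← rowLen_pos_iff, h i, if_pos rfl]; omega

theorem IsAddBox.le_colLen {lam mu : YoungDiagram} {i : ℕ} (h : IsAddBox lam mu i) :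
    i ≤ mu.colLen 0 := by
  by_contra hi
  push Not at hi
  have h1 := h i
  have h2 := h (mu.colLen 0)
  have h3 := lam.rowLen_anti _ _ hi.le
  rw [rowLen_eq_zero_of_le (le_refl _), if_neg hi.ne] at h2
  rw [if_pos rfl] at h1
  omega

theorem IsAddBox.colLen_le {lam mu : YoungDiagram} {i : ℕ} (h : IsAddBox lam mu i) :
    mu.colLen 0 ≤ lam.colLen 0 := by
  by_contra hi
  push Not at hi
  have h1 := rowLen_pos_iff.mpr hi
  have h2 := h (lam.colLen 0)
  rw [rowLen_eq_zero_of_le (le_refl _)] at h2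
  omega

theorem finsum_single_of_subsingleton {α : Type*} (P : α → Prop) [DecidablePred P] (f : α → K)
    (a : α) (ha : P a) (h : ∀ b, P b → b = a) : ∑ᶠ b, (if P b then f b else 0) = f a := by
  rw [finsum_eq_single _ a fun b hb => if_neg fun h' => hb (h b h'), if_pos ha]

theorem finite_support_of_subsingleton {α : Type*} (P : α → Prop) [DecidablePred P] (f : α → K)
    (h : ∀ a b, P a → P b → b = a) :
    (Function.support fun b => if P b then f b else 0).Finite := by
  refine Set.Subsingleton.finite fun a ha b hb => ?_
  rw [Function.mem_support] at ha hb
  exact (h b a (by by_contra h'; exact hb (if_neg h')) (by by_contra h'; exact ha (if_neg h')))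

end VacuumEntries

section VacuumModes

variable {K : Type*} [Field K] [CharZero K]

theorem vertexMode_annihilation_zero {q t : K} (hκ : ∀ n, kap q t n ≠ 0) (be : ℕ → K) (k : ℕ)
    (j : FockIdx) (h : k ≠ 0 ∨ j ≠ 0) :
    vertexMode q t (fun _ => 0) be (-(k : ℤ)) j 0 = 0 := by
  classical
  by_cases hk : k = 0
  · subst hk
    rw [vertexMode_annihilation hκ, coeff_expOp_zero, Module.End.one_apply,
      MvPolynomial.coeff_monomial, if_neg (Ne.symm (h.resolve_left (by simp)))]
  · exact vertexMode_zero_right_of_neg _ _ (by omega) _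

theorem vertexMode_annihilation_zero_zero {q t : K} (hκ : ∀ n, kap q t n ≠ 0) (be : ℕ → K) :
    vertexMode q t (fun _ => 0) be (-((0 : ℕ) : ℤ)) 0 0 = 1 := by
  rw [vertexMode_annihilation hκ, coeff_expOp_zero, Module.End.one_apply,
    MvPolynomial.coeff_monomial, if_pos rfl]

end VacuumModes

section Currents

variable {K : Type*} [Field K] [CharZero K] {r s : K} {N : ℤ} {u v w : K}

theorem Generic.tensor_xm_zero (hG : Generic r s) (n : ℤ) (hn : 0 < n + N) (mu lam : YoungDiagram)
    (j : FockIdx) (hj : j ≠ 0) :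
    ((vert r s v).tensor (horiz r s N u)).xm n (mu, j) (lam, 0) = 0 := by
  simp only [GenAction.tensor, horiz, Matrix.smul_apply, smul_eq_mul]
  have h1 : xiMode r s (-n - N) j 0 = 0 := vertexMode_zero_right_of_neg _ _ (by omega) _
  have h2 : ∀ k : ℕ, phipMode r s (-(k : ℤ)) j 0 = 0 := fun k =>
    vertexMode_annihilation_zero hG.kap_ne _ _ _ (Or.inr hj)
  simp [h1, h2]

theorem Generic.tensor_xm_zero_zero (hG : Generic r s) (n : ℤ) (hn : 0 < n + N)
    (mu lam : YoungDiagram) :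
    ((vert r s v).tensor (horiz r s N u)).xm n (mu, 0) (lam, 0) =
      ((s / r) ^ 2) ^ (-n) * ((vert r s v).xm n mu lam * (r ^ (2 * N) * s ^ (-2 * N))) := by
  simp only [GenAction.tensor, horiz, Matrix.smul_apply, smul_eq_mul]
  have h1 : xiMode r s (-n - N) 0 0 = 0 := vertexMode_zero_right_of_neg _ _ (by omega) _
  rw [h1, finsum_eq_single _ 0]
  · have h2 : phipMode r s (-((0 : ℕ) : ℤ)) 0 0 = 1 :=
      vertexMode_annihilation_zero_zero hG.kap_ne _
    rw [h2]
    simp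
  · intro k hk
    have h2 : phipMode r s (-(k : ℤ)) 0 0 = 0 :=
      vertexMode_annihilation_zero hG.kap_ne _ _ _ (Or.inl hk)
    rw [h2]
    simp

theorem mk_eq_mk_of_pos {f g : ℕ → K} (h0 : f 0 = g 0) (h : ∀ n, 0 < n → f n = g n) :
    PowerSeries.mk f = PowerSeries.mk g := by
  congr 1
  funext n
  rcases Nat.eq_zero_or_pos n with h' | h'
  · rw [h', h0]
  · exact h n h'

open Classical in
theorem finsum_vert_xm (n : ℤ) (lam : YoungDiagram) (f : YoungDiagram → K) :
    ∑ᶠ mu, f mu * (vert r s v).xm n mu lam = r ^ 2 * (s ^ 2)⁻¹ *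
      ∑ i ∈ Finset.range (lam.colLen 0),
        (∑ᶠ mu, if IsAddBox lam mu i then f mu * coeffAm (r ^ 4) (s ^ 4) lam i else 0) *
          ((r ^ 4) ^ ((lam.rowLen i : ℤ) - 1) * (s ^ 4) ^ (-(i : ℤ)) * v) ^ n := by
  simp only [vert]
  simp only [mul_left_comm _ (r ^ 2 * (s ^ 2)⁻¹), Finset.mul_sum, mul_ite, mul_zero]
  rw [finsum_sum_comm]
  · refine Finset.sum_congr rfl fun i _ => ?_
    rw [mul_comm (∑ᶠ _, _), mul_finsum_field, mul_finsum_field]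
    refine finsum_congr fun mu => ?_
    split_ifs
    · ring
    · simp
  · intro i _
    exact finite_support_of_subsingleton _ _ fun _ _ h h' => h'.right_unique h

open Classical in
theorem IsPhi.xm_rel (hG : Generic r s) (hv : v ≠ 0) (hw : w ≠ 0)
    {T : Matrix FockIdx (YoungDiagram × FockIdx) K} (hT : IsPhi r s N v u w T)
    (lam : YoungDiagram) (m : ℕ) (hm : 2 ≤ m) :
    T 0 (lam, 0) *
        PowerSeries.coeff m (charExpNeg (r ^ 4) (s ^ 4) (v * s ^ 2 / r ^ 2) lam) =
      ∑ i ∈ Finset.range (lam.colLen 0), w *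
        (∑ᶠ mu, if IsAddBox lam mu i then T 0 (mu, 0) * coeffAm (r ^ 4) (s ^ 4) lam i else 0) *
        ((r ^ 4) ^ lam.rowLen i * (s ^ 4)⁻¹ ^ (i + 1) * (v * s ^ 2 / r ^ 2)) ^
          ((m : ℤ) - N - 1) := by
  have h3 := hG.r_ne
  have h4 := hG.s_ne
  have h := congrFun (congrFun (hT.intertwines.xm ((m : ℤ) - N - 1)) 0) (lam, 0)
  have hM := (hT.isVertexOp hG hv lam).finsum_vertexMode_zero hG.kap_ne
    (fun n => -((1 - (s ^ 4) ^ (-(n : ℤ))) / n * r ^ (-2 * (n : ℤ)) * s ^ (2 * (n : ℤ))))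
    (fun n => (1 - (s ^ 4) ^ n) / n * r ^ (-2 * (n : ℤ)) * s ^ (2 * (n : ℤ))) m
  have he : (PowerSeries.mk fun n : ℕ => (1 - (s ^ 4) ^ n) / n * r ^ (-2 * (n : ℤ)) *
      s ^ (2 * (n : ℤ)) * natSeq (phiAnn (r ^ 4) (s ^ 4) v lam) n) =
      PowerSeries.mk fun n : ℕ => -(partChar ((r ^ 4) ^ n) ((s ^ 4) ^ n) lam *
        (v * s ^ 2 / r ^ 2) ^ n / n) := by
    apply mk_eq_mk_of_pos
    · simp
    · intro n hn
      have h1 := hG.one_sub_t_ne hn.ne'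
      rw [natSeq_of_pos _ hn, zpow_mul, zpow_mul, zpow_natCast, zpow_natCast]
      unfold phiAnn
      have e1 : (r ^ (-2 : ℤ)) = (r ^ 2)⁻¹ := by rw [zpow_neg]; norm_cast
      have e2 : (s ^ (2 : ℤ)) = s ^ 2 := by norm_cast
      rw [e1, e2]
      simp only [PNat.mk_coe, div_pow, mul_pow, inv_pow]
      field_simp
  rw [he] at hM
  change _ = _ * PowerSeries.coeff m (charExpNeg _ _ _ _) at hM
  rw [mmul, mmul, finsum_prod_eq_right _ 0 (fun a b hb => by
    rw [hG.tensor_xm_zero _ (by omega) _ _ _ hb, mul_zero])] at h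
  simp only [hG.tensor_xm_zero_zero ((m : ℤ) - N - 1) (N := N) (by omega)] at h
  have e3 : -((m : ℤ) - N - 1) - (N + 1) = -(m : ℤ) := by ring
  simp only [horiz, Matrix.smul_apply, smul_eq_mul, e3,
    mul_assoc (w⁻¹ * r ^ (2 * (N + 1)) * s ^ (-2 * (N + 1)))] at h
  rw [← mul_finsum_field] at h
  unfold xiMode at h
  rw [hM] at h
  have e4 : ∀ mu, T 0 (mu, 0) * (((s / r) ^ 2) ^ (-((m : ℤ) - N - 1)) *
      ((vert r s v).xm ((m : ℤ) - N - 1) mu lam * (r ^ (2 * N) * s ^ (-2 * N)))) =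
      ((s / r) ^ 2) ^ (-((m : ℤ) - N - 1)) * (r ^ (2 * N) * s ^ (-2 * N)) *
        (T 0 (mu, 0) * (vert r s v).xm ((m : ℤ) - N - 1) mu lam) := fun mu => by ring
  rw [finsum_congr e4, ← mul_finsum_field, finsum_vert_xm] at h
  have hc : w⁻¹ * r ^ (2 * (N + 1)) * s ^ (-2 * (N + 1)) ≠ 0 :=
    mul_ne_zero (mul_ne_zero (inv_ne_zero hw) (zpow_ne_zero _ h3)) (zpow_ne_zero _ h4)
  apply mul_left_cancel₀ hc
  rw [h, Finset.mul_sum, Finset.mul_sum, Finset.mul_sum]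
  refine Finset.sum_congr rfl fun i _ => ?_
  rw [zpow_two_mul_add_one h3, zpow_neg_two_mul_add_one h4]
  have e5 : (r ^ 4) ^ lam.rowLen i * (s ^ 4)⁻¹ ^ (i + 1) * (v * s ^ 2 / r ^ 2) =
      ((s / r) ^ 2)⁻¹ * ((r ^ 4) ^ ((lam.rowLen i : ℤ) - 1) * (s ^ 4) ^ (-(i : ℤ)) * v) := by
    rw [zpow_sub₀ (pow_ne_zero 4 h3), zpow_one, zpow_natCast, zpow_neg, zpow_natCast, inv_pow,
      pow_succ]
    field_simp
    ring
  rw [e5, mul_zpow ((s / r) ^ 2)⁻¹, inv_zpow, zpow_neg ((s / r) ^ 2)]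
  generalize ((s / r) ^ 2) ^ ((m : ℤ) - N - 1) = A
  generalize r ^ (2 * N) = A₁
  generalize s ^ (-2 * N) = A₂
  generalize (∑ᶠ mu, if IsAddBox lam mu i then
    T 0 (mu, 0) * coeffAm (r ^ 4) (s ^ 4) lam i else 0) = S
  field_simp

/-- The residue of the relation for `x^-` at the last row of `lam`. -/
theorem IsPhi.last_row (hG : Generic r s) (hv : v ≠ 0) (hw : w ≠ 0)
    {T : Matrix FockIdx (YoungDiagram × FockIdx) K} (hT : IsPhi r s N v u w T)
    {lam mu : YoungDiagram} {i₀ : ℕ} (h : IsAddBox lam mu i₀) (hl : lam.colLen 0 = i₀ + 1)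
    (a b : ℕ → K) (ha : ∀ i, a i = (r ^ 4) ^ lam.rowLen i * (s ^ 4)⁻¹ ^ i * (v * s ^ 2 / r ^ 2))
    (hb : ∀ i, b i = (r ^ 4) ^ lam.rowLen i * (s ^ 4)⁻¹ ^ (i + 1) * (v * s ^ 2 / r ^ 2)) :
    w * (T 0 (mu, 0) * coeffAm (r ^ 4) (s ^ 4) lam i₀) * b i₀ ^ (-N - 1) *
        ∏ i ∈ (Finset.range (i₀ + 1)).erase i₀, (1 - b i / b i₀) =
      T 0 (lam, 0) * ∏ j ∈ Finset.range (i₀ + 2), (1 - a j / b i₀) := by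
  classical
  have h3 := hG.r_ne
  have h4 := hG.s_ne
  have hb0 : ∀ i, b i ≠ 0 := fun i => by
    rw [hb]
    exact mul_ne_zero (mul_ne_zero (pow_ne_zero _ (pow_ne_zero _ h3))
      (pow_ne_zero _ (inv_ne_zero (pow_ne_zero _ h4))))
      (div_ne_zero (mul_ne_zero hv (pow_ne_zero _ h4)) (pow_ne_zero _ h3))
  have key := residue_eq (I := Finset.range (i₀ + 1)) (J := Finset.range (i₀ + 2)) (i₀ := i₀)
    (Finset.self_mem_range_succ i₀) a b
    (fun i => w * (∑ᶠ mu, if IsAddBox lam mu i then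
      T 0 (mu, 0) * coeffAm (r ^ 4) (s ^ 4) lam i else 0) * b i ^ (-N - 1))
    (fun i _ => hb0 i)
    (PowerSeries.C (T 0 (lam, 0)) * charExpNeg (r ^ 4) (s ^ 4) (v * s ^ 2 / r ^ 2) lam)
    (T 0 (lam, 0)) (by
      rw [mul_left_comm]
      congr 1
      simp only [ha, hb]
      exact charExpNeg_mul _ _ _ _ hl.le) 2 (fun m hm => by
      rw [PowerSeries.coeff_C_mul, hT.xm_rel hG hv hw lam m hm, hl]
      refine Finset.sum_congr rfl fun i _ => ?_
      have e : b i ^ ((m : ℤ) - N - 1) = b i ^ (-N - 1) * b i ^ m := by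
        rw [← zpow_natCast (b i) m, ← zpow_add₀ (hb0 i)]
        congr 1
        ring
      rw [← hb, mul_assoc _ (b i ^ (-N - 1)), e])
  rw [finsum_single_of_subsingleton _ _ mu h fun nu hnu => hnu.right_unique h] at key
  exact key

theorem finite_vertexMode_zero_left {q t : K} (hκ : ∀ n, kap q t n ≠ 0) (al be : ℕ → K) (m : ℤ)
    (f : FockIdx → K) :
    (Function.support fun j => vertexMode q t al be m 0 j * f j).Finite := by
  rcases lt_or_ge 0 m with h | h
  · simp [vertexMode_zero_left_of_pos al be h]
  · obtain ⟨l, rfl⟩ : ∃ l : ℕ, m = -(l : ℤ) := ⟨(-m).toNat, by omega⟩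
    refine (MvPolynomial.support (PowerSeries.coeff l (crePoly be))).finite_toSet.subset
      fun j hj => ?_
    have h1 := left_ne_zero_of_mul (Function.mem_support.mp hj)
    rw [vertexMode_zero_left hκ] at h1
    exact MvPolynomial.mem_support_iff.mpr (right_ne_zero_of_mul h1)

open Classical in
theorem finsum_vert_xm_left (n : ℤ) (mu : YoungDiagram) (f : YoungDiagram → K) {B : ℕ}
    (hB : mu.colLen 0 < B) :
    ∑ᶠ lam, (vert r s u).xm n mu lam * f lam = r ^ 2 * (s ^ 2)⁻¹ *
      ∑ i ∈ Finset.range B,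
        (∑ᶠ lam, if IsAddBox lam mu i then f lam * coeffAm (r ^ 4) (s ^ 4) lam i else 0) *
          ((r ^ 4) ^ (mu.rowLen i : ℤ) * (s ^ 4) ^ (-(i : ℤ)) * u) ^ n := by
  have e : ∀ lam, (vert r s u).xm n mu lam * f lam = ∑ i ∈ Finset.range B,
      if IsAddBox lam mu i then r ^ 2 * (s ^ 2)⁻¹ * (coeffAm (r ^ 4) (s ^ 4) lam i *
        ((r ^ 4) ^ (mu.rowLen i : ℤ) * (s ^ 4) ^ (-(i : ℤ)) * u) ^ n * f lam) else 0 := by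
    intro lam
    simp only [vert, Finset.sum_mul, Finset.mul_sum]
    rw [← Finset.sum_filter]
    have e2 : (Finset.range B).filter (fun i => IsAddBox lam mu i) =
        (Finset.range (lam.colLen 0)).filter (fun i => IsAddBox lam mu i) := by
      ext i
      simp only [Finset.mem_filter, Finset.mem_range]
      exact ⟨fun h => ⟨h.2.lt_colLen, h.2⟩, fun h => ⟨h.2.le_colLen.trans_lt hB, h.2⟩⟩
    rw [e2, Finset.sum_filter]
    refine Finset.sum_congr rfl fun i _ => ?_
    split_ifs with h
    · rw [h i, if_pos rfl]
      push_cast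
      rw [add_sub_cancel_right]
      ring
    · simp
  rw [finsum_congr e, finsum_sum_comm, Finset.mul_sum]
  · refine Finset.sum_congr rfl fun i _ => ?_
    rw [mul_comm (∑ᶠ _, _), mul_finsum_field, mul_finsum_field]
    refine finsum_congr fun lam => ?_
    split_ifs
    · ring
    · simp
  · intro i _
    exact finite_support_of_subsingleton _ _ fun _ _ h h' => h'.left_unique h

theorem finite_support_vert_xm (n : ℤ) (mu : YoungDiagram) (f : YoungDiagram → K) :
    (Function.support fun lam => (vert r s u).xm n mu lam * f lam).Finite := by
  classical
  refine Set.Finite.subset (s := ⋃ i ∈ Finset.range (mu.colLen 0 + 1), {lam | IsAddBox lam mu i})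
    (Set.Finite.biUnion (Finset.finite_toSet _) fun i _ => Set.Subsingleton.finite
      fun a ha b hb => IsAddBox.left_unique ha hb) fun lam h => ?_
  have h := left_ne_zero_of_mul (Function.mem_support.mp h)
  simp only [vert] at h
  obtain ⟨i, _, hi⟩ := Finset.exists_ne_zero_of_sum_ne_zero (right_ne_zero_of_mul h)
  have hi' : IsAddBox lam mu i := by by_contra h'; exact hi (if_neg h')
  simp only [Set.mem_iUnion, Finset.mem_range]
  exact ⟨i, Nat.lt_succ_of_le hi'.le_colLen, hi'⟩

theorem rescale_expSeries (x : K) (f : PowerSeries K) :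
    PowerSeries.rescale x (expSeries K f) = expSeries K (PowerSeries.rescale x f) := by
  ext k
  simp only [PowerSeries.coeff_rescale, expSeries, PowerSeries.coeff_mk, ← map_pow, smul_eq_mul,
    Finset.mul_sum]
  exact Finset.sum_congr rfl fun j _ => by ring

theorem Generic.charExp_eq_mul (hG : Generic r s) (u : K) (mu : YoungDiagram) :
    charExp (r ^ 4) (s ^ 4) u mu =
      PowerSeries.rescale u (seriesBp (r ^ 4) (s ^ 4) mu) *
      expSeries K (PowerSeries.mk fun n : ℕ => (1 - (s ^ 4) ^ n) / n * r ^ (-2 * (n : ℤ)) *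
        s ^ (2 * (n : ℤ)) * natSeq (fun n => -phiAnn (r ^ 4) (s ^ 4) (u * s ^ 2 / r ^ 2) mu n) n) := by
  have h3 := hG.r_ne
  have h4 := hG.s_ne
  rw [seriesBp_eq_exp (pow_ne_zero _ h3) (pow_ne_zero _ h4), rescale_expSeries, ← expSeries_add
    (by rw [PowerSeries.coeff_rescale, PowerSeries.coeff_mk]; simp)
    (by rw [PowerSeries.coeff_mk, natSeq_zero, mul_zero]), charExp]
  congr 1
  ext n
  rw [map_add, PowerSeries.coeff_rescale, PowerSeries.coeff_mk, PowerSeries.coeff_mk,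
    PowerSeries.coeff_mk]
  rcases Nat.eq_zero_or_pos n with h0 | hn
  · subst h0; simp
  · have h1 := hG.one_sub_t_ne hn.ne'
    have e1 : (r ^ (-2 : ℤ)) = (r ^ 2)⁻¹ := by rw [zpow_neg]; norm_cast
    have e2 : (s ^ (2 : ℤ)) = s ^ 2 := by norm_cast
    rw [natSeq_of_pos _ hn, zpow_mul, zpow_mul, zpow_natCast, zpow_natCast, e1, e2]
    unfold phiAnn
    have hr : r ^ n ≠ 0 := pow_ne_zero _ h3
    have hn' : (n : K) ≠ 0 := by exact_mod_cast hn.ne'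
    simp only [PNat.mk_coe, div_pow, mul_pow, inv_pow]
    have e3 : ∀ a : K, (a ^ 2) ^ n = (a ^ n) ^ 2 := fun a => by rw [← pow_mul, ← pow_mul, mul_comm]
    have e4 : ∀ a : K, (a ^ 4) ^ n = (a ^ n) ^ 4 := fun a => by rw [← pow_mul, ← pow_mul, mul_comm]
    rw [e4] at h1
    simp only [e3, e4]
    field_simp
    ring

open Classical in
theorem tensor_xm_vacuum (m : ℕ) (mu lam : YoungDiagram) (j : FockIdx) :
    ((horiz r s N v).tensor (vert r s u)).xm ((m : ℤ) - N) (0, mu) (j, lam) =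
      (if mu = lam then ∑ p ∈ Finset.HasAntidiagonal.antidiagonal m,
        v⁻¹ * r ^ (2 * N) * s ^ (-2 * N) * (r ^ 2 * (s ^ 2)⁻¹) *
          (PowerSeries.coeff p.1 (seriesBp (r ^ 4) (s ^ 4) mu) * u ^ p.1) *
            xiMode r s (-(p.2 : ℤ)) 0 j else 0) +
      if 0 = j then (vert r s u).xm ((m : ℤ) - N) mu lam else 0 := by
  simp only [GenAction.tensor]
  congr 1
  rw [finsum_eq_sum_of_support_subset (s := Finset.range (m + 1))]
  · rw [← Finset.Nat.sum_antidiagonal_eq_sum_range_succ_mk (f := fun p : ℕ × ℕ =>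
      ((vert r s u).gam ^ 2) ^ (-((m : ℤ) - N - p.1)) * (vert r s u).gam ^ (-(p.1 : ℤ)) *
        ((horiz r s N v).xm ((m : ℤ) - N - p.1) 0 j * (vert r s u).psip p.1 mu lam))]
    split_ifs with h
    · refine Finset.sum_congr rfl fun p hp => ?_
      rw [Finset.HasAntidiagonal.mem_antidiagonal] at hp
      have e : -((m : ℤ) - N - p.1) - N = -(p.2 : ℤ) := by rw [← hp]; push_cast; ring
      simp only [vert, horiz, Matrix.smul_apply, smul_eq_mul, one_pow, one_zpow, e, h]
      simp only [if_true]
      ring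
    · refine Finset.sum_eq_zero fun p _ => ?_
      simp [vert, h]
  · intro k hk
    rw [Function.mem_support] at hk
    by_contra h
    apply hk
    rw [Finset.coe_range, Set.mem_Iio] at h
    have : xiMode r s (-((m : ℤ) - N - k) - N) 0 j = 0 :=
      vertexMode_zero_left_of_pos _ _ (by omega) _
    have hx : (horiz r s N v).xm ((m : ℤ) - N - k) 0 j = 0 := by
      simp only [horiz, Matrix.smul_apply, smul_eq_mul, this, mul_zero]
    rw [hx, zero_mul, mul_zero]

open Classical in
theorem IsPhiStar.xm_rel (hG : Generic r s) (hu : u ≠ 0) (hv : v ≠ 0)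
    {T : Matrix (FockIdx × YoungDiagram) FockIdx K} (hT : IsPhiStar r s N w v u T)
    (mu : YoungDiagram) {B : ℕ} (hB : mu.colLen 0 < B) (m : ℕ) :
    T (0, mu) 0 * PowerSeries.coeff m (charExp (r ^ 4) (s ^ 4) u mu) =
      ∑ i ∈ Finset.range B, -v * (r ^ (2 * N) * s ^ (-2 * N))⁻¹ *
        (∑ᶠ lam, if IsAddBox lam mu i then T (0, lam) 0 * coeffAm (r ^ 4) (s ^ 4) lam i else 0) *
        ((r ^ 4) ^ mu.rowLen i * (s ^ 4)⁻¹ ^ i * u) ^ ((m : ℤ) - N) := by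
  have h3 := hG.r_ne
  have h4 := hG.s_ne
  have h := congrFun (congrFun (hT.intertwines.xm ((m : ℤ) - N)) (0, mu)) 0
  have hM := (hT.isVertexOp hG hu mu).finsum_vertexMode_zero hG.kap_ne
    (fun n => -((1 - (s ^ 4) ^ (-(n : ℤ))) / n * r ^ (-2 * (n : ℤ)) * s ^ (2 * (n : ℤ))))
    (fun n => (1 - (s ^ 4) ^ n) / n * r ^ (-2 * (n : ℤ)) * s ^ (2 * (n : ℤ)))
  have hr : ∑ᶠ j, T (0, mu) j * (horiz r s (N + 1) w).xm ((m : ℤ) - N) j 0 = 0 := by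
    refine (finsum_congr fun j => ?_).trans finsum_zero
    have : xiMode r s (-((m : ℤ) - N) - (N + 1)) j 0 = 0 :=
      vertexMode_zero_right_of_neg _ _ (by omega) _
    simp only [horiz, Matrix.smul_apply, smul_eq_mul, this, mul_zero]
  rw [mmul, mmul, hr] at h
  have hxi : ∀ l : ℕ, (Function.support fun j => xiMode r s (-(l : ℤ)) 0 j * T (j, mu) 0).Finite :=
    fun l => finite_vertexMode_zero_left hG.kap_ne _ _ _ _
  set A : K := v⁻¹ * r ^ (2 * N) * s ^ (-2 * N) * (r ^ 2 * (s ^ 2)⁻¹) with hA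
  set c : ℕ → K := fun k => PowerSeries.coeff k (seriesBp (r ^ 4) (s ^ 4) mu) * u ^ k with hc
  have h1 : ∑ᶠ x : FockIdx × YoungDiagram, (if mu = x.2 then
      ∑ p ∈ Finset.HasAntidiagonal.antidiagonal m, A * c p.1 * xiMode r s (-(p.2 : ℤ)) 0 x.1
      else 0) * T x 0 = A * (T (0, mu) 0 * PowerSeries.coeff m (charExp (r ^ 4) (s ^ 4) u mu)) := by
    rw [finsum_prod_eq_right _ mu (fun a b hb => by rw [if_neg hb.symm, zero_mul])]
    simp only [if_true, Finset.sum_mul, mul_assoc]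
    rw [finsum_sum_comm]
    · rw [hG.charExp_eq_mul, PowerSeries.coeff_mul, Finset.mul_sum, Finset.mul_sum]
      refine Finset.sum_congr rfl fun p _ => ?_
      rw [← mul_finsum_field, ← mul_finsum_field, PowerSeries.coeff_rescale]
      unfold xiMode
      rw [hM p.2, hc]
      ring
    · intro p _
      refine (hxi p.2).subset fun j hj => ?_
      rw [Function.mem_support] at hj ⊢
      intro h0
      rw [h0] at hj
      simp at hj
  have h2 : ∑ᶠ x : FockIdx × YoungDiagram, (if 0 = x.1 then (vert r s u).xm ((m : ℤ) - N) mu x.2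
      else 0) * T x 0 = ∑ᶠ lam, (vert r s u).xm ((m : ℤ) - N) mu lam * T (0, lam) 0 := by
    rw [finsum_prod_eq_left _ 0 (fun a b ha => by rw [if_neg ha.symm, zero_mul])]
    simp only [if_true]
  have h5 : ∀ x : FockIdx × YoungDiagram,
      ((horiz r s N v).tensor (vert r s u)).xm ((m : ℤ) - N) (0, mu) x * T x 0 = _ := fun x => by
    rw [tensor_xm_vacuum m mu x.2 x.1, add_mul]
  rw [finsum_congr h5, finsum_add_distrib, h1, h2, finsum_vert_xm_left _ _ _ hB] at h
  · have hA0 : A ≠ 0 :=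
      mul_ne_zero (mul_ne_zero (mul_ne_zero (inv_ne_zero hv) (zpow_ne_zero _ h3))
        (zpow_ne_zero _ h4)) (mul_ne_zero (pow_ne_zero _ h3) (inv_ne_zero (pow_ne_zero _ h4)))
    apply mul_left_cancel₀ hA0
    rw [eq_neg_of_add_eq_zero_left h, Finset.mul_sum, Finset.mul_sum, ← Finset.sum_neg_distrib]
    refine Finset.sum_congr rfl fun i _ => ?_
    have e1 : (s ^ 4) ^ (-(i : ℤ)) = (s ^ 4)⁻¹ ^ i := by rw [zpow_neg, zpow_natCast, inv_pow]
    rw [e1, zpow_natCast, hA]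
    have h6 : r ^ (2 * N) ≠ 0 := zpow_ne_zero _ h3
    have h7 : s ^ (-2 * N) ≠ 0 := zpow_ne_zero _ h4
    generalize ((r ^ 4) ^ mu.rowLen i * (s ^ 4)⁻¹ ^ i * u) ^ ((m : ℤ) - N) = Y
    generalize (∑ᶠ lam, if IsAddBox lam mu i then
      T (0, lam) 0 * coeffAm (r ^ 4) (s ^ 4) lam i else 0) = S
    generalize r ^ (2 * N) = A₁ at *
    generalize s ^ (-2 * N) = A₂ at *
    field_simp
  · refine (((Finset.HasAntidiagonal.antidiagonal m).finite_toSet.biUnion fun p _ =>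
      hxi p.2).image fun j => (j, mu)).subset fun x hx => ?_
    rw [Function.mem_support] at hx
    have hx1 := left_ne_zero_of_mul hx
    have hx2 : mu = x.2 := by by_contra h'; exact hx1 (if_neg h')
    rw [if_pos hx2] at hx1
    obtain ⟨p, hp, hp'⟩ := Finset.exists_ne_zero_of_sum_ne_zero hx1
    refine ⟨x.1, ?_, Prod.ext rfl hx2⟩
    simp only [Set.mem_iUnion]
    refine ⟨p, hp, ?_⟩
    rw [Function.mem_support, hx2]
    exact mul_ne_zero (right_ne_zero_of_mul hp') (right_ne_zero_of_mul hx)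
  · refine ((finite_support_vert_xm (r := r) (s := s) (u := u) ((m : ℤ) - N) mu
      fun lam => T (0, lam) 0).image fun lam => ((0 : FockIdx), lam)).subset fun x hx => ?_
    rw [Function.mem_support] at hx
    have hx1 := left_ne_zero_of_mul hx
    have hx2 : 0 = x.1 := by by_contra h'; exact hx1 (if_neg h')
    rw [if_pos hx2] at hx1
    refine ⟨x.2, ?_, Prod.ext hx2 rfl⟩
    have hx3 := right_ne_zero_of_mul hx
    rw [show x = (0, x.2) from Prod.ext hx2.symm rfl] at hx3
    exact mul_ne_zero hx1 hx3

/-- The residue of the relation for `x^-` at a row below which `mu` has no boxes. -/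
theorem IsPhiStar.last_row (hG : Generic r s) (hu : u ≠ 0) (hv : v ≠ 0)
    {T : Matrix (FockIdx × YoungDiagram) FockIdx K} (hT : IsPhiStar r s N w v u T)
    {lam mu : YoungDiagram} {i₀ : ℕ} (h : IsAddBox lam mu i₀) (hl : lam.colLen 0 = i₀ + 1)
    (a b : ℕ → K) (ha : ∀ i, a i = (r ^ 4) ^ mu.rowLen i * (s ^ 4)⁻¹ ^ i * u)
    (hb : ∀ i, b i = (r ^ 4) ^ mu.rowLen i * (s ^ 4)⁻¹ ^ (i + 1) * u) :
    -v * (r ^ (2 * N) * s ^ (-2 * N))⁻¹ *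
        (T (0, lam) 0 * coeffAm (r ^ 4) (s ^ 4) lam i₀) * a i₀ ^ (-N) *
        ∏ i ∈ (Finset.range (i₀ + 2)).erase i₀, (1 - a i / a i₀) =
      T (0, mu) 0 * ∏ j ∈ Finset.range (i₀ + 1), (1 - b j / a i₀) := by
  classical
  have h3 := hG.r_ne
  have h4 := hG.s_ne
  have ha0 : ∀ i, a i ≠ 0 := fun i => by
    rw [ha]
    exact mul_ne_zero (mul_ne_zero (pow_ne_zero _ (pow_ne_zero _ h3))
      (pow_ne_zero _ (inv_ne_zero (pow_ne_zero _ h4)))) hu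
  have hmu : mu.colLen 0 ≤ i₀ + 1 := hl ▸ h.colLen_le
  have key := residue_eq (I := Finset.range (i₀ + 2)) (J := Finset.range (i₀ + 1)) (i₀ := i₀)
    (Finset.mem_range.mpr (by omega)) b a
    (fun i => -v * (r ^ (2 * N) * s ^ (-2 * N))⁻¹ * (∑ᶠ lam, if IsAddBox lam mu i then
      T (0, lam) 0 * coeffAm (r ^ 4) (s ^ 4) lam i else 0) * a i ^ (-N))
    (fun i _ => ha0 i)
    (PowerSeries.C (T (0, mu) 0) * charExp (r ^ 4) (s ^ 4) u mu)
    (T (0, mu) 0) (by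
      rw [mul_left_comm]
      congr 1
      simp only [ha, hb]
      exact charExp_mul _ _ _ _ hmu) 0 (fun m _ => by
      rw [PowerSeries.coeff_C_mul, hT.xm_rel hG hu hv mu (Nat.lt_succ_of_le hmu) m]
      refine Finset.sum_congr rfl fun i _ => ?_
      have e : a i ^ ((m : ℤ) - N) = a i ^ (-N) * a i ^ m := by
        rw [← zpow_natCast (a i) m, ← zpow_add₀ (ha0 i)]
        congr 1
        ring
      rw [← ha, mul_assoc _ (a i ^ (-N)), e])
  rw [finsum_single_of_subsingleton _ _ lam h fun nu hnu => hnu.left_unique h] at key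
  exact key

end Currents

/-! ### Adding a box to the last row -/

section Boxes

theorem IsAddBox.mem_iff {lam mu : YoungDiagram} {i₀ : ℕ} (h : IsAddBox lam mu i₀) (x : ℕ × ℕ) :
    x ∈ lam ↔ x ∈ mu ∨ x = (i₀, mu.rowLen i₀) := by
  obtain ⟨i, j⟩ := x
  rw [YoungDiagram.mem_iff_lt_rowLen, YoungDiagram.mem_iff_lt_rowLen, h i, Prod.mk.injEq]
  by_cases hi : i = i₀
  · subst hi; simp; omega
  · simp [hi]

theorem IsAddBox.notMem {lam mu : YoungDiagram} {i₀ : ℕ} (_ : IsAddBox lam mu i₀) :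
    (i₀, mu.rowLen i₀) ∉ mu := by
  rw [YoungDiagram.mem_iff_lt_rowLen]; exact lt_irrefl _

theorem IsAddBox.cells_eq {lam mu : YoungDiagram} {i₀ : ℕ} (h : IsAddBox lam mu i₀) :
    lam.cells = insert (i₀, mu.rowLen i₀) mu.cells := by
  ext x
  rw [Finset.mem_insert, YoungDiagram.mem_cells, YoungDiagram.mem_cells, h.mem_iff, or_comm]

theorem IsAddBox.card_eq {lam mu : YoungDiagram} {i₀ : ℕ} (h : IsAddBox lam mu i₀) :
    lam.card = mu.card + 1 := by
  rw [YoungDiagram.card, h.cells_eq, Finset.card_insert_of_notMem]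
  rw [YoungDiagram.mem_cells]; exact h.notMem

theorem IsAddBox.colLen_rowLen {lam mu : YoungDiagram} {i₀ : ℕ} (h : IsAddBox lam mu i₀) :
    mu.colLen (mu.rowLen i₀) = i₀ := by
  have h1 : ¬ i₀ < mu.colLen (mu.rowLen i₀) := by
    rw [← YoungDiagram.mem_iff_lt_colLen]; exact h.notMem
  have h2 : ∀ i, i < i₀ → i < mu.colLen (mu.rowLen i₀) := fun i hi => by
    rw [← YoungDiagram.mem_iff_lt_colLen]
    have h3 : (i₀, mu.rowLen i₀) ∈ lam := (h.mem_iff _).mpr (Or.inr rfl)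
    rcases (h.mem_iff _).mp (lam.up_left_mem hi.le le_rfl h3) with h4 | h4
    · exact h4
    · exact absurd (Prod.mk.inj h4).1 hi.ne
  by_contra h3
  have := h2 (mu.colLen (mu.rowLen i₀))
  omega

theorem IsAddBox.transpose {lam mu : YoungDiagram} {i₀ : ℕ} (h : IsAddBox lam mu i₀) :
    IsAddBox lam.transpose mu.transpose (mu.rowLen i₀) := by
  intro j
  rw [YoungDiagram.rowLen_transpose, YoungDiagram.rowLen_transpose]
  have h1 : ∀ i, i < lam.colLen j ↔ i < mu.colLen j ∨ (i = i₀ ∧ j = mu.rowLen i₀) := fun i => by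
    rw [← YoungDiagram.mem_iff_lt_colLen, ← YoungDiagram.mem_iff_lt_colLen, h.mem_iff,
      Prod.mk.injEq]
  split_ifs with hj
  · subst hj
    rw [h.colLen_rowLen] at h1 ⊢
    have h2 := h1 i₀
    have h3 := h1 (i₀ + 1)
    simp only [and_true, lt_self_iff_false, false_or, iff_true] at h2 h3
    omega
  · simp only [hj, and_false, or_false] at h1
    have h2 := h1 (lam.colLen j)
    have h3 := h1 (mu.colLen j)
    omega

theorem nStat_eq_sum {lam : YoungDiagram} {M : ℕ} (hM : lam.colLen 0 ≤ M) :
    nStat lam = ∑ i ∈ Finset.range M, i * lam.rowLen i := by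
  rw [nStat]
  refine Finset.sum_subset (Finset.range_mono hM) fun i _ hi => ?_
  rw [Finset.mem_range, not_lt] at hi
  rw [rowLen_eq_zero_of_le hi, mul_zero]

theorem IsAddBox.nStat_eq {lam mu : YoungDiagram} {i₀ : ℕ} (h : IsAddBox lam mu i₀) :
    nStat lam = nStat mu + i₀ := by
  rw [nStat_eq_sum (le_refl (lam.colLen 0)), nStat_eq_sum h.colLen_le]
  simp only [h _, mul_add, Finset.sum_add_distrib, mul_ite, mul_one, mul_zero]
  rw [Finset.sum_ite_eq', if_pos (Finset.mem_range.mpr h.lt_colLen)]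

variable {K : Type*} [Field K]

theorem IsAddBox.framing_eq {r s : K} (hr : r ≠ 0) (hs : s ≠ 0) {lam mu : YoungDiagram} {i₀ : ℕ}
    (h : IsAddBox lam mu i₀) :
    framing r s lam = framing r s mu *
      -(r ^ 2 / s ^ 2 * ((r ^ 4) ^ mu.rowLen i₀ * (s ^ 4)⁻¹ ^ i₀)) := by
  rw [framing, framing, h.nStat_eq, h.transpose.nStat_eq, h.card_eq]
  have e1 : (4 * ((nStat mu.transpose + mu.rowLen i₀ : ℕ) : ℤ) + 2 * ((mu.card + 1 : ℕ) : ℤ)) =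
      (4 * (nStat mu.transpose : ℤ) + 2 * mu.card) + (4 * mu.rowLen i₀ + 2 : ℕ) := by
    push_cast; ring
  have e2 : (-4 * ((nStat mu + i₀ : ℕ) : ℤ) - 2 * ((mu.card + 1 : ℕ) : ℤ)) =
      (-4 * (nStat mu : ℤ) - 2 * mu.card) + -((4 * i₀ + 2 : ℕ) : ℤ) := by
    push_cast; ring
  rw [e1, e2, zpow_add₀ hr, zpow_add₀ hs, zpow_natCast, zpow_neg, zpow_natCast]
  rw [pow_add r, pow_mul r, pow_add s, pow_mul s, inv_pow]
  field_simp
  ring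

theorem framing_bot (r s : K) : framing r s ⊥ = 1 := by
  have h : ∀ i, (⊥ : YoungDiagram).colLen i = 0 := fun i => by
    by_contra h0
    exact YoungDiagram.notMem_bot _ (YoungDiagram.mem_iff_lt_colLen.mpr (Nat.pos_of_ne_zero h0))
  have h2 : (⊥ : YoungDiagram).transpose = ⊥ := by
    rw [YoungDiagram.transpose_eq_iff_eq_transpose] <;> rfl
  have h1 : nStat ⊥ = 0 := by rw [nStat, h]; rfl
  rw [framing, h2, h1]
  simp [YoungDiagram.card]

theorem nek_bot_bot (q t x : K) : nek q t ⊥ ⊥ x = 1 := by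
  simp [nek]

theorem exists_last_row {lam : YoungDiagram} (h : lam ≠ ⊥) :
    ∃ (mu : YoungDiagram) (i₀ : ℕ), IsAddBox lam mu i₀ ∧ lam.colLen 0 = i₀ + 1 := by
  have h0 : 0 < lam.colLen 0 := by
    rw [Nat.pos_iff_ne_zero]
    intro h0
    apply h
    apply eq_of_rowLen_eq
    intro i
    rw [rowLen_eq_zero_of_le (by omega), rowLen_eq_zero_of_le]
    by_contra h1
    push Not at h1
    exact YoungDiagram.notMem_bot _ (YoungDiagram.mem_iff_lt_colLen.mpr h1)
  obtain ⟨i₀, hi₀⟩ : ∃ i₀, lam.colLen 0 = i₀ + 1 := ⟨lam.colLen 0 - 1, by omega⟩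
  obtain ⟨c, hc⟩ : ∃ c, lam.rowLen i₀ = c + 1 :=
    ⟨lam.rowLen i₀ - 1, by have := rowLen_pos_iff.mpr (show i₀ < lam.colLen 0 by omega); omega⟩
  have hlow : IsLowerSet ((lam.cells.erase (i₀, c) : Finset (ℕ × ℕ)) : Set (ℕ × ℕ)) := by
    intro y x hxy hy
    rw [Finset.mem_coe, Finset.mem_erase, YoungDiagram.mem_cells] at hy ⊢
    refine ⟨?_, lam.isLowerSet hxy hy.2⟩
    rintro rfl
    apply hy.1
    obtain ⟨i, j⟩ := y
    have h1 : (i, 0) ∈ lam := lam.up_left_mem le_rfl (Nat.zero_le j) hy.2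
    have h2 : i₀ ≤ i := hxy.1
    have h3 : c ≤ j := hxy.2
    rw [YoungDiagram.mem_iff_lt_colLen] at h1
    have h4 : i = i₀ := by omega
    subst h4
    have h5 := YoungDiagram.mem_iff_lt_rowLen.mp hy.2
    rw [show j = c by omega]
  refine ⟨⟨lam.cells.erase (i₀, c), hlow⟩, i₀, fun i => ?_, hi₀⟩
  set mu : YoungDiagram := ⟨lam.cells.erase (i₀, c), hlow⟩ with hmu
  have hm : ∀ j, j < mu.rowLen i ↔ j < lam.rowLen i ∧ ¬(i = i₀ ∧ j = c) := fun j => by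
    rw [← YoungDiagram.mem_iff_lt_rowLen, ← YoungDiagram.mem_iff_lt_rowLen,
      ← YoungDiagram.mem_cells, hmu, Finset.mem_erase, YoungDiagram.mem_cells, and_comm,
      ne_eq, Prod.mk.injEq]
  split_ifs with hi
  · subst hi
    have h1 := hm c
    have h2 := hm (c - 1)
    have h3 := hm (mu.rowLen i)
    omega
  · simp only [hi, false_and, not_false_eq_true, and_true] at hm
    have h1 := hm (mu.rowLen i)
    have h2 := hm (lam.rowLen i)
    omega

theorem last_row_induction {P : YoungDiagram → Prop} (h0 : P ⊥)
    (h1 : ∀ lam mu i₀, IsAddBox lam mu i₀ → lam.colLen 0 = i₀ + 1 → P mu → P lam)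
    (lam : YoungDiagram) : P lam := by
  induction hn : lam.card generalizing lam with
  | zero =>
    have : lam = ⊥ := by
      by_contra h
      obtain ⟨mu, i₀, h, _⟩ := exists_last_row h
      have := h.card_eq
      omega
    rwa [this]
  | succ n ih =>
    have : lam ≠ ⊥ := by rintro rfl; simp [YoungDiagram.card] at hn
    obtain ⟨mu, i₀, h, hl⟩ := exists_last_row this
    exact h1 lam mu i₀ h hl (ih mu (by have := h.card_eq; omega))

@[to_additive]
theorem prod_cells_eq {R : Type*} [CommMonoid R] (lam : YoungDiagram) (f : ℕ → ℕ → R) {M : ℕ} (hM : lam.colLen 0 ≤ M) :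
    ∏ b ∈ lam.cells, f b.1 b.2 =
      ∏ i ∈ Finset.range M, ∏ j ∈ Finset.range (lam.rowLen i), f i j := by
  rw [Finset.prod_sigma']
  refine Finset.prod_bij' (fun b _ => ⟨b.1, b.2⟩) (fun p _ => (p.1, p.2)) ?_ ?_ ?_ ?_ ?_
  · rintro ⟨i, j⟩ h
    rw [YoungDiagram.mem_cells] at h
    rw [Finset.mem_sigma, Finset.mem_range, Finset.mem_range]
    refine ⟨lt_of_lt_of_le ?_ hM, YoungDiagram.mem_iff_lt_rowLen.mp h⟩
    exact YoungDiagram.mem_iff_lt_colLen.mp (lam.up_left_mem le_rfl (Nat.zero_le j) h)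
  · rintro ⟨i, j⟩ h
    rw [Finset.mem_sigma, Finset.mem_range, Finset.mem_range] at h
    rw [YoungDiagram.mem_cells]
    exact YoungDiagram.mem_iff_lt_rowLen.mpr h.2
  all_goals intros; rfl

/-- The contribution of the box `(i, j)` to `N_{λ,λ}(1)`. -/
def hookFactor (q t : K) (lam : YoungDiagram) (i j : ℕ) : K :=
  (1 - q ^ (-(lam.rowLen i : ℤ) + j) * t ^ (-(lam.colLen j : ℤ) + i + 1)) *
    (1 - q ^ ((lam.rowLen i : ℤ) - j - 1) * t ^ ((lam.colLen j : ℤ) - i))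

theorem nek_self (q t : K) (lam : YoungDiagram) :
    nek q t lam lam 1 = ∏ b ∈ lam.cells, hookFactor q t lam b.1 b.2 := by
  rw [nek, ← Finset.prod_mul_distrib]
  simp only [one_mul, hookFactor]

theorem Generic.nek_self_ne {r s : K} (hG : Generic r s) (lam : YoungDiagram) :
    nek (r ^ 4) (s ^ 4) lam lam 1 ≠ 0 := by
  rw [nek_self, Finset.prod_ne_zero_iff]
  rintro ⟨i, j⟩ h
  rw [YoungDiagram.mem_cells] at h
  have h1 := YoungDiagram.mem_iff_lt_rowLen.mp h
  have h2 := YoungDiagram.mem_iff_lt_colLen.mp h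
  exact mul_ne_zero (hG.one_sub_ne _ _ (by simp only; omega)) (hG.one_sub_ne _ _ (by simp only; omega))

theorem Generic.nek_self_last_row {r s : K} (hG : Generic r s) {lam mu : YoungDiagram} {i₀ : ℕ}
    (h : IsAddBox lam mu i₀) (hl : lam.colLen 0 = i₀ + 1) (c : ℕ) (hc : mu.rowLen i₀ = c)
    (z : ℕ → K) (hz : ∀ i, z i = (r ^ 4) ^ ((mu.rowLen i : ℤ) - c) * (s ^ 4) ^ ((i₀ : ℤ) - i)) :
    nek (r ^ 4) (s ^ 4) lam lam 1 *
        ∏ i ∈ Finset.range i₀, ((1 - z i / s ^ 4) * (1 - z i / r ^ 4)) =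
      nek (r ^ 4) (s ^ 4) mu mu 1 *
        ((1 - (r ^ 4) ^ (-(c : ℤ) - 1)) * (1 - (r ^ 4) ^ c * s ^ 4)) *
        ∏ i ∈ Finset.range i₀, ((s ^ 4)⁻¹ * (1 - z i) * (1 - z i * s ^ 4 / r ^ 4)) := by
  have hq : r ^ 4 ≠ 0 := pow_ne_zero _ hG.r_ne
  have ht : s ^ 4 ≠ 0 := pow_ne_zero _ hG.s_ne
  rw [nek_self, nek_self, prod_cells_eq lam _ hl.le, prod_cells_eq mu _ (hl ▸ h.colLen_le),
    Finset.prod_range_succ, Finset.prod_range_succ]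
  have hcol : ∀ j, lam.colLen j = mu.colLen j + if j = c then 1 else 0 := fun j => by
    have := h.transpose j
    rwa [YoungDiagram.rowLen_transpose, YoungDiagram.rowLen_transpose, hc] at this
  have hcc : mu.colLen c = i₀ := hc ▸ h.colLen_rowLen
  -- the last row, where all legs vanish
  have hlast : ∏ j ∈ Finset.range (lam.rowLen i₀), hookFactor (r ^ 4) (s ^ 4) lam i₀ j =
      (∏ j ∈ Finset.range (mu.rowLen i₀), hookFactor (r ^ 4) (s ^ 4) mu i₀ j) *
        ((1 - (r ^ 4) ^ (-(c : ℤ) - 1)) * (1 - (r ^ 4) ^ c * s ^ 4)) := by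
    have h1 : lam.rowLen i₀ = c + 1 := by rw [h i₀, if_pos rfl, hc]
    rw [h1, hc, Finset.prod_range_succ', mul_comm]
    have h2 : ∀ j, j ≤ c → lam.colLen j = i₀ + 1 := fun j hj => by
      apply le_antisymm
      · rw [← hl]; exact lam.colLen_anti _ _ (Nat.zero_le _)
      · have : (i₀, j) ∈ lam := YoungDiagram.mem_iff_lt_rowLen.mpr (by omega)
        exact YoungDiagram.mem_iff_lt_colLen.mp this
    rw [mul_comm]
    congr 1
    · refine Finset.prod_congr rfl fun j hj => ?_
      rw [Finset.mem_range] at hj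
      have h3 := hcol j
      rw [h2 j hj.le, if_neg hj.ne, add_zero] at h3
      rw [hookFactor, hookFactor, h2 _ hj, ← h3, h1, hc]
      push_cast
      ring_nf
    · rw [hookFactor, h2 0 (Nat.zero_le _), h1]
      have e1 : -((c + 1 : ℕ) : ℤ) + (0 : ℕ) = -(c : ℤ) - 1 := by push_cast; ring
      have e2 : -((i₀ + 1 : ℕ) : ℤ) + i₀ + 1 = 0 := by push_cast; ring
      have e3 : ((c + 1 : ℕ) : ℤ) - (0 : ℕ) - 1 = c := by push_cast; ring
      have e4 : ((i₀ + 1 : ℕ) : ℤ) - i₀ = 1 := by push_cast; ring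
      rw [e1, e2, e3, e4, zpow_zero, mul_one, zpow_one, zpow_natCast]
  -- in a row above, only the leg of the box in column `c` changes
  have hrow : ∀ i ∈ Finset.range i₀,
      (∏ j ∈ Finset.range (lam.rowLen i), hookFactor (r ^ 4) (s ^ 4) lam i j) *
        ((1 - z i / s ^ 4) * (1 - z i / r ^ 4)) =
      (∏ j ∈ Finset.range (mu.rowLen i), hookFactor (r ^ 4) (s ^ 4) mu i j) *
        ((s ^ 4)⁻¹ * (1 - z i) * (1 - z i * s ^ 4 / r ^ 4)) := by
    intro i hi
    rw [Finset.mem_range] at hi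
    have h1 : lam.rowLen i = mu.rowLen i := by rw [h i, if_neg hi.ne, add_zero]
    have h2 : c < mu.rowLen i := by
      rw [← YoungDiagram.mem_iff_lt_rowLen, YoungDiagram.mem_iff_lt_colLen, hcc]; exact hi
    rw [h1, ← Finset.mul_prod_erase _ _ (Finset.mem_range.mpr h2),
      ← Finset.mul_prod_erase (Finset.range (mu.rowLen i)) (hookFactor (r ^ 4) (s ^ 4) mu i)
        (Finset.mem_range.mpr h2)]
    have h3 : ∏ j ∈ (Finset.range (mu.rowLen i)).erase c, hookFactor (r ^ 4) (s ^ 4) lam i j =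
        ∏ j ∈ (Finset.range (mu.rowLen i)).erase c, hookFactor (r ^ 4) (s ^ 4) mu i j := by
      refine Finset.prod_congr rfl fun j hj => ?_
      rw [hookFactor, hookFactor, h1, hcol j, if_neg (Finset.ne_of_mem_erase hj), add_zero]
    rw [h3]
    have h4 : hookFactor (r ^ 4) (s ^ 4) lam i c * ((1 - z i / s ^ 4) * (1 - z i / r ^ 4)) =
        hookFactor (r ^ 4) (s ^ 4) mu i c *
          ((s ^ 4)⁻¹ * (1 - z i) * (1 - z i * s ^ 4 / r ^ 4)) := by
      have hz0 : z i ≠ 0 := by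
        rw [hz]; exact mul_ne_zero (zpow_ne_zero _ hq) (zpow_ne_zero _ ht)
      have e1 : (r ^ 4) ^ (-(mu.rowLen i : ℤ) + c) * (s ^ 4) ^ (-((i₀ + 1 : ℕ) : ℤ) + i + 1) =
          (z i)⁻¹ := by
        rw [hz, mul_inv, ← zpow_neg, ← zpow_neg]
        congr 2 <;> push_cast <;> ring
      have e2 : (r ^ 4) ^ ((mu.rowLen i : ℤ) - c - 1) * (s ^ 4) ^ (((i₀ + 1 : ℕ) : ℤ) - i) =
          z i * s ^ 4 / r ^ 4 := by
        rw [hz, zpow_sub₀ hq _ 1, zpow_one, show ((i₀ + 1 : ℕ) : ℤ) - i = ((i₀ : ℤ) - i) + 1 by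
          push_cast; ring, zpow_add₀ ht, zpow_one]
        ring
      have e3 : (r ^ 4) ^ (-(mu.rowLen i : ℤ) + c) * (s ^ 4) ^ (-(i₀ : ℤ) + i + 1) =
          (z i)⁻¹ * s ^ 4 := by
        rw [zpow_add₀ ht, zpow_one, hz, mul_inv, ← zpow_neg, ← zpow_neg, mul_assoc]
        congr 2
        · ring
        · congr 1; ring
      have e4 : (r ^ 4) ^ ((mu.rowLen i : ℤ) - c - 1) * (s ^ 4) ^ ((i₀ : ℤ) - i) =
          z i / r ^ 4 := by
        rw [hz, zpow_sub₀ hq _ 1, zpow_one]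
        ring
      rw [hookFactor, hookFactor, h1, hcol c, if_pos rfl, hcc, e1, e2, e3, e4]
      generalize r ^ 4 = q at hq ⊢
      generalize s ^ 4 = t at ht ⊢
      field_simp
      ring
    rw [mul_right_comm, h4]
    ring
  have hprod := Finset.prod_mul_distrib.symm.trans
    ((Finset.prod_congr rfl hrow).trans Finset.prod_mul_distrib)
  rw [hlast, mul_right_comm, hprod]
  ring

end Boxes

/-! ### Vacuum entries in closed form -/

section VacuumProduct

variable {K : Type*} [Field K] [CharZero K] {r s : K} {N N' : ℤ} {u v w u' w' y : K}

theorem coeffAm_last_row (q t : K) {lam : YoungDiagram} {i₀ : ℕ} (hl : lam.colLen 0 = i₀ + 1) :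
    coeffAm q t lam i₀ = (1 - t⁻¹) * ((1 - q ^ (-(lam.rowLen i₀ : ℤ))) /
      (1 - q ^ (-(lam.rowLen i₀ : ℤ) + 1) * t⁻¹)) := by
  rw [coeffAm, hl, Finset.Ico_self, Finset.prod_empty, mul_one, rowLen_eq_zero_of_le hl.le]
  norm_num

theorem IsPhi.vacuum_last_row (hG : Generic r s) (hv : v ≠ 0) (hw : w ≠ 0)
    {T : Matrix FockIdx (YoungDiagram × FockIdx) K} (hT : IsPhi r s N v u w T)
    {lam mu : YoungDiagram} {i₀ : ℕ} (h : IsAddBox lam mu i₀) (hl : lam.colLen 0 = i₀ + 1)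
    (c : ℕ) (hc : mu.rowLen i₀ = c)
    (z : ℕ → K) (hz : ∀ i, z i = (r ^ 4) ^ ((mu.rowLen i : ℤ) - c) * (s ^ 4) ^ ((i₀ : ℤ) - i)) :
    w * T 0 (mu, 0) * (r ^ 2 / s ^ 2 * ((r ^ 4) ^ c * (s ^ 4)⁻¹ ^ i₀ * v)) ^ (-N - 1) *
        ∏ i ∈ Finset.range i₀, (1 - z i / r ^ 4) =
      -(T 0 (lam, 0) * s ^ 4 * (1 - (r ^ 4) ^ (-(c : ℤ)) * (s ^ 4)⁻¹) *
        ∏ i ∈ Finset.range i₀, (1 - z i * s ^ 4 / r ^ 4)) := by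
  have hr := hG.r_ne
  have hs := hG.s_ne
  have hq : r ^ 4 ≠ 0 := pow_ne_zero _ hr
  have ht : s ^ 4 ≠ 0 := pow_ne_zero _ hs
  have key := hT.last_row hG hv hw h hl _ _ (fun _ => rfl) (fun _ => rfl)
  set x := v * s ^ 2 / r ^ 2 with hx
  have hx0 : x ≠ 0 := div_ne_zero (mul_ne_zero hv (pow_ne_zero _ hs)) (pow_ne_zero _ hr)
  have h1 : lam.rowLen i₀ = c + 1 := by rw [h i₀, if_pos rfl, hc]
  have hb : (r ^ 4) ^ lam.rowLen i₀ * (s ^ 4)⁻¹ ^ (i₀ + 1) * x =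
      r ^ 2 / s ^ 2 * ((r ^ 4) ^ c * (s ^ 4)⁻¹ ^ i₀ * v) := by
    rw [h1, hx]
    simp only [pow_succ _ c, pow_succ _ i₀, inv_pow]
    field_simp
  have hz' : ∀ i, z i = (r ^ 4) ^ mu.rowLen i * ((r ^ 4) ^ c)⁻¹ * ((s ^ 4) ^ i₀ * ((s ^ 4) ^ i)⁻¹) :=
    fun i => by rw [hz, zpow_sub₀ hq, zpow_sub₀ ht]; simp only [zpow_natCast, div_eq_mul_inv]
  have hlam : ∀ i ∈ Finset.range i₀, lam.rowLen i = mu.rowLen i := fun i hi => by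
    rw [h i, if_neg (Finset.mem_range.mp hi).ne, add_zero]
  have e1 : ∏ i ∈ (Finset.range (i₀ + 1)).erase i₀,
      (1 - (r ^ 4) ^ lam.rowLen i * (s ^ 4)⁻¹ ^ (i + 1) * x /
        ((r ^ 4) ^ lam.rowLen i₀ * (s ^ 4)⁻¹ ^ (i₀ + 1) * x)) =
      ∏ i ∈ Finset.range i₀, (1 - z i / r ^ 4) := by
    rw [Finset.range_add_one, Finset.erase_insert Finset.notMem_range_self]
    refine Finset.prod_congr rfl fun i hi => ?_
    rw [hlam i hi, h1, hz']
    simp only [pow_succ _ c, pow_succ _ i₀, pow_succ _ i, inv_pow]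
    field_simp
  have e2 : ∏ j ∈ Finset.range (i₀ + 2),
      (1 - (r ^ 4) ^ lam.rowLen j * (s ^ 4)⁻¹ ^ j * x /
        ((r ^ 4) ^ lam.rowLen i₀ * (s ^ 4)⁻¹ ^ (i₀ + 1) * x)) =
      (∏ i ∈ Finset.range i₀, (1 - z i * s ^ 4 / r ^ 4)) * (1 - s ^ 4) *
        (1 - (r ^ 4) ^ (-(c : ℤ) - 1)) := by
    rw [Finset.prod_range_succ, Finset.prod_range_succ, rowLen_eq_zero_of_le hl.le]
    congr 1
    · congr 1
      · refine Finset.prod_congr rfl fun i hi => ?_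
        rw [hlam i hi, h1, hz']
        simp only [pow_succ _ c, pow_succ _ i₀, inv_pow]
        field_simp
      · congr 1
        simp only [pow_succ _ i₀, inv_pow]
        field_simp
    · rw [h1, zpow_sub₀ hq, zpow_one, zpow_neg, zpow_natCast, pow_zero, pow_succ _ c]
      field_simp
  rw [e1, e2, hb, coeffAm_last_row _ _ hl, h1] at key
  have h2 : 1 - (r ^ 4) ^ (-(c : ℤ) - 1) ≠ 0 := by
    simpa using hG.one_sub_ne (-(c : ℤ) - 1) 0 (by omega)
  have h3 : 1 - (s ^ 4)⁻¹ ≠ 0 := by simpa using hG.one_sub_t_inv_ne one_ne_zero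
  have h4 : 1 - (r ^ 4) ^ (-(c : ℤ)) * (s ^ 4)⁻¹ ≠ 0 := by
    simpa using hG.one_sub_ne (-(c : ℤ)) (-1) (by omega)
  have e3 : -((c + 1 : ℕ) : ℤ) + 1 = -(c : ℤ) := by push_cast; ring
  have e4 : -((c + 1 : ℕ) : ℤ) = -(c : ℤ) - 1 := by push_cast; ring
  have e5 : 1 - s ^ 4 = -(s ^ 4 * (1 - (s ^ 4)⁻¹)) := by field_simp; ring
  rw [e3, e4, e5] at key
  generalize 1 - (r ^ 4) ^ (-(c : ℤ) - 1) = B at h2 key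
  generalize 1 - (s ^ 4)⁻¹ = C at h3 key
  generalize 1 - (r ^ 4) ^ (-(c : ℤ)) * (s ^ 4)⁻¹ = D at h4 key ⊢
  generalize (r ^ 2 / s ^ 2 * ((r ^ 4) ^ c * (s ^ 4)⁻¹ ^ i₀ * v)) ^ (-N - 1) = Y at key ⊢
  generalize ∏ i ∈ Finset.range i₀, (1 - z i / r ^ 4) = P at key ⊢
  generalize ∏ i ∈ Finset.range i₀, (1 - z i * s ^ 4 / r ^ 4) = Q at key ⊢
  have key' : (C * B) * (w * T 0 (mu, 0) * Y * P) = (C * B) * -(T 0 (lam, 0) * s ^ 4 * D * Q) := by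
    have h5 : C * (B / D) * D = C * B := by field_simp
    linear_combination D * key - (w * T 0 (mu, 0) * Y * P) * h5
  exact mul_left_cancel₀ (mul_ne_zero h3 h2) key'

theorem IsPhiStar.vacuum_last_row (hG : Generic r s) (hu : u ≠ 0) (hv : v ≠ 0)
    {T : Matrix (FockIdx × YoungDiagram) FockIdx K} (hT : IsPhiStar r s N w v u T)
    {lam mu : YoungDiagram} {i₀ : ℕ} (h : IsAddBox lam mu i₀) (hl : lam.colLen 0 = i₀ + 1)
    (c : ℕ) (hc : mu.rowLen i₀ = c)
    (z : ℕ → K) (hz : ∀ i, z i = (r ^ 4) ^ ((mu.rowLen i : ℤ) - c) * (s ^ 4) ^ ((i₀ : ℤ) - i)) :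
    -v * T (0, lam) 0 * (r ^ 2 / s ^ 2 * ((r ^ 4) ^ c * (s ^ 4)⁻¹ ^ i₀ * u)) ^ (-N) *
        (1 - (r ^ 4) ^ (-(c : ℤ) - 1)) * ∏ i ∈ Finset.range i₀, (1 - z i) =
      T (0, mu) 0 * ∏ i ∈ Finset.range i₀, (1 - z i / s ^ 4) := by
  have hr := hG.r_ne
  have hs := hG.s_ne
  have hq : r ^ 4 ≠ 0 := pow_ne_zero _ hr
  have ht : s ^ 4 ≠ 0 := pow_ne_zero _ hs
  have key := hT.last_row hG hu hv h hl _ _ (fun _ => rfl) (fun _ => rfl)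
  have h1 : lam.rowLen i₀ = c + 1 := by rw [h i₀, if_pos rfl, hc]
  have hmu : mu.rowLen (i₀ + 1) = 0 := rowLen_eq_zero_of_le (hl ▸ h.colLen_le)
  have hz' : ∀ i, z i = (r ^ 4) ^ mu.rowLen i * ((r ^ 4) ^ c)⁻¹ * ((s ^ 4) ^ i₀ * ((s ^ 4) ^ i)⁻¹) :=
    fun i => by rw [hz, zpow_sub₀ hq, zpow_sub₀ ht]; simp only [zpow_natCast, div_eq_mul_inv]
  have e1 : ∏ i ∈ (Finset.range (i₀ + 2)).erase i₀,
      (1 - (r ^ 4) ^ mu.rowLen i * (s ^ 4)⁻¹ ^ i * u /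
        ((r ^ 4) ^ mu.rowLen i₀ * (s ^ 4)⁻¹ ^ i₀ * u)) =
      (∏ i ∈ Finset.range i₀, (1 - z i)) * (1 - (r ^ 4) ^ (-(c : ℤ)) * (s ^ 4)⁻¹) := by
    have e : (Finset.range (i₀ + 2)).erase i₀ = insert (i₀ + 1) (Finset.range i₀) := by
      ext i; simp only [Finset.mem_erase, Finset.mem_insert, Finset.mem_range]; omega
    rw [e, Finset.prod_insert (by simp), hmu, mul_comm]
    congr 1
    · refine Finset.prod_congr rfl fun i hi => ?_
      rw [hz', hc]
      simp only [inv_pow]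
      field_simp
    · rw [hc, zpow_neg, zpow_natCast, pow_zero, pow_succ _ i₀]
      simp only [inv_pow]
      field_simp
  have e2 : ∏ j ∈ Finset.range (i₀ + 1),
      (1 - (r ^ 4) ^ mu.rowLen j * (s ^ 4)⁻¹ ^ (j + 1) * u /
        ((r ^ 4) ^ mu.rowLen i₀ * (s ^ 4)⁻¹ ^ i₀ * u)) =
      (∏ i ∈ Finset.range i₀, (1 - z i / s ^ 4)) * (1 - (s ^ 4)⁻¹) := by
    rw [Finset.prod_range_succ]
    congr 1
    · refine Finset.prod_congr rfl fun i hi => ?_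
      rw [hc, hz']
      simp only [pow_succ _ i, inv_pow]
      field_simp
    · congr 1
      simp only [pow_succ _ i₀, inv_pow]
      field_simp
  rw [e1, e2, coeffAm_last_row _ _ hl, h1, hc] at key
  have h3 : 1 - (s ^ 4)⁻¹ ≠ 0 := by simpa using hG.one_sub_t_inv_ne one_ne_zero
  have h4 : 1 - (r ^ 4) ^ (-(c : ℤ)) * (s ^ 4)⁻¹ ≠ 0 := by
    simpa using hG.one_sub_ne (-(c : ℤ)) (-1) (by omega)
  have e3 : -((c + 1 : ℕ) : ℤ) + 1 = -(c : ℤ) := by push_cast; ring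
  have e4 : -((c + 1 : ℕ) : ℤ) = -(c : ℤ) - 1 := by push_cast; ring
  have e5 : (r ^ 2 / s ^ 2 * ((r ^ 4) ^ c * (s ^ 4)⁻¹ ^ i₀ * u)) ^ (-N) =
      (r ^ (2 * N) * s ^ (-2 * N))⁻¹ * ((r ^ 4) ^ c * (s ^ 4)⁻¹ ^ i₀ * u) ^ (-N) := by
    rw [mul_zpow (r ^ 2 / s ^ 2), div_zpow, zpow_neg, zpow_neg (s ^ 2), zpow_mul, zpow_mul]
    have e6 : (s ^ (-2 : ℤ)) = (s ^ 2)⁻¹ := by rw [zpow_neg]; norm_cast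
    have e7 : (r ^ (2 : ℤ)) = r ^ 2 := by norm_cast
    rw [e6, e7, inv_zpow, mul_inv, div_eq_mul_inv]
  rw [e3, e4] at key
  rw [e5]
  generalize 1 - (r ^ 4) ^ (-(c : ℤ) - 1) = B at key ⊢
  generalize 1 - (s ^ 4)⁻¹ = C at h3 key
  generalize 1 - (r ^ 4) ^ (-(c : ℤ)) * (s ^ 4)⁻¹ = D at h4 key
  generalize ((r ^ 4) ^ c * (s ^ 4)⁻¹ ^ i₀ * u) ^ (-N) = Y at key ⊢
  generalize (r ^ (2 * N) * s ^ (-2 * N))⁻¹ = Y' at key ⊢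
  generalize ∏ i ∈ Finset.range i₀, (1 - z i) = P at key ⊢
  generalize ∏ i ∈ Finset.range i₀, (1 - z i / s ^ 4) = Q at key ⊢
  apply mul_left_cancel₀ h3
  have h5 : C * (B / D) * D = C * B := by field_simp
  linear_combination key + (v * T (0, lam) 0 * Y' * Y * P) * h5

/-- The product of the vacuum entries of `Φ_λ` and `Φ^*_λ`. -/
theorem vacuum_mul_vacuum (hG : Generic r s) (hy : y ≠ 0) (hw : w ≠ 0) (hu' : u' ≠ 0)
    {T : Matrix FockIdx (YoungDiagram × FockIdx) K} (hT : IsPhi r s N y u w T)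
    {T' : Matrix (FockIdx × YoungDiagram) FockIdx K} (hT' : IsPhiStar r s N' w' u' y T')
    (lam : YoungDiagram) :
    T' (0, lam) 0 * T 0 (lam, 0) =
      (w / u' * (r ^ 2 / s ^ 2)⁻¹ * (-y) ^ (N' - N - 1)) ^ lam.card *
        framing r s lam ^ (N' - N) / nek (r ^ 4) (s ^ 4) lam lam 1 := by
  induction lam using last_row_induction with
  | h0 =>
    rw [hT.normalized, hT'.normalized, framing_bot, nek_bot_bot, one_zpow]
    simp [YoungDiagram.card]
  | h1 lam mu i₀ h hl ih =>
    have hr := hG.r_ne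
    have hs := hG.s_ne
    have hq : r ^ 4 ≠ 0 := pow_ne_zero _ hr
    have ht : s ^ 4 ≠ 0 := pow_ne_zero _ hs
    obtain ⟨c, hc⟩ : ∃ c, mu.rowLen i₀ = c := ⟨_, rfl⟩
    obtain ⟨z, hz⟩ : ∃ z : ℕ → K, ∀ i, z i =
      (r ^ 4) ^ ((mu.rowLen i : ℤ) - c) * (s ^ 4) ^ ((i₀ : ℤ) - i) := ⟨_, fun _ => rfl⟩
    -- `z_i` is the weight `q^{j-1} t^{1-i}` of the first box to the right of row `i`, relative to
    -- that of the new box; the factors with `z_i` cancel between the recursions `k1`, `k2`, `k3`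
    have k1 := hT.vacuum_last_row hG hy hw h hl c hc z hz
    have k2 := hT'.vacuum_last_row hG hy hu' h hl c hc z hz
    have k3 := hG.nek_self_last_row h hl c hc z hz
    have hrow : ∀ i ∈ Finset.range i₀, c < mu.rowLen i := fun i hi => by
      rw [← YoungDiagram.mem_iff_lt_rowLen, YoungDiagram.mem_iff_lt_colLen, ← hc, h.colLen_rowLen]
      exact Finset.mem_range.mp hi
    have n1 : ∏ i ∈ Finset.range i₀, (1 - z i) ≠ 0 := Finset.prod_ne_zero_iff.mpr fun i hi => by
      have := hrow i hi
      rw [hz]; exact hG.one_sub_ne _ _ (by omega)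
    have n2 : ∏ i ∈ Finset.range i₀, (1 - z i * s ^ 4 / r ^ 4) ≠ 0 :=
      Finset.prod_ne_zero_iff.mpr fun i hi => by
        have := Finset.mem_range.mp hi
        have e : z i * s ^ 4 / r ^ 4 = (r ^ 4) ^ ((mu.rowLen i : ℤ) - c - 1) *
            (s ^ 4) ^ ((i₀ : ℤ) - i + 1) := by
          rw [hz, zpow_sub₀ hq _ 1, zpow_add₀ ht _ 1, zpow_one, zpow_one]; ring
        rw [e]; exact hG.one_sub_ne _ _ (by omega)
    have n3 : ∏ i ∈ Finset.range i₀, (1 - z i / s ^ 4) ≠ 0 :=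
      Finset.prod_ne_zero_iff.mpr fun i hi => by
        have := hrow i hi
        have e : z i / s ^ 4 = (r ^ 4) ^ ((mu.rowLen i : ℤ) - c) *
            (s ^ 4) ^ ((i₀ : ℤ) - i - 1) := by
          rw [hz, zpow_sub₀ ht _ 1, zpow_one]; ring
        rw [e]; exact hG.one_sub_ne _ _ (by omega)
    have n4 : ∏ i ∈ Finset.range i₀, (1 - z i / r ^ 4) ≠ 0 :=
      Finset.prod_ne_zero_iff.mpr fun i hi => by
        have := Finset.mem_range.mp hi
        have e : z i / r ^ 4 = (r ^ 4) ^ ((mu.rowLen i : ℤ) - c - 1) *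
            (s ^ 4) ^ ((i₀ : ℤ) - i) := by
          rw [hz, zpow_sub₀ hq _ 1, zpow_one]; ring
        rw [e]; exact hG.one_sub_ne _ _ (by omega)
    have n5 : 1 - (r ^ 4) ^ (-(c : ℤ)) * (s ^ 4)⁻¹ ≠ 0 := by
      simpa using hG.one_sub_ne (-(c : ℤ)) (-1) (by omega)
    have n6 : 1 - (r ^ 4) ^ (-(c : ℤ) - 1) ≠ 0 := by
      simpa using hG.one_sub_ne (-(c : ℤ) - 1) 0 (by omega)
    rw [Finset.prod_mul_distrib, Finset.prod_mul_distrib, Finset.prod_mul_distrib,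
      Finset.prod_const, Finset.card_range] at k3
    have hD : 1 - (r ^ 4) ^ c * s ^ 4 =
        -((r ^ 4) ^ c * s ^ 4 * (1 - (r ^ 4) ^ (-(c : ℤ)) * (s ^ 4)⁻¹)) := by
      rw [zpow_neg, zpow_natCast]; field_simp; ring
    set φ := -(r ^ 2 / s ^ 2 * ((r ^ 4) ^ c * (s ^ 4)⁻¹ ^ i₀)) with hφ
    have hφ0 : φ ≠ 0 := neg_ne_zero.mpr (mul_ne_zero (div_ne_zero (pow_ne_zero _ hr)
      (pow_ne_zero _ hs)) (mul_ne_zero (pow_ne_zero _ hq) (pow_ne_zero _ (inv_ne_zero ht))))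
    have hχ : r ^ 2 / s ^ 2 * ((r ^ 4) ^ c * (s ^ 4)⁻¹ ^ i₀ * y) = φ * -y := by rw [hφ]; ring
    have hχ0 : φ * -y ≠ 0 := mul_ne_zero hφ0 (neg_ne_zero.mpr hy)
    rw [hχ] at k1 k2
    rw [hD] at k3
    have hm := hG.nek_self_ne mu
    have hl' := hG.nek_self_ne lam
    have hfr : framing r s lam = framing r s mu * φ := by rw [h.framing_eq hr hs, hc]
    have hE : φ ^ (N' - N) * (-y) ^ (N' - N - 1) * (φ * -y) ^ (-N') = φ * (φ * -y) ^ (-N - 1) := by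
      have e1 : φ ^ (N' - N) = φ * φ ^ (N' - N - 1) := by
        rw [← zpow_one_add₀ hφ0]; congr 1; ring
      rw [e1, mul_assoc φ, ← mul_zpow, mul_assoc, ← zpow_add₀ hχ0]
      congr 2
      ring
    have hE' : (φ * -y) ^ (-N') ≠ 0 := zpow_ne_zero _ hχ0
    have hρ : (r ^ 4) ^ c * (s ^ 4)⁻¹ ^ i₀ = -φ * (r ^ 2 / s ^ 2)⁻¹ := by
      rw [hφ]; field_simp
    rw [eq_div_iff hm] at ih
    rw [eq_div_iff hl', hfr, h.card_eq, mul_zpow, pow_succ _ mu.card]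
    generalize (φ * -y) ^ (-N - 1) = E at *
    generalize (φ * -y) ^ (-N') = E' at *
    generalize φ ^ (N' - N) = F at *
    generalize (-y) ^ (N' - N - 1) = Y at *
    generalize (r ^ 2 / s ^ 2)⁻¹ = ρ at *
    generalize (r ^ 4) ^ c = qc at *
    generalize (s ^ 4)⁻¹ ^ i₀ = ti at *
    generalize 1 - (r ^ 4) ^ (-(c : ℤ) - 1) = B at *
    generalize 1 - (r ^ 4) ^ (-(c : ℤ)) * (s ^ 4)⁻¹ = D at *
    generalize ∏ i ∈ Finset.range i₀, (1 - z i) = P₁ at *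
    generalize ∏ i ∈ Finset.range i₀, (1 - z i * s ^ 4 / r ^ 4) = P₂ at *
    generalize ∏ i ∈ Finset.range i₀, (1 - z i / s ^ 4) = P₃ at *
    generalize ∏ i ∈ Finset.range i₀, (1 - z i / r ^ 4) = P₄ at *
    generalize nek (r ^ 4) (s ^ 4) lam lam 1 = nl at *
    generalize nek (r ^ 4) (s ^ 4) mu mu 1 = nm at *
    generalize framing r s mu ^ (N' - N) = fm at *
    generalize T' (0, lam) 0 = a' at *
    generalize T 0 (lam, 0) = a at *
    generalize T' (0, mu) 0 = b' at *
    generalize T 0 (mu, 0) = b at *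
    have m1 : (B * s ^ 4 * D * P₁ * P₂) * (u' * E' * (a' * a * nl)) =
        (B * s ^ 4 * D * P₁ * P₂) * (w * E * -(qc * ti) * (b' * b * nm)) := by
      linear_combination (-b' * P₃ * nl) * k1 - (a * s ^ 4 * D * P₂ * nl) * k2 + (b' * w * b * E) * k3
    have m2 := mul_left_cancel₀
      (mul_ne_zero (mul_ne_zero (mul_ne_zero (mul_ne_zero n6 ht) n5) n1) n2) m1
    apply mul_left_cancel₀ (mul_ne_zero hu' hE')
    rw [m2, ih, hρ]
    generalize (w / u' * ρ * Y) ^ mu.card = κ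
    have hu : u' * (w / u') = w := by field_simp
    linear_combination (-κ * fm * w * ρ) * hE - (E' * κ * ρ * Y * fm * F) * hu

end VacuumProduct

/-! ### The character identity for Nekrasov factors -/

section CharacterIdentity

variable {K : Type*} [Field K]

theorem sum_Ico_geom {t : K} (ht : t ≠ 0) (i c : ℕ) (h : i ≤ c) :
    (1 - t⁻¹) * ∑ k ∈ Finset.Ico i c, t ^ ((i : ℤ) - k) = 1 - t ^ ((i : ℤ) - c) := by
  induction c, h using Nat.le_induction with
  | base => simp
  | succ c h ih =>
    rw [Finset.sum_Ico_succ_top h, mul_add, ih]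
    have : t ^ ((i : ℤ) - (c + 1 : ℕ)) = t ^ ((i : ℤ) - c) * t⁻¹ := by
      rw [← zpow_sub_one₀ ht]; congr 1; push_cast; ring
    rw [this]
    ring

/-- Rewriting column lengths by means of row lengths. -/
theorem sum_row_eq {q t : K} (ht : t ≠ 0) (lam : YoungDiagram) {M : ℕ} (hM : lam.colLen 0 ≤ M)
    (i : ℕ) :
    (1 - q) * ∑ j ∈ Finset.range (lam.rowLen i), q ^ j * t ^ ((i : ℤ) - lam.colLen j) =
      (1 - q ^ lam.rowLen i) -
        (1 - t⁻¹) * ∑ k ∈ Finset.Ico i M, t ^ ((i : ℤ) - k) * (1 - q ^ lam.rowLen k) := by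
  have hgeom : ∀ m : ℕ, (1 - q) * ∑ j ∈ Finset.range m, q ^ j = 1 - q ^ m := fun m =>
    mul_neg_geom_sum q m
  have h1 : ∀ j ∈ Finset.range (lam.rowLen i), q ^ j * t ^ ((i : ℤ) - lam.colLen j) =
      q ^ j - (1 - t⁻¹) * ∑ k ∈ Finset.Ico i M,
        t ^ ((i : ℤ) - k) * if j < lam.rowLen k then q ^ j else 0 := by
    intro j hj
    have hj' : i < lam.colLen j := by
      rw [← YoungDiagram.mem_iff_lt_colLen, YoungDiagram.mem_iff_lt_rowLen]
      exact Finset.mem_range.mp hj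
    have h2 : ∑ k ∈ Finset.Ico i M, t ^ ((i : ℤ) - k) * (if j < lam.rowLen k then q ^ j else 0) =
        q ^ j * ∑ k ∈ Finset.Ico i (lam.colLen j), t ^ ((i : ℤ) - k) := by
      have h3 : Finset.Ico i (lam.colLen j) =
          (Finset.Ico i M).filter fun k => j < lam.rowLen k := by
        ext k
        rw [Finset.mem_filter, Finset.mem_Ico, Finset.mem_Ico, ← YoungDiagram.mem_iff_lt_rowLen,
          YoungDiagram.mem_iff_lt_colLen]
        have := lam.colLen_anti _ _ (Nat.zero_le j)
        omega
      rw [h3, Finset.mul_sum, Finset.sum_filter]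
      refine Finset.sum_congr rfl fun k _ => ?_
      split_ifs <;> ring
    rw [h2, mul_left_comm, sum_Ico_geom ht _ _ hj'.le]
    ring
  rw [Finset.sum_congr rfl h1, Finset.sum_sub_distrib, mul_sub, hgeom, ← Finset.mul_sum,
    Finset.sum_comm, mul_left_comm]
  congr 2
  rw [Finset.mul_sum]
  refine Finset.sum_congr rfl fun k hk => ?_
  rw [← Finset.mul_sum, ← Finset.sum_filter, mul_left_comm, ← hgeom]
  congr 3
  ext j
  rw [Finset.mem_filter, Finset.mem_range, Finset.mem_range]
  have := lam.rowLen_anti _ _ (Finset.mem_Ico.mp hk).1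
  omega

theorem row_char_identity {t : K} (ht : t ≠ 0) (a b : ℕ → K) (M : ℕ) :
    1 - (t⁻¹ ^ M + (1 - t⁻¹) * ∑ i ∈ Finset.range M, t⁻¹ ^ i * a i) *
        (t ^ M + (1 - t) * ∑ i ∈ Finset.range M, t ^ i * b i) =
      (t - 1) * (∑ i ∈ Finset.range M, b i * ((1 - a i) -
        (1 - t⁻¹) * ∑ k ∈ Finset.Ico i M, t ^ ((i : ℤ) - k) * (1 - a k))) -
      (1 - t⁻¹) * (∑ k ∈ Finset.range M, a k * ((1 - b k) -
        (1 - t) * ∑ p ∈ Finset.Ico k M, t⁻¹ ^ ((k : ℤ) - p) * (1 - b p))) := by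
  induction M with
  | zero => simp
  | succ M ih =>
    have h1 : ∀ (x : K) (f g : ℕ → K) (y : K), x ≠ 0 →
        ∑ i ∈ Finset.range (M + 1), f i * ((1 - g i) -
        y * ∑ k ∈ Finset.Ico i (M + 1), x ^ ((i : ℤ) - k) * (1 - g k)) =
        (∑ i ∈ Finset.range M, f i * ((1 - g i) -
          y * ∑ k ∈ Finset.Ico i M, x ^ ((i : ℤ) - k) * (1 - g k))) -
          y * (1 - g M) * x⁻¹ ^ M * (∑ i ∈ Finset.range M, x ^ i * f i) +
          f M * ((1 - g M) - y * (1 - g M)) := by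
      intro x f g y hx
      rw [Finset.sum_range_succ]
      congr 1
      · rw [Finset.mul_sum, ← Finset.sum_sub_distrib]
        refine Finset.sum_congr rfl fun i hi => ?_
        rw [Finset.sum_Ico_succ_top (Finset.mem_range.mp hi).le, zpow_sub₀ hx, zpow_natCast,
          zpow_natCast, inv_pow]
        ring
      · rw [Finset.sum_Ico_succ_top le_rfl]
        simp
    rw [h1 t b a _ ht, h1 t⁻¹ a b _ (inv_ne_zero ht), Finset.sum_range_succ, Finset.sum_range_succ,
      inv_inv]
    generalize ∑ i ∈ Finset.range M, b i * ((1 - a i) -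
        (1 - t⁻¹) * ∑ k ∈ Finset.Ico i M, t ^ ((i : ℤ) - k) * (1 - a k)) = X at ih ⊢
    generalize ∑ k ∈ Finset.range M, a k * ((1 - b k) -
        (1 - t) * ∑ p ∈ Finset.Ico k M, t⁻¹ ^ ((k : ℤ) - p) * (1 - b p)) = Y at ih ⊢
    generalize ∑ i ∈ Finset.range M, t⁻¹ ^ i * a i = A at ih ⊢
    generalize ∑ i ∈ Finset.range M, t ^ i * b i = B at ih ⊢
    have h2 : t⁻¹ ^ M * t ^ M = 1 := by rw [inv_pow]; exact inv_mul_cancel₀ (pow_ne_zero _ ht)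
    have h3 : t⁻¹ * t = 1 := inv_mul_cancel₀ ht
    rw [pow_succ, pow_succ]
    linear_combination ih + ((1 - t) * (1 - b M) + (1 - t⁻¹) * (1 - a M) -
      (1 - t⁻¹) * (1 - t) * (1 - a M) * (1 - b M)) * h2 -
      ((1 - a M) * (1 - b M) + b M * (1 - a M) + a M * (1 - b M)) * h3

/-- The character behind the Nekrasov factors. -/
theorem char_identity {q t : K} (hq : q ≠ 0) (ht : t ≠ 0) (lam mu : YoungDiagram) :
    1 - partChar q t lam * partChar q⁻¹ t⁻¹ mu = (1 - q) * (1 - t⁻¹) *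
      ((∑ b ∈ lam.cells,
        q ^ (-(mu.rowLen b.1 : ℤ) + b.2) * t ^ (-(lam.colLen b.2 : ℤ) + b.1 + 1)) +
      ∑ b ∈ mu.cells,
        q ^ ((lam.rowLen b.1 : ℤ) - b.2 - 1) * t ^ ((mu.colLen b.2 : ℤ) - b.1)) := by
  set M := max (lam.colLen 0) (mu.colLen 0)
  have h1 := partChar_eq q t lam (le_max_left _ _ : _ ≤ M)
  have h2 := partChar_eq q⁻¹ t⁻¹ mu (le_max_right _ _ : _ ≤ M)
  rw [h1, h2, inv_inv, row_char_identity ht,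
    sum_cells_eq lam (fun i j => q ^ (-(mu.rowLen i : ℤ) + j) * t ^ (-(lam.colLen j : ℤ) + i + 1))
      (le_max_left _ _ : _ ≤ M),
    sum_cells_eq mu (fun i j => q ^ ((lam.rowLen i : ℤ) - j - 1) * t ^ ((mu.colLen j : ℤ) - i))
      (le_max_right _ _ : _ ≤ M), mul_add, sub_eq_add_neg]
  congr 1
  · rw [Finset.mul_sum, Finset.mul_sum]
    refine Finset.sum_congr rfl fun i _ => ?_
    rw [← sum_row_eq ht lam (le_max_left _ _), Finset.mul_sum, Finset.mul_sum, Finset.mul_sum,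
      Finset.mul_sum]
    refine Finset.sum_congr rfl fun j _ => ?_
    rw [inv_pow, zpow_add₀ hq, zpow_add₀ ht, zpow_neg, zpow_natCast, zpow_natCast, zpow_one,
      neg_add_eq_sub]
    field_simp
  · rw [← mul_neg, Finset.mul_sum, ← Finset.sum_neg_distrib, Finset.mul_sum]
    refine Finset.sum_congr rfl fun i _ => ?_
    have := sum_row_eq (q := q⁻¹) (inv_ne_zero ht) mu (le_max_right _ _ : _ ≤ M) i
    rw [inv_inv] at this
    rw [← this, Finset.mul_sum, Finset.mul_sum, Finset.mul_sum, ← Finset.sum_neg_distrib,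
      Finset.mul_sum]
    refine Finset.sum_congr rfl fun j _ => ?_
    rw [inv_zpow, ← zpow_neg, neg_sub, zpow_sub₀ hq, zpow_sub₀ hq, zpow_natCast, zpow_natCast,
      zpow_one, inv_pow]
    field_simp
    ring

/-- The monomials in `q, t` of the boxes in the first product of `N_{λ,μ}`. -/
def boxWeight₁ (q t : K) (lam mu : YoungDiagram) (b : ℕ × ℕ) : K :=
  q ^ (-(mu.rowLen b.1 : ℤ) + b.2) * t ^ (-(lam.colLen b.2 : ℤ) + b.1 + 1)

/-- The monomials in `q, t` of the boxes in the second product of `N_{λ,μ}`. -/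
def boxWeight₂ (q t : K) (lam mu : YoungDiagram) (b : ℕ × ℕ) : K :=
  q ^ ((lam.rowLen b.1 : ℤ) - b.2 - 1) * t ^ ((mu.colLen b.2 : ℤ) - b.1)

theorem nek_eq (q t : K) (lam mu : YoungDiagram) (x : K) :
    nek q t lam mu x = (∏ b ∈ lam.cells, (1 - x * boxWeight₁ q t lam mu b)) *
      ∏ b ∈ mu.cells, (1 - x * boxWeight₂ q t lam mu b) := by
  simp only [nek, boxWeight₁, boxWeight₂, mul_assoc]

theorem boxWeight₁_pow (q t : K) (lam mu : YoungDiagram) (b : ℕ × ℕ) (n : ℕ) :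
    boxWeight₁ (q ^ n) (t ^ n) lam mu b = boxWeight₁ q t lam mu b ^ n := by
  have h : ∀ (a : K) (z : ℤ), (a ^ n) ^ z = (a ^ z) ^ n := fun a z => by
    rw [← zpow_natCast, ← zpow_natCast, ← zpow_mul, ← zpow_mul, mul_comm]
  simp only [boxWeight₁, h, mul_pow]

theorem boxWeight₂_pow (q t : K) (lam mu : YoungDiagram) (b : ℕ × ℕ) (n : ℕ) :
    boxWeight₂ (q ^ n) (t ^ n) lam mu b = boxWeight₂ q t lam mu b ^ n := by
  have h : ∀ (a : K) (z : ℤ), (a ^ n) ^ z = (a ^ z) ^ n := fun a z => by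
    rw [← zpow_natCast, ← zpow_natCast, ← zpow_mul, ← zpow_mul, mul_comm]
  simp only [boxWeight₂, h, mul_pow]

theorem boxWeight_duality {q t : K} (hq : q ≠ 0) (ht : t ≠ 0) (lam mu : YoungDiagram)
    (b : ℕ × ℕ) : boxWeight₁ q t mu lam b * (boxWeight₂ q t lam mu b * (q / t)) = 1 := by
  have e : boxWeight₁ q t mu lam b * (boxWeight₂ q t lam mu b * (q / t)) =
      (q ^ (-(lam.rowLen b.1 : ℤ) + b.2) * q ^ ((lam.rowLen b.1 : ℤ) - b.2 - 1) * q ^ (1 : ℤ)) *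
      (t ^ (-(mu.colLen b.2 : ℤ) + b.1 + 1) * t ^ ((mu.colLen b.2 : ℤ) - b.1) * t ^ (-1 : ℤ)) := by
    rw [boxWeight₁, boxWeight₂, zpow_one, zpow_neg_one]; ring
  rw [e, ← zpow_add₀ hq, ← zpow_add₀ hq, ← zpow_add₀ ht, ← zpow_add₀ ht]
  ring_nf
  simp

theorem card_eq_sum_rowLen (lam : YoungDiagram) {M : ℕ} (hM : lam.colLen 0 ≤ M) :
    lam.card = ∑ i ∈ Finset.range M, lam.rowLen i := by
  have := sum_cells_eq lam (fun _ _ => 1) hM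
  simpa using this

theorem sum_cells_transpose (lam : YoungDiagram) (f : ℕ → ℕ → ℤ) :
    ∑ b ∈ lam.transpose.cells, f b.1 b.2 = ∑ b ∈ lam.cells, f b.2 b.1 := by
  refine Finset.sum_bij' (fun b _ => b.swap) (fun b _ => b.swap) ?_ ?_ ?_ ?_ ?_
  · intro b hb
    rw [YoungDiagram.mem_cells] at hb ⊢
    exact YoungDiagram.mem_transpose.mp hb
  · intro b hb
    rw [YoungDiagram.mem_cells] at hb ⊢
    rw [YoungDiagram.mem_transpose, Prod.swap_swap]
    exact hb
  all_goals intros; rfl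

theorem sum_cells_fst (lam : YoungDiagram) : ∑ b ∈ lam.cells, (b.1 : ℤ) = nStat lam := by
  rw [sum_cells_eq lam (fun i _ => (i : ℤ)) le_rfl, nStat]
  push_cast
  refine Finset.sum_congr rfl fun i _ => ?_
  rw [Finset.sum_const, Finset.card_range, nsmul_eq_mul, mul_comm]

theorem sum_cells_snd (lam : YoungDiagram) : ∑ b ∈ lam.cells, (b.2 : ℤ) = nStat lam.transpose := by
  rw [← sum_cells_fst, sum_cells_transpose lam fun i _ => (i : ℤ)]

theorem sum_cells_rowLen_comm (lam mu : YoungDiagram) :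
    ∑ b ∈ lam.cells, (mu.rowLen b.1 : ℤ) = ∑ b ∈ mu.cells, (lam.rowLen b.1 : ℤ) := by
  set M := max (lam.colLen 0) (mu.colLen 0)
  rw [sum_cells_eq lam (fun i _ => (mu.rowLen i : ℤ)) (le_max_left _ _ : _ ≤ M),
    sum_cells_eq mu (fun i _ => (lam.rowLen i : ℤ)) (le_max_right _ _ : _ ≤ M)]
  refine Finset.sum_congr rfl fun i _ => ?_
  rw [Finset.sum_const, Finset.sum_const, Finset.card_range, Finset.card_range, nsmul_eq_mul,
    nsmul_eq_mul, mul_comm]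

theorem sum_cells_rowLen_self (lam : YoungDiagram) :
    ∑ b ∈ lam.cells, (lam.rowLen b.1 : ℤ) = 2 * nStat lam.transpose + lam.card := by
  rw [← sum_cells_snd, YoungDiagram.card, Finset.card_eq_sum_ones, Nat.cast_sum, Finset.mul_sum,
    ← Finset.sum_add_distrib, sum_cells_eq lam (fun i _ => (lam.rowLen i : ℤ)) le_rfl,
    sum_cells_eq lam (fun _ j => 2 * (j : ℤ) + ((1 : ℕ) : ℤ)) le_rfl]
  refine Finset.sum_congr rfl fun i _ => ?_
  rw [Finset.sum_const, Finset.card_range, nsmul_eq_mul]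
  induction lam.rowLen i with
  | zero => simp
  | succ n ih => rw [Finset.sum_range_succ, ← ih]; push_cast; ring

theorem sum_cells_colLen_self (lam : YoungDiagram) :
    ∑ b ∈ lam.cells, (lam.colLen b.2 : ℤ) = 2 * nStat lam + lam.card := by
  have h := sum_cells_rowLen_self lam.transpose
  rw [YoungDiagram.transpose_transpose] at h
  have h2 : lam.transpose.card = lam.card := by
    rw [card_eq_sum_rowLen lam.transpose (M := lam.rowLen 0)
      (by rw [YoungDiagram.colLen_transpose])]
    simp only [YoungDiagram.rowLen_transpose]
    have h3 := sum_cells_transpose lam (fun _ _ => 1)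
    simp only [Finset.sum_const, nsmul_eq_mul, mul_one] at h3
    have h4 : lam.transpose.card = lam.card := by exact_mod_cast h3
    rw [← h4, card_eq_sum_rowLen lam.transpose (M := lam.rowLen 0)
      (by rw [YoungDiagram.colLen_transpose])]
    simp only [YoungDiagram.rowLen_transpose]
  rw [← h2, ← h, sum_cells_transpose lam fun i _ => (lam.transpose.rowLen i : ℤ)]
  simp only [YoungDiagram.rowLen_transpose]

theorem prod_zpow_eq {ι : Type*} {a : K} (ha : a ≠ 0) (s : Finset ι) (f : ι → ℤ) :
    ∏ i ∈ s, a ^ f i = a ^ ∑ i ∈ s, f i := by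
  classical
  induction s using Finset.induction_on with
  | empty => simp
  | insert i s hi ih => rw [Finset.prod_insert hi, Finset.sum_insert hi, zpow_add₀ ha, ih]

/-- The monomial relating `N_{μ,λ}(1/y)` to `N_{λ,μ}(y q / t)`. -/
theorem prod_boxWeight {r s : K} (hr : r ≠ 0) (hs : s ≠ 0) (lam mu : YoungDiagram) :
    (∏ b ∈ mu.cells, -boxWeight₁ (r ^ 4) (s ^ 4) mu lam b) *
      ∏ b ∈ lam.cells, -boxWeight₂ (r ^ 4) (s ^ 4) mu lam b =
      (framing r s lam)⁻¹ * framing r s mu * ((r ^ 2 / s ^ 2)⁻¹) ^ (lam.card + mu.card) := by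
  have hq : r ^ 4 ≠ 0 := pow_ne_zero _ hr
  have ht : s ^ 4 ≠ 0 := pow_ne_zero _ hs
  simp only [boxWeight₁, boxWeight₂]
  rw [Finset.prod_neg, Finset.prod_neg, Finset.prod_mul_distrib, Finset.prod_mul_distrib,
    prod_zpow_eq hq, prod_zpow_eq hq, prod_zpow_eq ht, prod_zpow_eq ht]
  have h1 : ∑ b ∈ mu.cells, (-(lam.rowLen b.1 : ℤ) + b.2) =
      -(∑ b ∈ mu.cells, (lam.rowLen b.1 : ℤ)) + nStat mu.transpose := by
    rw [Finset.sum_add_distrib, Finset.sum_neg_distrib, sum_cells_snd]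
  have hc : ∀ nu : YoungDiagram, ∑ _b ∈ nu.cells, (1 : ℤ) = nu.card := fun nu => by
    rw [Finset.sum_const, nsmul_eq_mul, mul_one]
  have h2 : ∑ b ∈ lam.cells, ((mu.rowLen b.1 : ℤ) - b.2 - 1) =
      (∑ b ∈ mu.cells, (lam.rowLen b.1 : ℤ)) - nStat lam.transpose - lam.card := by
    rw [Finset.sum_sub_distrib, Finset.sum_sub_distrib, sum_cells_snd, sum_cells_rowLen_comm, hc]
  have h3 : ∑ b ∈ mu.cells, (-(mu.colLen b.2 : ℤ) + b.1 + 1) = -nStat mu := by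
    rw [Finset.sum_add_distrib, Finset.sum_add_distrib, Finset.sum_neg_distrib,
      sum_cells_colLen_self, sum_cells_fst, hc]
    ring
  have h4 : ∑ b ∈ lam.cells, ((lam.colLen b.2 : ℤ) - b.1) = nStat lam + lam.card := by
    rw [Finset.sum_sub_distrib, sum_cells_colLen_self, sum_cells_fst]
    ring
  rw [h1, h2, h3, h4, framing, framing]
  change (-1) ^ mu.card * _ * ((-1) ^ lam.card * _) = _
  generalize ∑ b ∈ mu.cells, (lam.rowLen b.1 : ℤ) = S
  have e1 : ∀ (a : K) (z : ℤ), (a ^ 4) ^ z = a ^ (4 * z) := fun a z => by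
    rw [zpow_mul]; norm_cast
  have e2 : ((r ^ 2 / s ^ 2)⁻¹) ^ (lam.card + mu.card) =
      r ^ (-2 * ((lam.card : ℤ) + mu.card)) * s ^ (2 * ((lam.card : ℤ) + mu.card)) := by
    rw [zpow_mul, zpow_mul, zpow_neg, inv_div, div_eq_inv_mul, mul_pow]
    norm_cast
  have e3 : ((-1 : K) ^ lam.card)⁻¹ = (-1) ^ lam.card := by
    rw [← inv_pow]; norm_num
  rw [e2, mul_inv, mul_inv, ← zpow_neg, ← zpow_neg, e3]
  simp only [e1]
  have e5 : r ^ (4 * (-S + (nStat mu.transpose : ℤ))) *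
      r ^ (4 * (S - (nStat lam.transpose : ℤ) - lam.card)) =
      r ^ (-(4 * (nStat lam.transpose : ℤ) + 2 * lam.card)) *
        r ^ (4 * (nStat mu.transpose : ℤ) + 2 * mu.card) * r ^ (-2 * ((lam.card : ℤ) + mu.card)) := by
    rw [← zpow_add₀ hr, ← zpow_add₀ hr, ← zpow_add₀ hr]; congr 1; ring
  have e6 : s ^ (4 * (-(nStat mu : ℤ))) * s ^ (4 * ((nStat lam : ℤ) + lam.card)) =
      s ^ (-(-4 * (nStat lam : ℤ) - 2 * lam.card)) *
        s ^ (-4 * (nStat mu : ℤ) - 2 * mu.card) * s ^ (2 * ((lam.card : ℤ) + mu.card)) := by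
    rw [← zpow_add₀ hs, ← zpow_add₀ hs, ← zpow_add₀ hs]; congr 1; ring
  calc _ = (-1) ^ mu.card * (-1) ^ lam.card *
      (r ^ (4 * (-S + (nStat mu.transpose : ℤ))) *
        r ^ (4 * (S - (nStat lam.transpose : ℤ) - lam.card))) *
      (s ^ (4 * (-(nStat mu : ℤ))) * s ^ (4 * ((nStat lam : ℤ) + lam.card))) := by ring
    _ = _ := by rw [e5, e6]; ring

theorem nek_inv {r s : K} (hr : r ≠ 0) (hs : s ≠ 0) (lam mu : YoungDiagram) {y : K} (hy : y ≠ 0) :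
    nek (r ^ 4) (s ^ 4) mu lam y⁻¹ = nek (r ^ 4) (s ^ 4) lam mu (r ^ 4 / s ^ 4 * y) *
      ((framing r s lam)⁻¹ * framing r s mu *
        ((y * (r ^ 2 / s ^ 2))⁻¹) ^ (lam.card + mu.card)) := by
  have hq : r ^ 4 ≠ 0 := pow_ne_zero _ hr
  have ht : s ^ 4 ≠ 0 := pow_ne_zero _ hs
  have h1 : ∀ b, 1 - y⁻¹ * boxWeight₁ (r ^ 4) (s ^ 4) mu lam b =
      (1 - r ^ 4 / s ^ 4 * y * boxWeight₂ (r ^ 4) (s ^ 4) lam mu b) *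
        (y⁻¹ * -boxWeight₁ (r ^ 4) (s ^ 4) mu lam b) := fun b => by
    have h := boxWeight_duality hq ht lam mu b
    have h2 : y * y⁻¹ = 1 := mul_inv_cancel₀ hy
    linear_combination (-(y * y⁻¹)) * h - h2
  have h2 : ∀ b, 1 - y⁻¹ * boxWeight₂ (r ^ 4) (s ^ 4) mu lam b =
      (1 - r ^ 4 / s ^ 4 * y * boxWeight₁ (r ^ 4) (s ^ 4) lam mu b) *
        (y⁻¹ * -boxWeight₂ (r ^ 4) (s ^ 4) mu lam b) := fun b => by
    have h := boxWeight_duality hq ht mu lam b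
    have h2 : y * y⁻¹ = 1 := mul_inv_cancel₀ hy
    linear_combination (-(y * y⁻¹)) * h - h2
  rw [mul_inv, mul_pow, mul_left_comm _ (y⁻¹ ^ _), ← prod_boxWeight hr hs, nek_eq, nek_eq]
  simp only [h1, h2, Finset.prod_mul_distrib, Finset.prod_const]
  rw [pow_add, YoungDiagram.card, YoungDiagram.card]
  ring

end CharacterIdentity

/-! ### Contractions of the intertwining operators -/

section Pairing

variable {K : Type*} [Field K]

/-- The coefficients of the logarithm of the contraction of two vertex operators. -/
def pairCoeff (q t : K) (lam mu : YoungDiagram) (n : ℕ) : K :=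
  -(partChar (q ^ n) (t ^ n) lam * partChar (q⁻¹ ^ n) (t⁻¹ ^ n) mu /
    (n * (1 - q ^ n) * (1 - t⁻¹ ^ n)))

/-- The contraction of the vertex operators labelled by `lam` and `mu`. -/
def pairSeries (q t : K) (lam mu : YoungDiagram) : PowerSeries K :=
  expSeries K (PowerSeries.mk (pairCoeff q t lam mu))

theorem pairCoeff_zero (q t : K) (lam mu : YoungDiagram) : pairCoeff q t lam mu 0 = 0 := by
  simp [pairCoeff]

theorem map_partChar {K' : Type*} [Field K'] (φ : K →+* K') (q t : K) (lam : YoungDiagram) :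
    φ (partChar q t lam) = partChar (φ q) (φ t) lam := by
  simp [partChar]

theorem map_pairCoeff {K' : Type*} [Field K'] (φ : K →+* K') (q t : K) (lam mu : YoungDiagram)
    (n : ℕ) : φ (pairCoeff q t lam mu n) = pairCoeff (φ q) (φ t) lam mu n := by
  simp [pairCoeff, map_partChar]

variable [CharZero K] {r s : K}

/-- By the character identity the contraction is `𝒢` divided by the Nekrasov factor. -/
theorem Generic.pairSeries_mul (hG : Generic r s) (lam mu : YoungDiagram) :
    pairSeries (r ^ 4) (s ^ 4) lam mu *
        ((∏ b ∈ lam.cells, lin (boxWeight₁ (r ^ 4) (s ^ 4) lam mu b)) *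
          ∏ b ∈ mu.cells, lin (boxWeight₂ (r ^ 4) (s ^ 4) lam mu b)) =
      calG (r ^ 4) (s ^ 4) := by
  have hz : ∀ x : K, PowerSeries.coeff 0 (logLin x) = 0 := fun x => by rw [coeff_logLin]; simp
  have hnz : ∀ x : K, PowerSeries.coeff 0 (-logLin x) = 0 := fun x => by rw [map_neg, hz, neg_zero]
  have hs : ∀ (S : Finset (ℕ × ℕ)) (f : ℕ × ℕ → K),
      PowerSeries.coeff 0 (∑ b ∈ S, -logLin (f b)) = 0 := fun S f => by
    rw [map_sum]; exact Finset.sum_eq_zero fun _ _ => hnz _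
  simp only [← expSeries_neg_logLin]
  rw [← expSeries_sum _ _ fun _ _ => hnz _, ← expSeries_sum _ _ fun _ _ => hnz _,
    ← expSeries_add (hs _ _) (hs _ _), pairSeries,
    ← expSeries_add (by rw [PowerSeries.coeff_mk, pairCoeff_zero])
      (by rw [map_add, hs, hs, add_zero]), calG]
  congr 1
  ext n
  rw [map_add, map_add, map_sum, map_sum, PowerSeries.coeff_mk, PowerSeries.coeff_mk]
  simp only [map_neg, coeff_logLin]
  rcases Nat.eq_zero_or_pos n with h0 | hn
  · subst h0; simp [pairCoeff_zero]
  · have hq : (r ^ 4) ^ n ≠ 0 := pow_ne_zero _ (pow_ne_zero _ hG.r_ne)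
    have ht : (s ^ 4) ^ n ≠ 0 := pow_ne_zero _ (pow_ne_zero _ hG.s_ne)
    have h1 := char_identity hq ht lam mu
    have e1 := boxWeight₁_pow (r ^ 4) (s ^ 4) lam mu
    have e2 := boxWeight₂_pow (r ^ 4) (s ^ 4) lam mu
    simp only [boxWeight₁] at e1
    simp only [boxWeight₂] at e2
    simp only [e1, e2] at h1
    have h2 := hG.one_sub_q_ne hn.ne'
    have h3 := hG.one_sub_t_inv_ne hn.ne'
    have h4 : (n : K) ≠ 0 := by exact_mod_cast hn.ne'
    have h5 : (s ^ 4) ^ (-(n : ℤ)) = (s ^ 4)⁻¹ ^ n := by rw [zpow_neg, zpow_natCast, inv_pow]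
    rw [if_neg hn.ne', h5, Finset.sum_neg_distrib, Finset.sum_neg_distrib, ← Finset.sum_div,
      ← Finset.sum_div, pairCoeff]
    simp only [boxWeight₁, boxWeight₂]
    rw [show ((r ^ 4) ^ n)⁻¹ = (r ^ 4)⁻¹ ^ n from (inv_pow _ _).symm,
      show ((s ^ 4) ^ n)⁻¹ = (s ^ 4)⁻¹ ^ n from (inv_pow _ _).symm] at h1
    rw [← sub_sub_cancel 1 (partChar ((r ^ 4) ^ n) ((s ^ 4) ^ n) lam *
      partChar ((r ^ 4)⁻¹ ^ n) ((s ^ 4)⁻¹ ^ n) mu), h1]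
    generalize (s ^ 4)⁻¹ ^ n = T at *
    field_simp
    ring

/-- Contraction of two operators `Φ`. -/
theorem Generic.phi_contraction (hG : Generic r s) {v v' : K} (hv : v ≠ 0)
    (lam mu : YoungDiagram) (n : ℕ+) :
    -phiCre (r ^ 4) (s ^ 4) v mu n *
        (phiAnn (r ^ 4) (s ^ 4) v' lam n / kap (r ^ 4) (s ^ 4) n) =
      pairCoeff (r ^ 4) (s ^ 4) lam mu n * (r ^ 4 / s ^ 4 * (v' / v)) ^ (n : ℕ) := by
  have h1 := hG.one_sub_t_ne n.ne_zero
  have h2 := hG.one_sub_q_ne n.ne_zero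
  have h3 := hG.one_sub_t_inv_ne n.ne_zero
  have h4 : ((n : ℕ) : K) ≠ 0 := by exact_mod_cast n.ne_zero
  have hr := hG.r_ne
  have hs := hG.s_ne
  rw [phiCre, phiAnn, kap, pairCoeff]
  simp only [mul_pow, div_pow]
  generalize partChar ((r ^ 4) ^ (n : ℕ)) _ lam = E
  generalize partChar ((r ^ 4)⁻¹ ^ (n : ℕ)) _ mu = E'
  generalize 1 - (s ^ 4)⁻¹ ^ (n : ℕ) = D at *
  field_simp

/-- Contraction of two operators `Φ^*`. -/
theorem Generic.phiStar_contraction (hG : Generic r s) {u u' : K} (hu : u ≠ 0)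
    (lam mu : YoungDiagram) (n : ℕ+) :
    -(-phiCre (r ^ 4) (s ^ 4) (u * r ^ 2 / s ^ 2) mu n) *
        (-phiAnn (r ^ 4) (s ^ 4) (u' * s ^ 2 / r ^ 2) lam n / kap (r ^ 4) (s ^ 4) n) =
      pairCoeff (r ^ 4) (s ^ 4) lam mu n * (u' / u) ^ (n : ℕ) := by
  have hr := hG.r_ne
  have hs := hG.s_ne
  have h := hG.phi_contraction (v := u * r ^ 2 / s ^ 2) (v' := u' * s ^ 2 / r ^ 2)
    (div_ne_zero (mul_ne_zero hu (pow_ne_zero _ hr)) (pow_ne_zero _ hs)) lam mu n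
  have e : r ^ 4 / s ^ 4 * (u' * s ^ 2 / r ^ 2 / (u * r ^ 2 / s ^ 2)) = u' / u := by field_simp
  rw [e] at h
  rw [← h]
  ring

end Pairing

/-! ### Formal sums of Hahn series -/

section HSum

variable {Γ R α β : Type*}

theorem exists_ne_zero_of_finsum_ne_zero {M : Type*} [AddCommMonoid M] {f : α → M}
    (h : ∑ᶠ a, f a ≠ 0) : ∃ a, f a ≠ 0 := by
  by_contra! h'
  exact h (by simp [h'])

section Basic

variable [PartialOrder Γ] [AddCommMonoid R]

theorem HasHSum.coeff {f : α → HahnSeries Γ R} {x : HahnSeries Γ R} (h : HasHSum f x) (g : Γ) :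
    x.coeff g = ∑ᶠ a, (f a).coeff g := by
  obtain ⟨S, hS, rfl⟩ := h
  rw [HahnSeries.SummableFamily.coeff_hsum]
  simp [hS]

theorem HasHSum.unique {f : α → HahnSeries Γ R} {x y : HahnSeries Γ R} (hx : HasHSum f x)
    (hy : HasHSum f y) : x = y := by
  ext g
  rw [hx.coeff, hy.coeff]

theorem HasHSum.isPWO {f : α → HahnSeries Γ R} {x : HahnSeries Γ R} (h : HasHSum f x) :
    (⋃ a, (f a).support).IsPWO := by
  obtain ⟨S, hS, rfl⟩ := h
  simpa [hS] using S.isPWO_iUnion_support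

theorem HasHSum.finite {f : α → HahnSeries Γ R} {x : HahnSeries Γ R} (h : HasHSum f x) (g : Γ) :
    {a | (f a).coeff g ≠ 0}.Finite := by
  obtain ⟨S, hS, rfl⟩ := h
  have := S.finite_co_support g
  simpa [Function.HasFiniteSupport, Function.support, hS] using this

theorem exists_hasHSum {f : α → HahnSeries Γ R} (h₁ : (⋃ a, (f a).support).IsPWO)
    (h₂ : ∀ g, {a | (f a).coeff g ≠ 0}.Finite) : ∃ x, HasHSum f x :=
  ⟨_, ⟨⟨f, h₁, h₂⟩, fun _ => rfl, rfl⟩⟩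

theorem hasHSum_of_coeff {f : α → HahnSeries Γ R} {x : HahnSeries Γ R}
    (h₁ : (⋃ a, (f a).support).IsPWO) (h₂ : ∀ g, {a | (f a).coeff g ≠ 0}.Finite)
    (h₃ : ∀ g, x.coeff g = ∑ᶠ a, (f a).coeff g) : HasHSum f x := by
  obtain ⟨y, hy⟩ := exists_hasHSum h₁ h₂
  have : x = y := by
    ext g
    rw [h₃, hy.coeff]
  rwa [this]

theorem HasHSum.congr {f f' : α → HahnSeries Γ R} {x : HahnSeries Γ R} (h : HasHSum f x)
    (hf : ∀ a, f' a = f a) : HasHSum f' x := by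
  rwa [funext hf]

/-- The sum of a doubly indexed summable family can be computed iteratively. -/
theorem HasHSum.prod_fiber {F : α × β → HahnSeries Γ R} {x : HahnSeries Γ R} (hF : HasHSum F x)
    {y : α → HahnSeries Γ R} (hy : ∀ a, HasHSum (fun b => F (a, b)) (y a)) : HasHSum y x := by
  refine hasHSum_of_coeff (hF.isPWO.mono ?_) (fun g => ?_) (fun g => ?_)
  · rintro g hg
    obtain ⟨a, ha⟩ := Set.mem_iUnion.1 hg
    rw [HahnSeries.mem_support, (hy a).coeff] at ha
    obtain ⟨b, hb⟩ := exists_ne_zero_of_finsum_ne_zero ha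
    exact Set.mem_iUnion.2 ⟨(a, b), hb⟩
  · refine ((hF.finite g).image Prod.fst).subset fun a ha => ?_
    simp only [Set.mem_ofPred_eq, (hy a).coeff] at ha
    obtain ⟨b, hb⟩ := exists_ne_zero_of_finsum_ne_zero ha
    exact ⟨(a, b), hb, rfl⟩
  · rw [hF.coeff, finsum_curry _ (hF.finite g)]
    exact finsum_congr fun a => ((hy a).coeff g).symm

theorem HasHSum.of_injective {f : α → HahnSeries Γ R} {x : HahnSeries Γ R} (hf : HasHSum f x)
    {e : α → β} (he : Function.Injective e) {f' : β → HahnSeries Γ R} (h₁ : ∀ a, f' (e a) = f a)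
    (h₂ : ∀ b, b ∉ Set.range e → f' b = 0) : HasHSum f' x := by
  obtain ⟨S, hS, rfl⟩ := hf
  refine ⟨S.embDomain ⟨e, he⟩, fun b => ?_, HahnSeries.SummableFamily.hsum_embDomain _ _⟩
  by_cases hb : b ∈ Set.range e
  · obtain ⟨a, rfl⟩ := hb
    rw [h₁, ← hS]
    exact HahnSeries.SummableFamily.embDomain_image S ⟨e, he⟩
  · rw [h₂ b hb]
    exact HahnSeries.SummableFamily.embDomain_of_notMem_range S ⟨e, he⟩ hb

theorem HasHSum.equiv {f : α → HahnSeries Γ R} {x : HahnSeries Γ R} (hf : HasHSum f x)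
    (e : β ≃ α) : HasHSum (fun b => f (e b)) x :=
  hf.of_injective e.symm.injective (fun a => by simp) fun b hb => absurd ⟨e b, by simp⟩ hb

theorem HasHSum.prod_swap {F : α × β → HahnSeries Γ R} {x : HahnSeries Γ R} (hF : HasHSum F x) :
    HasHSum (fun p : β × α => F (p.2, p.1)) x :=
  hF.equiv (Equiv.prodComm β α)

theorem HasHSum.prod_fiber' {F : α × β → HahnSeries Γ R} {x : HahnSeries Γ R} (hF : HasHSum F x)
    {y : β → HahnSeries Γ R} (hy : ∀ b, HasHSum (fun a => F (a, b)) (y b)) : HasHSum y x :=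
  hF.prod_swap.prod_fiber hy

theorem hasHSum_finset {f : α → HahnSeries Γ R} (s : Finset α) (hf : ∀ a ∉ s, f a = 0) :
    HasHSum f (∑ a ∈ s, f a) := by
  classical
  have hsup : (⋃ a, (f a).support).IsPWO := by
    have : (⋃ a, (f a).support) = ⋃ a ∈ (s : Set α), (f a).support := by
      ext g
      simp only [Set.mem_iUnion, exists_prop]
      refine exists_congr fun a => ⟨fun h => ⟨?_, h⟩, fun h => h.2⟩
      by_contra ha
      rw [hf a ha] at h
      simp at h
    rw [this]
    exact (Finset.isPWO_bUnion s).2 fun a _ => (f a).isPWO_support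
  refine hasHSum_of_coeff hsup (fun g => s.finite_toSet.subset fun a ha => ?_) fun g => ?_
  · by_contra h
    exact ha (by rw [hf a h]; rfl)
  · rw [HahnSeries.coeff_sum, finsum_eq_sum_of_support_subset]
    intro a ha
    by_contra h
    exact ha (by simp only [hf a h]; rfl)

theorem hasHSum_of_forall_ne {f : α → HahnSeries Γ R} (a₀ : α) (hf : ∀ a, a ≠ a₀ → f a = 0) :
    HasHSum f (f a₀) := by
  simpa using hasHSum_finset {a₀} fun a ha => hf a (by simpa using ha)

/-- Terms of a summable family may be grouped along a map with finite fibres. -/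
theorem HasHSum.fiberwise {f : α → HahnSeries Γ R} {x : HahnSeries Γ R} (hf : HasHSum f x)
    (s : β → Finset α) (p : α → β) (hs : ∀ b a, a ∈ s b ↔ p a = b) :
    HasHSum (fun b => ∑ a ∈ s b, f a) x := by
  classical
  have h1 : HasHSum (fun c : β × α => if p c.2 = c.1 then f c.2 else 0) x := by
    refine hf.of_injective (e := fun a => (p a, a)) (fun a b h => (Prod.ext_iff.1 h).2)
      (fun a => by simp) ?_
    rintro ⟨b, a⟩ hb
    exact if_neg fun h => hb ⟨a, Prod.ext h rfl⟩
  refine h1.prod_fiber fun b => ?_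
  have h2 : ∑ a ∈ s b, f a = ∑ a ∈ s b, if p a = b then f a else 0 :=
    Finset.sum_congr rfl fun a ha => by rw [if_pos ((hs b a).1 ha)]
  simp only [h2]
  exact hasHSum_finset _ fun a ha => if_neg fun h => ha ((hs b a).2 h)

end Basic

theorem HasHSum.add [PartialOrder Γ] [AddCommMonoid R] {f f' : α → HahnSeries Γ R}
    {x x' : HahnSeries Γ R} (h : HasHSum f x) (h' : HasHSum f' x') :
    HasHSum (fun a => f a + f' a) (x + x') := by
  obtain ⟨S, hS, rfl⟩ := h
  obtain ⟨S', hS', rfl⟩ := h'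
  exact ⟨S + S', fun a => by simp [hS, hS'], HahnSeries.SummableFamily.hsum_add⟩

section Mul

variable [AddCommMonoid Γ] [PartialOrder Γ] [IsOrderedCancelAddMonoid Γ] [Semiring R]

theorem HasHSum.mul {f : α → HahnSeries Γ R} {f' : β → HahnSeries Γ R} {x x' : HahnSeries Γ R}
    (h : HasHSum f x) (h' : HasHSum f' x') :
    HasHSum (fun p : α × β => f p.1 * f' p.2) (x * x') := by
  obtain ⟨S, hS, rfl⟩ := h
  obtain ⟨S', hS', rfl⟩ := h'
  exact ⟨S.mul S', fun a => by
    simp only [← hS, ← hS']; rfl, HahnSeries.SummableFamily.hsum_mul _ _⟩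

theorem HasHSum.mul_left {f : α → HahnSeries Γ R} {x : HahnSeries Γ R} (h : HasHSum f x)
    (y : HahnSeries Γ R) : HasHSum (fun a => y * f a) (y * x) := by
  have h1 : HasHSum (fun _ : Unit => y) y := by
    simpa using hasHSum_of_forall_ne (f := fun _ : Unit => y) () (by simp)
  exact (h1.mul h).equiv (Equiv.punitProd α).symm

end Mul

theorem hasHSum_heval [AddCommMonoid Γ] [LinearOrder Γ] [IsOrderedCancelAddMonoid Γ]
    [CommRing R] {x : HahnSeries Γ R} (hx : 0 < x.orderTop) (f : PowerSeries R) :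
    HasHSum (fun n => HahnSeries.C (PowerSeries.coeff n f) * x ^ n) (PowerSeries.heval x f) := by
  refine ⟨HahnSeries.SummableFamily.powerSeriesFamily x f, fun n => ?_, rfl⟩
  rw [HahnSeries.SummableFamily.powerSeriesFamily_of_orderTop_pos hx]
  simp only [HahnSeries.C_mul_eq_smul]

end HSum

/-! ### Supports in finitely generated cones -/

section Cone

variable {Γ k ι α : Type*} [AddCommGroup Γ]

/-- The homomorphism `c ↦ ∑ i, c i • σ i`. -/
def coneHom [Fintype ι] (σ : ι → Γ) : (ι → ℕ) →+ Γ where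
  toFun c := ∑ i, c i • σ i
  map_zero' := by simp
  map_add' c d := by simp [add_smul, Finset.sum_add_distrib]

/-- The submonoid generated by the finite family `σ`. -/
def cone [Fintype ι] (σ : ι → Γ) : AddSubmonoid Γ := AddMonoidHom.mrange (coneHom σ)

theorem coneHom_mem [Fintype ι] (σ : ι → Γ) (c : ι → ℕ) : coneHom σ c ∈ cone σ := ⟨c, rfl⟩

theorem coneHom_single [Fintype ι] [DecidableEq ι] (σ : ι → Γ) (i : ι) (n : ℕ) :
    coneHom σ (Pi.single i n) = n • σ i := by
  change ∑ j, _ = _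
  rw [Finset.sum_eq_single i]
  · simp
  · intro j _ hj
    simp [hj]
  · simp

theorem mem_cone [Fintype ι] (σ : ι → Γ) (i : ι) : σ i ∈ cone σ := by
  classical
  exact ⟨Pi.single i 1, by rw [coneHom_single, one_smul]⟩

variable [LinearOrder Γ] [IsOrderedAddMonoid Γ] [Field k]

/-- The support of `x` lies in the translate `g + S`. -/
def InCone (S : AddSubmonoid Γ) (g : Γ) (x : HahnSeries Γ k) : Prop :=
  ∀ γ, x.coeff γ ≠ 0 → γ - g ∈ S

variable {S : AddSubmonoid Γ} {g g' : Γ} {x x' : HahnSeries Γ k}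

theorem InCone.zero : InCone S g (0 : HahnSeries Γ k) := fun γ h => absurd rfl h

theorem InCone.single (c : k) : InCone S g (HahnSeries.single g c) := by
  intro γ h
  rw [HahnSeries.eq_of_mem_support_single h, sub_self]
  exact S.zero_mem

theorem InCone.C (c : k) : InCone S (0 : Γ) (HahnSeries.C c) := InCone.single c

theorem InCone.one : InCone S (0 : Γ) (1 : HahnSeries Γ k) := InCone.C 1

theorem InCone.add (h : InCone S g x) (h' : InCone S g x') : InCone S g (x + x') := by
  intro γ hγ
  by_cases h0 : x.coeff γ = 0
  · exact h' γ fun h1 => hγ (by rw [HahnSeries.coeff_add, h0, h1, add_zero])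
  · exact h γ h0

theorem InCone.neg (h : InCone S g x) : InCone S g (-x) := fun γ hγ =>
  h γ fun h0 => hγ (by rw [HahnSeries.coeff_neg, h0, neg_zero])

theorem InCone.sum {s : Finset α} {f : α → HahnSeries Γ k} (h : ∀ a ∈ s, InCone S g (f a)) :
    InCone S g (∑ a ∈ s, f a) :=
  Finset.sum_induction f _ (fun _ _ => InCone.add) InCone.zero h

theorem InCone.mul (h : InCone S g x) (h' : InCone S g' x') : InCone S (g + g') (x * x') := by
  intro γ hγ
  obtain ⟨a, ha, b, hb, rfl⟩ := HahnSeries.support_mul_subset (HahnSeries.mem_support _ _ |>.2 hγ)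
  have := S.add_mem (h a ha) (h' b hb)
  change a + b - (g + g') ∈ S
  rwa [add_sub_add_comm]

theorem InCone.const_mul (h : InCone S 0 x) (h' : InCone S g' x') : InCone S g' (x * x') := by
  simpa using h.mul h'

theorem InCone.mul_const (h : InCone S g x) (h' : InCone S 0 x') : InCone S g (x * x') := by
  simpa using h.mul h'

theorem InCone.pow (h : InCone S g x) (n : ℕ) : InCone S (n • g) (x ^ n) := by
  induction n with
  | zero => simpa using InCone.one
  | succ n ih =>
    rw [pow_succ, succ_nsmul]
    exact ih.mul h

theorem InCone.prod {s : Finset α} {f : α → HahnSeries Γ k} {G : α → Γ}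
    (h : ∀ a ∈ s, InCone S (G a) (f a)) : InCone S (∑ a ∈ s, G a) (∏ a ∈ s, f a) := by
  classical
  induction s using Finset.induction_on with
  | empty => simpa using InCone.one
  | insert a s ha ih =>
    rw [Finset.sum_insert ha, Finset.prod_insert ha]
    exact (h a (Finset.mem_insert_self _ _)).mul
      (ih fun b hb => h b (Finset.mem_insert_of_mem hb))

theorem InCone.mono (h : InCone S g x) (hg : g - g' ∈ S) : InCone S g' x := fun γ hγ => by
  simpa using S.add_mem (h γ hγ) hg

theorem InCone.of_eq (h : InCone S g x) (hg : g = g') : InCone S g' x := hg ▸ h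

theorem InCone.of_hasHSum {f : α → HahnSeries Γ k} (hf : HasHSum f x)
    (h : ∀ a, InCone S g (f a)) : InCone S g x := by
  intro γ hγ
  rw [hf.coeff] at hγ
  obtain ⟨a, ha⟩ := exists_ne_zero_of_finsum_ne_zero hγ
  exact h a γ ha

theorem coneHom_lt [Fintype ι] {σ : ι → Γ} (hσ : ∀ i, 0 < σ i) {c d : ι → ℕ} (h : c < d) :
    coneHom σ c < coneHom σ d := by
  obtain ⟨h1, i, hi⟩ := Pi.lt_def.1 h
  exact Finset.sum_lt_sum (fun j _ => nsmul_le_nsmul_left (hσ j).le (h1 j))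
    ⟨i, Finset.mem_univ _, nsmul_lt_nsmul_left (hσ i) hi⟩

theorem coneHom_mono [Fintype ι] {σ : ι → Γ} (hσ : ∀ i, 0 < σ i) : Monotone (coneHom σ) := by
  intro c d h
  rcases h.eq_or_lt with rfl | h
  · exact le_rfl
  · exact (coneHom_lt hσ h).le

/-- Dickson's lemma: only finitely many combinations of positive elements have a given value. -/
theorem finite_coneHom_eq [Fintype ι] {σ : ι → Γ} (hσ : ∀ i, 0 < σ i) (γ : Γ) :
    {c | coneHom σ c = γ}.Finite := by
  refine IsAntichain.finite_of_partiallyWellOrderedOn (r := (· ≤ ·)) ?_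
    (Set.isPWO_of_wellQuasiOrderedLE _)
  intro c hc d hd hne hle
  have := coneHom_lt hσ (lt_of_le_of_ne hle hne)
  rw [Set.mem_ofPred_eq] at hc hd
  rw [hc, hd] at this
  exact lt_irrefl _ this

/-- A family whose supports lie in translates of a finitely generated cone of positive elements
is summable as soon as the translation parts take each bounded range of values finitely often. -/
theorem exists_hasHSum_of_inCone [Fintype ι] {σ : ι → Γ} (hσ : ∀ i, 0 < σ i) (d : α → ι → ℕ)
    (hd : ∀ c, {a | d a ≤ c}.Finite) {f : α → HahnSeries Γ k}
    (hf : ∀ a, InCone (cone σ) (g + coneHom σ (d a)) (f a)) :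
    ∃ x, HasHSum f x ∧ InCone (cone σ) g x := by
  have hf' : ∀ a γ, (f a).coeff γ ≠ 0 → ∃ c, coneHom σ c = γ - g ∧ d a ≤ c := by
    intro a γ hγ
    obtain ⟨c, hc⟩ := hf a γ hγ
    refine ⟨d a + c, ?_, le_self_add⟩
    rw [map_add, hc]
    abel
  have hs : (⋃ a, (f a).support).IsPWO := by
    refine ((Set.isPWO_of_wellQuasiOrderedLE Set.univ).image_of_monotone
      ((coneHom_mono hσ).const_add g)).mono (Set.iUnion_subset fun a γ hγ => ?_)
    obtain ⟨c, hc, -⟩ := hf' a γ hγ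
    exact ⟨c, trivial, by simp only [hc]; abel⟩
  obtain ⟨x, hx⟩ := exists_hasHSum hs fun γ => by
    refine ((finite_coneHom_eq hσ (γ - g)).biUnion fun c _ => hd c).subset fun a ha => ?_
    obtain ⟨c, hc, hle⟩ := hf' a γ ha
    exact Set.mem_biUnion (x := c) hc hle
  refine ⟨x, hx, InCone.of_hasHSum hx fun a => (hf a).mono ?_⟩
  simpa using coneHom_mem σ (d a)

end Cone

/-! ### Formal sums of coherent-state coefficients -/

section CohSum

theorem le_wt {b : FockIdx} {n : ℕ+} (h : n ∈ b.support) : (n : ℕ) * b n ≤ wt b :=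
  Finset.single_le_sum (f := fun n : ℕ+ => (n : ℕ) * b n) (fun _ _ => Nat.zero_le _) h

theorem eq_zero_of_wt_eq_zero {b : FockIdx} (h : wt b = 0) : b = 0 := by
  by_contra hb
  obtain ⟨n, hn⟩ := Finsupp.support_nonempty_iff.2 hb
  have h1 := le_wt hn
  have h2 : 0 < (n : ℕ) * b n := Nat.mul_pos n.pos (Nat.pos_of_ne_zero (Finsupp.mem_support_iff.1 hn))
  omega

theorem sum_natSeq_eq_wt (b : FockIdx) :
    ∑ p ∈ Finset.HasAntidiagonal.antidiagonal (wt b), p.1 * natSeq (fun n => b n) p.1 = wt b := by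
  rw [Finset.Nat.sum_antidiagonal_eq_sum_range_succ_mk]
  symm
  refine Finset.sum_of_injOn (fun n : ℕ+ => (n : ℕ)) PNat.coe_injective.injOn ?_ ?_ ?_
  · intro n hn
    have h1 := le_wt hn
    have h2 : 0 < b n := Nat.pos_of_ne_zero (Finsupp.mem_support_iff.1 hn)
    have : (n : ℕ) ≤ wt b := le_trans (Nat.le_mul_of_pos_right _ h2) h1
    simpa [Nat.lt_succ_iff] using this
  · intro n _ hn
    rcases Nat.eq_zero_or_pos n with h0 | h0
    · simp [h0]
    · rw [natSeq_of_pos _ h0]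
      have : b ⟨n, h0⟩ = 0 := by
        by_contra hb
        exact hn ⟨⟨n, h0⟩, Finsupp.mem_support_iff.2 hb, rfl⟩
      simp [this]
  · intro n _
    simp [natSeq_coe]

/-- The basis states of weight `m`. -/
def idxOfWt (m : ℕ) : Finset FockIdx :=
  (Set.Finite.subset (finite_wt_le m) (t := {c | wt c = m}) fun _ h => le_of_eq h).toFinset

@[simp] theorem mem_idxOfWt (m : ℕ) (b : FockIdx) : b ∈ idxOfWt m ↔ wt b = m := by
  simp [idxOfWt]

variable {K : Type*} [Field K] [CharZero K]

theorem coh_sub_single (y : ℕ+ → K) (b : FockIdx) (n : ℕ+) (h : b n ≠ 0) :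
    y n * coh y (b - Finsupp.single n 1) = b n * coh y b := by
  have h1 : b - Finsupp.single n 1 + Finsupp.single n 1 = b :=
    tsub_add_cancel_of_le (Finsupp.single_le_iff.2 (Nat.one_le_iff_ne_zero.2 h))
  have h2 := coh_add_single y (b - Finsupp.single n 1) n
  rw [h1] at h2
  rw [← h2]
  congr 1
  have : b n = (b - Finsupp.single n 1 : FockIdx) n + 1 := by
    rw [Finsupp.tsub_apply, Finsupp.single_eq_same]
    omega
  rw [this]
  push_cast
  rfl

theorem coeff_crePoly_one (m : ℕ) : ∀ b, wt b = m →
    MvPolynomial.coeff b (PowerSeries.coeff m (crePoly fun _ => (1 : K))) =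
      coh (fun _ => 1) b := by
  induction m using Nat.strong_induction_on with
  | _ m ih =>
  intro b hb
  rcases Nat.eq_zero_or_pos m with h0 | h0
  · subst h0
    rw [eq_zero_of_wt_eq_zero hb, crePoly, coeff_zero_expSeries, coh_zero_idx]
    simp
  have hm : (m : K) ≠ 0 := by exact_mod_cast h0.ne'
  apply mul_left_cancel₀ hm
  have hrec := coeff_expSeries_rec (K := K)
    (f := PowerSeries.mk fun n => (1 : K) • natSeq (MvPolynomial.X (R := K)) n)
    (by simp [natSeq_zero]) (fun _ _ => Commute.all _ _) m
  have hcast : ∀ j : ℕ, ((j : ℕ) : Fock K) = MvPolynomial.C (j : K) := fun j => by simp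
  have h1 := congrArg (MvPolynomial.coeff b) hrec
  rw [hcast, MvPolynomial.coeff_C_mul, MvPolynomial.coeff_sum] at h1
  refine h1.trans ?_
  have h2 : ∀ p ∈ Finset.HasAntidiagonal.antidiagonal m, MvPolynomial.coeff b ((p.1 : Fock K) *
      PowerSeries.coeff p.1 (PowerSeries.mk fun n => (1 : K) • natSeq (MvPolynomial.X (R := K)) n) *
      PowerSeries.coeff p.2 (expSeries K
        (PowerSeries.mk fun n => (1 : K) • natSeq (MvPolynomial.X (R := K)) n))) =
      ((p.1 * natSeq (fun n => b n) p.1 : ℕ) : K) * coh (fun _ => 1) b := by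
    intro p hp
    rw [Finset.HasAntidiagonal.mem_antidiagonal] at hp
    rw [hcast, mul_assoc, MvPolynomial.coeff_C_mul, PowerSeries.coeff_mk, one_smul]
    rcases Nat.eq_zero_or_pos p.1 with h3 | h3
    · simp [h3]
    obtain ⟨n, hn⟩ : ∃ n : ℕ+, (n : ℕ) = p.1 := ⟨⟨p.1, h3⟩, rfl⟩
    rw [← hn, natSeq_coe, natSeq_coe, MvPolynomial.coeff_X_mul']
    split_ifs with h4
    · replace h4 := Finsupp.mem_support_iff.1 h4
      have h5 := coh_sub_single (K := K) (fun _ => 1) b n h4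
      have h6 : wt (b - Finsupp.single n 1) = p.2 := by
        have h7 : b - Finsupp.single n 1 + Finsupp.single n 1 = b :=
          tsub_add_cancel_of_le (Finsupp.single_le_iff.2 (Nat.one_le_iff_ne_zero.2 h4))
        have h8 := congrArg wt h7
        rw [wt_add, wt_single, hb] at h8
        omega
      have h9 := ih p.2 (by omega) _ h6
      rw [crePoly] at h9
      rw [h9, ← one_mul (coh _ _), h5]
      push_cast
      ring
    · replace h4 := Finsupp.notMem_support_iff.1 h4
      simp [h4]
  rw [Finset.sum_congr rfl h2, ← Finset.sum_mul, ← Nat.cast_sum]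
  subst hb
  rw [sum_natSeq_eq_wt]

/-- The coefficients of `exp (∑ z_n x^n)` are the complete homogeneous sums of `coh z`. -/
theorem coeff_expSeries_natSeq (z : ℕ+ → K) (m : ℕ) :
    PowerSeries.coeff m (expSeries K (PowerSeries.mk (natSeq z))) =
      ∑ b ∈ idxOfWt m, coh z b := by
  have h := aeval_coeff_crePoly z (fun _ => (1 : K)) m
  simp only [one_mul] at h
  refine h.symm.trans ?_
  rw [← fockEval_prod_pow, fockEval_eq_finsum, finsum_eq_sum_of_support_subset (s := idxOfWt m)]
  · refine Finset.sum_congr rfl fun b hb => ?_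
    rw [coeff_crePoly_one m b ((mem_idxOfWt m b).1 hb), coh, coh, ← Finsupp.prod_mul]
    refine Finsupp.prod_congr fun n _ => ?_
    rw [one_pow, one_mul, mul_comm]
  · intro b hb
    have h1 := left_ne_zero_of_mul (Function.mem_support.1 hb)
    have h2 := isWeightedHomogeneous_crePoly (K := K) (fun _ => 1) m h1
    rw [wt_eq_weight] at h2
    simpa using h2

end CohSum

section HahnCoh

variable {Γ k ι A : Type*} [AddCommGroup Γ] [LinearOrder Γ] [IsOrderedAddMonoid Γ] [Field k]

instance [CharZero k] : CharZero (HahnSeries Γ k) :=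
  charZero_of_injective_ringHom (HahnSeries.C_injective (Γ := Γ) (R := k))

theorem InCone.inv_natCast {S : AddSubmonoid Γ} (n : ℕ) :
    InCone S 0 ((n : HahnSeries Γ k)⁻¹) := by
  rw [← map_natCast (HahnSeries.C (Γ := Γ) (R := k)), ← map_inv₀]
  exact InCone.C _

theorem InCone.coh {S : AddSubmonoid Γ} {y : ℕ+ → HahnSeries Γ k} {g : Γ}
    (hy : ∀ n : ℕ+, InCone S ((n : ℕ) • g) (y n)) (b : FockIdx) : InCone S (wt b • g) (coh y b) := by
  have h := InCone.prod (S := S) (s := b.support) (G := fun n => b n • (n : ℕ) • g)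
    (f := fun n => y n ^ b n * (((b n).factorial : HahnSeries Γ k))⁻¹)
    fun n _ => ((hy n).pow _).mul_const (InCone.inv_natCast _)
  refine InCone.of_eq h ?_
  rw [wt, Finsupp.sum, Finset.sum_smul]
  exact Finset.sum_congr rfl fun n _ => by rw [mul_comm, mul_smul]

theorem HasHSum.expSeries_of_coh [CharZero k] {z : ℕ+ → HahnSeries Γ k} {E : HahnSeries Γ k}
    (h : HasHSum (coh z) E) :
    HasHSum (fun m => PowerSeries.coeff m
      (expSeries (HahnSeries Γ k) (PowerSeries.mk (natSeq z)))) E := by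
  simp only [coeff_expSeries_natSeq]
  exact h.fiberwise idxOfWt wt fun m b => mem_idxOfWt m b

theorem hasHSum_coeff_mul {F F' : PowerSeries (HahnSeries Γ k)} {x x' : HahnSeries Γ k}
    (h : HasHSum (fun m => PowerSeries.coeff m F) x)
    (h' : HasHSum (fun m => PowerSeries.coeff m F') x') :
    HasHSum (fun m => PowerSeries.coeff m (F * F')) (x * x') := by
  simp only [PowerSeries.coeff_mul]
  exact (h.mul h').fiberwise Finset.HasAntidiagonal.antidiagonal (fun p => p.1 + p.2)
    fun m p => Finset.HasAntidiagonal.mem_antidiagonal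

theorem hasHSum_coeff_prod (s : Finset A) {F : A → PowerSeries (HahnSeries Γ k)}
    {x : A → HahnSeries Γ k} (h : ∀ a ∈ s, HasHSum (fun m => PowerSeries.coeff m (F a)) (x a)) :
    HasHSum (fun m => PowerSeries.coeff m (∏ a ∈ s, F a)) (∏ a ∈ s, x a) := by
  classical
  induction s using Finset.induction_on with
  | empty =>
    have := hasHSum_of_forall_ne (f := fun m => PowerSeries.coeff m
      (1 : PowerSeries (HahnSeries Γ k))) 0 fun m hm => by simp [PowerSeries.coeff_one, hm]
    simpa using this
  | insert a s ha ih =>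
    rw [Finset.prod_insert ha, Finset.prod_insert ha]
    exact hasHSum_coeff_mul (h a (Finset.mem_insert_self _ _))
      (ih fun b hb => h b (Finset.mem_insert_of_mem hb))

variable [Fintype ι] {σ : ι → Γ}

theorem finite_single_wt_le [DecidableEq ι] (j : ι) (c : ι → ℕ) :
    {b : FockIdx | Pi.single (M := fun _ => ℕ) j (wt b) ≤ c}.Finite :=
  (finite_wt_le (c j)).subset fun b hb => by simpa using hb j

theorem exists_hasHSum_coh (hσ : ∀ i, 0 < σ i) (j : ι) {z : ℕ+ → HahnSeries Γ k}
    (hz : ∀ n : ℕ+, InCone (cone σ) ((n : ℕ) • σ j) (z n)) :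
    ∃ E, HasHSum (coh z) E ∧ InCone (cone σ) 0 E := by
  classical
  refine exists_hasHSum_of_inCone hσ (fun b => Pi.single j (wt b)) (finite_single_wt_le j)
    fun b => ?_
  rw [zero_add, coneHom_single]
  exact InCone.coh hz b

theorem coh_C_mul_pow [CharZero k] (a : ℕ+ → k) (X : HahnSeries Γ k) (b : FockIdx) :
    coh (fun n => HahnSeries.C (a n) * X ^ (n : ℕ)) b = HahnSeries.C (coh a b) * X ^ wt b := by
  induction b using fockIdx_induction with
  | h0 => simp
  | h1 b n ih =>
    have hs : ((b n : HahnSeries Γ k) + 1) ≠ 0 := by exact_mod_cast Nat.succ_ne_zero (b n)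
    apply mul_left_cancel₀ hs
    rw [coh_add_single, ih, wt_add, wt_single, mul_one, pow_add, ← mul_assoc, ← mul_assoc]
    have : ((b n : HahnSeries Γ k) + 1) = HahnSeries.C ((b n : k) + 1) := by
      rw [map_add, map_natCast, map_one]
    rw [this, ← map_mul, coh_add_single, map_mul]
    ring

theorem hasHSum_coh_heval [CharZero k] (hσ : ∀ i, 0 < σ i) (j : ι) (a : ℕ+ → k)
    {X : HahnSeries Γ k} (hX : InCone (cone σ) (σ j) X) (hX' : 0 < X.orderTop) :
    HasHSum (coh fun n => HahnSeries.C (a n) * X ^ (n : ℕ))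
      (PowerSeries.heval X (expSeries k (PowerSeries.mk (natSeq a)))) := by
  obtain ⟨E, hE, -⟩ := exists_hasHSum_coh hσ j
    (z := fun n => HahnSeries.C (a n) * X ^ (n : ℕ)) fun n => (InCone.C _).const_mul (hX.pow n)
  have h := hE.expSeries_of_coh
  have h2 := hasHSum_heval hX' (expSeries k (PowerSeries.mk (natSeq a)))
  have h3 : (fun m => HahnSeries.C (PowerSeries.coeff m
      (expSeries k (PowerSeries.mk (natSeq a)))) * X ^ m) =
      fun m => PowerSeries.coeff m (expSeries (HahnSeries Γ k)
        (PowerSeries.mk (natSeq fun n => HahnSeries.C (a n) * X ^ (n : ℕ)))) := by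
    ext1 m
    rw [coeff_expSeries_natSeq, coeff_expSeries_natSeq, map_sum, Finset.sum_mul]
    refine Finset.sum_congr rfl fun b hb => ?_
    rw [coh_C_mul_pow, (mem_idxOfWt m b).1 hb]
  rw [h3] at h2
  rwa [h.unique h2] at hE

/-- The sum of the coefficients `coh z` is multiplicative in `z`; for `z_n = ∑ a_n X^n` it is a
product of exponentials evaluated at the `X`'s. -/
theorem hasHSum_coh_sum [CharZero k] (hσ : ∀ i, 0 < σ i) (j : ι) (s : Finset A)
    (a : A → ℕ+ → k) {X : A → HahnSeries Γ k} (hX : ∀ i, InCone (cone σ) (σ j) (X i))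
    (hX' : ∀ i, 0 < (X i).orderTop) :
    HasHSum (coh fun n => ∑ i ∈ s, HahnSeries.C (a i n) * X i ^ (n : ℕ))
      (∏ i ∈ s, PowerSeries.heval (X i) (expSeries k (PowerSeries.mk (natSeq (a i))))) := by
  obtain ⟨E, hE, -⟩ := exists_hasHSum_coh hσ j
    (z := fun n => ∑ i ∈ s, HahnSeries.C (a i n) * X i ^ (n : ℕ))
    fun n => InCone.sum fun i _ => (InCone.C _).const_mul ((hX i).pow n)
  have h1 := hasHSum_coeff_prod s fun i _ =>
    (hasHSum_coh_heval hσ j (a i) (hX i) (hX' i)).expSeries_of_coh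
  rw [← expSeries_sum _ _ fun i _ => by rw [PowerSeries.coeff_mk, natSeq_zero]] at h1
  have h2 : (∑ i ∈ s, PowerSeries.mk (natSeq fun n => HahnSeries.C (a i n) * X i ^ (n : ℕ))) =
      PowerSeries.mk (natSeq fun n : ℕ+ => ∑ i ∈ s, HahnSeries.C (a i n) * X i ^ (n : ℕ)) := by
    ext1 n
    rw [map_sum, PowerSeries.coeff_mk]
    simp only [PowerSeries.coeff_mk]
    rcases Nat.eq_zero_or_pos n with h0 | h0
    · subst h0
      simp [natSeq_zero]
    · simp only [natSeq_of_pos _ h0]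
  rw [h2] at h1
  rwa [hE.expSeries_of_coh.unique h1] at hE

end HahnCoh

/-! ### Vertex operators acting on coherent states -/

section VertexCoh

theorem IsVertexOp.smul {K : Type*} [Field K] {κ c c' : ℕ+ → K} {M : Matrix FockIdx FockIdx K}
    (h : IsVertexOp κ c c' M) (x : K) : IsVertexOp κ c c' (x • M) where
  ann n a b := by
    simp only [Matrix.smul_apply, smul_eq_mul]
    linear_combination x * h.ann n a b
  cre n b := by
    simp only [Matrix.smul_apply, smul_eq_mul]
    linear_combination x * h.cre n b

variable {Γ k : Type*} [AddCommGroup Γ] [LinearOrder Γ] [IsOrderedAddMonoid Γ] [Field k]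
  [CharZero k]

theorem sub_single_add_single {b : FockIdx} {n : ℕ+} (h : b n ≠ 0) :
    b - Finsupp.single n 1 + Finsupp.single n 1 = b :=
  tsub_add_cancel_of_le (Finsupp.single_le_iff.2 (Nat.one_le_iff_ne_zero.2 h))

theorem IsVertexOp.inCone {S : AddSubmonoid Γ} {g : Γ} {κ c c' : ℕ+ → HahnSeries Γ k}
    {M : Matrix FockIdx FockIdx (HahnSeries Γ k)} (h : IsVertexOp κ c c' M) (h0 : M 0 0 = 1)
    (hκ : ∀ n, κ n ≠ 0) (hκ' : ∀ n, InCone S 0 (κ n)⁻¹)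
    (hc : ∀ n : ℕ+, InCone S ((n : ℕ) • g) (c n))
    (hc' : ∀ n : ℕ+, InCone S (-((n : ℕ) • g)) (c' n)) (a b : FockIdx) :
    InCone S (wt a • g - wt b • g) (M a b) := by
  revert b
  induction a using fockIdx_induction with
  | h0 =>
    intro b
    induction b using fockIdx_induction with
    | h0 => simpa [h0] using InCone.one
    | h1 b n ih =>
      rw [h.cre]
      refine ((hc' n).neg.mul ih).of_eq ?_
      rw [wt_add, wt_single, mul_one, add_smul]
      abel
  | h1 a n ih =>
    intro b
    have ha : ((a n : HahnSeries Γ k) + 1) ≠ 0 := by exact_mod_cast Nat.succ_ne_zero (a n)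
    have h1 : M (a + Finsupp.single n 1) b = ((a n + 1 : ℕ) : HahnSeries Γ k)⁻¹ *
        (b n * M a (b - Finsupp.single n 1) + c n * (κ n)⁻¹ * M a b) := by
      have := h.ann n a b
      have hk := hκ n
      push_cast
      field_simp
      linear_combination this
    rw [h1]
    refine (InCone.inv_natCast _).const_mul (InCone.add ?_ ?_)
    · by_cases hb : b n = 0
      · rw [hb, Nat.cast_zero, zero_mul]
        exact InCone.zero
      · have hn : InCone S 0 ((b n : ℕ) : HahnSeries Γ k) := by
          rw [← map_natCast (HahnSeries.C (Γ := Γ) (R := k))]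
          exact InCone.C _
        refine (hn.const_mul (ih _)).of_eq ?_
        have h2 := congrArg wt (sub_single_add_single hb)
        rw [wt_add, wt_single, mul_one] at h2
        rw [wt_add, wt_single, mul_one, add_smul, ← h2, add_smul]
        abel
    · refine (((hc n).mul_const (hκ' n)).mul (ih b)).of_eq ?_
      rw [wt_add, wt_single, mul_one, add_smul]
      abel

/-- A vertex operator maps coherent states to coherent states: the commutation relation with `a_n`
shifts the parameter by `c_n / κ_n`, and that with `a_{-n}` gives the vacuum entry `E`. -/
theorem IsVertexOp.hasHSum_mul_coh {κ c c' y : ℕ+ → HahnSeries Γ k}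
    {M : Matrix FockIdx FockIdx (HahnSeries Γ k)} (h : IsVertexOp κ c c' M) (h0 : M 0 0 = 1)
    (hκ : ∀ n, κ n ≠ 0) {E : HahnSeries Γ k} (hE : HasHSum (coh fun n => -c' n * y n) E)
    (a : FockIdx) :
    HasHSum (fun b => M a b * coh y b) (coh (fun n => y n + c n / κ n) a * E) := by
  induction a using fockIdx_induction with
  | h0 =>
    rw [coh_zero_idx, one_mul]
    refine hE.congr fun b => ?_
    rw [h.zero_left, h0, one_mul, coh, coh, ← Finsupp.prod_mul]
    refine Finsupp.prod_congr fun n _ => ?_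
    rw [mul_pow]
    ring
  | h1 a n ih =>
    have ha : ((a n : HahnSeries Γ k) + 1) ≠ 0 := by exact_mod_cast Nat.succ_ne_zero (a n)
    have h1 : HasHSum (fun b : FockIdx => (b n : HahnSeries Γ k) * (M a (b - Finsupp.single n 1) * coh y b))
        (y n * (coh (fun n => y n + c n / κ n) a * E)) := by
      refine (ih.mul_left (y n)).of_injective (e := fun b => b + Finsupp.single n 1)
        (add_left_injective _) (fun b => ?_) fun b hb => ?_
      · have := coh_add_single y b n
        rw [add_tsub_cancel_right, Finsupp.add_apply, Finsupp.single_eq_same]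
        push_cast
        linear_combination M a b * this
      · have : b n = 0 := by
          by_contra hb'
          exact hb ⟨_, sub_single_add_single hb'⟩
        rw [this, Nat.cast_zero, zero_mul]
    have h2 := (h1.add (ih.mul_left (c n / κ n))).mul_left ((a n : HahnSeries Γ k) + 1)⁻¹
    have h3 : coh (fun n => y n + c n / κ n) (a + Finsupp.single n 1) =
        ((a n : HahnSeries Γ k) + 1)⁻¹ * ((y n + c n / κ n) *
          coh (fun n => y n + c n / κ n) a) := by
      have := coh_add_single (fun n => y n + c n / κ n) a n
      rw [← this, inv_mul_cancel_left₀ ha]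
    rw [h3]
    have h4 : ∀ X : HahnSeries Γ k, ((a n : HahnSeries Γ k) + 1)⁻¹ * ((y n + c n / κ n) * X) * E =
        ((a n : HahnSeries Γ k) + 1)⁻¹ * (y n * (X * E) + c n / κ n * (X * E)) := fun X => by ring
    rw [h4]
    refine h2.congr fun b => ?_
    have := h.ann n a b
    have hk := hκ n
    field_simp
    linear_combination coh y b * this

end VertexCoh

/-! ### Chains of vertex operators -/

section Chain

variable {Γ k ι : Type*} [AddCommGroup Γ] [LinearOrder Γ] [IsOrderedAddMonoid Γ] [Field k]

/-- A family of vertex operators indexed by partitions, normalized by the vacuum entry, where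
`c_n` has order at least `n g` and `c'_n` has order at least `-n g` with respect to the
cone `S`. -/
structure IsVertexFamily (S : AddSubmonoid Γ) (g : Γ) (κ : ℕ+ → HahnSeries Γ k)
    (c c' : YoungDiagram → ℕ+ → HahnSeries Γ k)
    (N : YoungDiagram → Matrix FockIdx FockIdx (HahnSeries Γ k)) : Prop where
  vop : ∀ lam, IsVertexOp κ (c lam) (c' lam) (N lam)
  vac : ∀ lam, N lam 0 0 = 1
  ann_mem : ∀ lam (n : ℕ+), InCone S ((n : ℕ) • g) (c lam n)
  cre_mem : ∀ lam (n : ℕ+), InCone S (-((n : ℕ) • g)) (c' lam n)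

/-- The total degree of a state of the tensor product of two Fock spaces. -/
def wtPair (b : FockIdx × FockIdx) : ℕ := wt b.1 + wt b.2

theorem finite_wtPair_le (m : ℕ) : {b | wtPair b ≤ m}.Finite := by
  refine ((finite_wt_le m).prod (finite_wt_le m)).subset fun b hb => ?_
  rw [Set.mem_ofPred_eq, wtPair] at hb
  exact ⟨by simp only [Set.mem_ofPred_eq]; omega, by simp only [Set.mem_ofPred_eq]; omega⟩

theorem finite_card_le (m : ℕ) : {lam : YoungDiagram | lam.card ≤ m}.Finite := by
  have h := ((Finset.range m ×ˢ Finset.range m).powerset : Finset (Finset (ℕ × ℕ))).finite_toSet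
  refine Set.Finite.of_finite_image (f := YoungDiagram.cells) (h.subset ?_) ?_
  · rintro _ ⟨lam, hlam, rfl⟩
    rw [Finset.mem_coe, Finset.mem_powerset]
    rintro ⟨i, j⟩ hij
    rw [Set.mem_ofPred_eq] at hlam
    rw [YoungDiagram.mem_cells] at hij
    have h1 : (i + 1) * (j + 1) ≤ lam.card := by
      rw [← Finset.card_range (i + 1), ← Finset.card_range (j + 1), ← Finset.card_product]
      refine Finset.card_le_card fun p hp => ?_
      rw [Finset.mem_product, Finset.mem_range, Finset.mem_range] at hp
      rw [YoungDiagram.mem_cells]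
      exact lam.up_left_mem (by omega) (by omega) hij
    rw [Finset.mem_product, Finset.mem_range, Finset.mem_range]
    constructor <;> nlinarith
  · intro lam _ mu _ h
    exact YoungDiagram.ext h

theorem finite_forall_card_le {A : Type*} [Finite A] (m : A → ℕ) :
    {lam : A → YoungDiagram | ∀ a, (lam a).card ≤ m a}.Finite := by
  refine (Set.Finite.pi' fun a => finite_card_le (m a)).subset fun lam h a => h a

end Chain

section ChainSum

variable {Γ k ι : Type*} [AddCommGroup Γ] [LinearOrder Γ] [IsOrderedAddMonoid Γ] [Field k]

open Classical in
/-- The formal sum of a family of Hahn series, `0` if the family is not summable. -/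
def hsumOf {α : Type*} (f : α → HahnSeries Γ k) : HahnSeries Γ k :=
  if h : ∃ x, HasHSum f x then h.choose else 0

theorem hasHSum_hsumOf {α : Type*} {f : α → HahnSeries Γ k} (h : ∃ x, HasHSum f x) :
    HasHSum f (hsumOf f) := by
  rw [hsumOf, dif_pos h]
  exact h.choose_spec

/-- The matrix `∑_λ τ(λ) A_λ ⊗ B_λ`. -/
def pairSum (τ : YoungDiagram → HahnSeries Γ k)
    (A B : YoungDiagram → Matrix FockIdx FockIdx (HahnSeries Γ k)) :
    Matrix (FockIdx × FockIdx) (FockIdx × FockIdx) (HahnSeries Γ k) := fun a b =>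
  hsumOf fun lam => τ lam * (A lam a.1 b.1 * B lam a.2 b.2)

/-- The products `T_{i-1} ⋯ T_0`. -/
def chainProd {I : Type*} [DecidableEq I] (T : ℕ → Matrix I I (HahnSeries Γ k)) : ℕ → Matrix I I (HahnSeries Γ k)
  | 0 => 1
  | i + 1 => fun a c => hsumOf fun b => T i a b * chainProd T i b c

/-- The parameter of the coherent state created from the vacuum by the first `i` vertex
operators of a chain. -/
def cohPar (κ : ℕ+ → HahnSeries Γ k) (c : ℕ → YoungDiagram → ℕ+ → HahnSeries Γ k) (i : ℕ)
    (lam : Fin i → YoungDiagram) (n : ℕ+) : HahnSeries Γ k :=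
  ∑ α : Fin i, c α (lam α) n / κ n

/-- The coefficient of this coherent state: vacuum entries `τ` and pairwise contractions `E`. -/
def chainCoeff (τ : ℕ → YoungDiagram → HahnSeries Γ k)
    (E : ℕ → ℕ → YoungDiagram → YoungDiagram → HahnSeries Γ k) :
    (i : ℕ) → (Fin i → YoungDiagram) → HahnSeries Γ k
  | 0, _ => 1
  | i + 1, lam => chainCoeff τ E i (Fin.init lam) *
      (τ i (lam (Fin.last i)) * ∏ α : Fin i, E α i (Fin.init lam α) (lam (Fin.last i)))

theorem cohPar_succ (κ : ℕ+ → HahnSeries Γ k) (c : ℕ → YoungDiagram → ℕ+ → HahnSeries Γ k) (i : ℕ)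
    (lam : Fin (i + 1) → YoungDiagram) :
    cohPar κ c (i + 1) lam =
      fun n => cohPar κ c i (Fin.init lam) n + c i (lam (Fin.last i)) n / κ n := by
  ext1 n
  rw [cohPar, Fin.sum_univ_castSucc]
  rfl

variable [Fintype ι]

/-- The data of a chain of `n` operators `T_i = ∑_λ τ_i(λ) A_{i,λ} ⊗ B_{i,λ}`, where the order
`g i` of the oscillators drops by `σ (jg i)` at each step and each box of `λ` in the `i`-th
operator contributes the order `σ (jt i)`. -/
structure IsVertexChain (n : ℕ) (σ : ι → Γ) (g : ℕ → Γ) (jg jt : ℕ → ι)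
    (κ : ℕ+ → HahnSeries Γ k) (cA cA' cB cB' : ℕ → YoungDiagram → ℕ+ → HahnSeries Γ k)
    (A B : ℕ → YoungDiagram → Matrix FockIdx FockIdx (HahnSeries Γ k))
    (τ : ℕ → YoungDiagram → HahnSeries Γ k) : Prop where
  pos : ∀ i, 0 < σ i
  kap_ne : ∀ n, κ n ≠ 0
  kap_mem : ∀ n, InCone (cone σ) 0 (κ n)⁻¹
  step : ∀ i < n, g i - g (i + 1) = σ (jg i)
  famA : ∀ i < n, IsVertexFamily (cone σ) (g (i + 1)) κ (cA i) (cA' i) (A i)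
  famB : ∀ i < n, IsVertexFamily (cone σ) (g (i + 1)) κ (cB i) (cB' i) (B i)
  tau_mem : ∀ i < n, ∀ lam : YoungDiagram, InCone (cone σ) (lam.card • σ (jt i)) (τ i lam)

variable {n : ℕ} {σ : ι → Γ} {g : ℕ → Γ} {jg jt : ℕ → ι} {κ : ℕ+ → HahnSeries Γ k}
  {cA cA' cB cB' : ℕ → YoungDiagram → ℕ+ → HahnSeries Γ k}
  {A B : ℕ → YoungDiagram → Matrix FockIdx FockIdx (HahnSeries Γ k)}
  {τ : ℕ → YoungDiagram → HahnSeries Γ k}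

theorem inCone_cohPar {c : ℕ → YoungDiagram → ℕ+ → HahnSeries Γ k}
    (hκ : ∀ n, InCone (cone σ) 0 (κ n)⁻¹) (hg : ∀ i < n, g i - g (i + 1) ∈ cone σ)
    (hc : ∀ i < n, ∀ lam (m : ℕ+), InCone (cone σ) ((m : ℕ) • g (i + 1)) (c i lam m)) (i : ℕ)
    (hi : i ≤ n) (lam : Fin i → YoungDiagram) (m : ℕ+) :
    InCone (cone σ) ((m : ℕ) • g i) (cohPar κ c i lam m) := by
  induction i with
  | zero => simpa [cohPar] using InCone.zero
  | succ i ih =>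
    rw [cohPar_succ]
    refine InCone.add ((ih (by omega) (Fin.init lam)).mono ?_) ?_
    · rw [← smul_sub]
      exact AddSubmonoid.nsmul_mem _ (hg i (by omega)) _
    · rw [div_eq_mul_inv]
      exact (hc i (by omega) _ m).mul_const (hκ m)

variable [CharZero k]

theorem IsVertexFamily.inCone {S : AddSubmonoid Γ} {γ : Γ}
    {c c' : YoungDiagram → ℕ+ → HahnSeries Γ k}
    {N : YoungDiagram → Matrix FockIdx FockIdx (HahnSeries Γ k)}
    (h : IsVertexFamily S γ κ c c' N) (hκ : ∀ n, κ n ≠ 0) (hκ' : ∀ n, InCone S 0 (κ n)⁻¹)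
    (lam : YoungDiagram) (a b : FockIdx) : InCone S (wt a • γ - wt b • γ) (N lam a b) :=
  (h.vop lam).inCone (h.vac lam) hκ hκ' (h.ann_mem lam) (h.cre_mem lam) a b

namespace IsVertexChain

theorem inCone_term (h : IsVertexChain n σ g jg jt κ cA cA' cB cB' A B τ) {i : ℕ} (hi : i < n)
    (lam : YoungDiagram) (a b : FockIdx × FockIdx) :
    InCone (cone σ) (wtPair a • g (i + 1) - wtPair b • g (i + 1) + lam.card • σ (jt i))
      (τ i lam * (A i lam a.1 b.1 * B i lam a.2 b.2)) := by
  refine ((h.tau_mem i hi lam).mul (((h.famA i hi).inCone h.kap_ne h.kap_mem lam _ _).mul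
    ((h.famB i hi).inCone h.kap_ne h.kap_mem lam _ _))).of_eq ?_
  rw [wtPair, wtPair, add_smul, add_smul]
  abel

theorem pairSum_spec (h : IsVertexChain n σ g jg jt κ cA cA' cB cB' A B τ) {i : ℕ} (hi : i < n)
    (a b : FockIdx × FockIdx) :
    HasHSum (fun lam => τ i lam * (A i lam a.1 b.1 * B i lam a.2 b.2))
      (pairSum (τ i) (A i) (B i) a b) ∧
    InCone (cone σ) (wtPair a • g (i + 1) - wtPair b • g (i + 1))
      (pairSum (τ i) (A i) (B i) a b) := by
  classical
  obtain ⟨x, hx, hx'⟩ := exists_hasHSum_of_inCone (g := wtPair a • g (i + 1) - wtPair b • g (i + 1))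
    h.pos (fun lam : YoungDiagram => Pi.single (jt i) lam.card)
    (fun c => (finite_card_le (c (jt i))).subset fun lam hl => by simpa using hl (jt i))
    (f := fun lam => τ i lam * (A i lam a.1 b.1 * B i lam a.2 b.2)) fun lam => by
      rw [coneHom_single]
      exact h.inCone_term hi lam a b
  have h1 := hasHSum_hsumOf ⟨x, hx⟩
  have h2 : pairSum (τ i) (A i) (B i) a b = x := h1.unique hx
  exact ⟨h1, h2 ▸ hx'⟩

theorem chainProd_spec (h : IsVertexChain n σ g jg jt κ cA cA' cB cB' A B τ) (i : ℕ) (hi : i ≤ n)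
    (b c : FockIdx × FockIdx) : InCone (cone σ) (wtPair b • g i - wtPair c • g 0)
      (chainProd (fun i => pairSum (τ i) (A i) (B i)) i b c) ∧ (i < n →
      HasHSum (fun b' => pairSum (τ i) (A i) (B i) b b' *
          chainProd (fun i => pairSum (τ i) (A i) (B i)) i b' c)
        (chainProd (fun i => pairSum (τ i) (A i) (B i)) (i + 1) b c)) := by
  classical
  have key : ∀ (i : ℕ) (hi : i < n) (hc : ∀ b', InCone (cone σ) (wtPair b' • g i - wtPair c • g 0)
      (chainProd (fun i => pairSum (τ i) (A i) (B i)) i b' c)) (b : FockIdx × FockIdx),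
      ∃ x, HasHSum (fun b' => pairSum (τ i) (A i) (B i) b b' *
          chainProd (fun i => pairSum (τ i) (A i) (B i)) i b' c) x ∧
        InCone (cone σ) (wtPair b • g (i + 1) - wtPair c • g 0) x := by
    intro i hi hc b
    refine exists_hasHSum_of_inCone h.pos (fun b' => Pi.single (jg i) (wtPair b'))
      (fun c => (finite_wtPair_le (c (jg i))).subset fun b' hl => by simpa using hl (jg i))
      fun b' => ?_
    rw [coneHom_single, ← h.step i hi]
    refine ((h.pairSum_spec hi b b').2.mul (hc b')).of_eq ?_
    rw [smul_sub]
    abel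
  have hcone : ∀ i ≤ n, ∀ b, InCone (cone σ) (wtPair b • g i - wtPair c • g 0)
      (chainProd (fun i => pairSum (τ i) (A i) (B i)) i b c) := by
    intro i
    induction i with
    | zero =>
      intro _ b
      rw [chainProd, Matrix.one_apply]
      split_ifs with hbc
      · rw [hbc, sub_self]
        exact InCone.one
      · exact InCone.zero
    | succ i ih =>
      intro hi b
      obtain ⟨x, hx, hx'⟩ := key i (by omega) (ih (by omega)) b
      have hx2 : chainProd (fun i => pairSum (τ i) (A i) (B i)) (i + 1) b c = x :=
        (hasHSum_hsumOf ⟨x, hx⟩).unique hx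
      rwa [hx2]
  refine ⟨hcone i hi b, fun hi' => ?_⟩
  obtain ⟨x, hx, -⟩ := key i hi' (hcone i hi) b
  exact hasHSum_hsumOf ⟨x, hx⟩

theorem inCone_chainCoeff (h : IsVertexChain n σ g jg jt κ cA cA' cB cB' A B τ)
    {E : ℕ → ℕ → YoungDiagram → YoungDiagram → HahnSeries Γ k}
    (hE : ∀ i < n, ∀ α < i, ∀ lam mu, InCone (cone σ) 0 (E α i lam mu)) (i : ℕ) (hi : i ≤ n)
    (lam : Fin i → YoungDiagram) :
    InCone (cone σ) (∑ α : Fin i, (lam α).card • σ (jt α)) (chainCoeff τ E i lam) := by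
  induction i with
  | zero => simpa [chainCoeff] using InCone.one
  | succ i ih =>
    rw [chainCoeff, Fin.sum_univ_castSucc]
    refine (ih (by omega) (Fin.init lam)).mul ((h.tau_mem i (by omega) _).mul_const ?_)
    exact (InCone.prod (G := fun _ => 0) fun (α : Fin i) _ =>
      hE i (by omega) α α.2 _ _).of_eq (by simp)

/-- The vacuum is mapped by a chain of vertex operators to a sum of coherent states. -/
theorem hasHSum_vacuum (h : IsVertexChain n σ g jg jt κ cA cA' cB cB' A B τ)
    {EA EB : ℕ → ℕ → YoungDiagram → YoungDiagram → HahnSeries Γ k}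
    (hE : ∀ i < n, ∀ α < i, ∀ lam mu, InCone (cone σ) 0 (EA α i lam mu * EB α i lam mu))
    (hEA : ∀ i < n, ∀ (lam : Fin i → YoungDiagram) mu,
      HasHSum (coh fun m => -cA' i mu m * cohPar κ cA i lam m) (∏ α : Fin i, EA α i (lam α) mu))
    (hEB : ∀ i < n, ∀ (lam : Fin i → YoungDiagram) mu,
      HasHSum (coh fun m => -cB' i mu m * cohPar κ cB i lam m) (∏ α : Fin i, EB α i (lam α) mu))
    (i : ℕ) (hi : i ≤ n) (b : FockIdx × FockIdx) :
    HasHSum (fun lam : Fin i → YoungDiagram =>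
      chainCoeff τ (fun α β lam mu => EA α β lam mu * EB α β lam mu) i lam *
        (coh (cohPar κ cA i lam) b.1 * coh (cohPar κ cB i lam) b.2))
      (chainProd (fun i => pairSum (τ i) (A i) (B i)) i b 0) := by
  classical
  have hstep : ∀ i < n, g i - g (i + 1) ∈ cone σ := fun i hi => by
    rw [h.step i hi]
    exact mem_cone σ _
  induction i generalizing b with
  | zero =>
    have hcoh : ∀ b : FockIdx, b ≠ 0 → coh (fun _ => (0 : HahnSeries Γ k)) b = 0 := by
      intro b hb
      obtain ⟨m, hm⟩ := Finsupp.support_nonempty_iff.2 hb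
      refine Finset.prod_eq_zero hm ?_
      change (0 : HahnSeries Γ k) ^ b m * _ = 0
      rw [zero_pow (Finsupp.mem_support_iff.1 hm), zero_mul]
    have hpar : ∀ (c : ℕ → YoungDiagram → ℕ+ → HahnSeries Γ k) (lam : Fin 0 → YoungDiagram),
        cohPar κ c 0 lam = fun _ => 0 := fun c lam => by
      ext1 m
      simp [cohPar]
    simp only [hpar, chainCoeff, one_mul]
    have h1 := hasHSum_of_forall_ne (f := fun _ : Fin 0 → YoungDiagram =>
      coh (fun _ => (0 : HahnSeries Γ k)) b.1 * coh (fun _ => 0) b.2) default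
      fun lam hl => absurd (Subsingleton.elim _ _) hl
    convert h1 using 1
    rw [chainProd, Matrix.one_apply]
    split_ifs with hb
    · simp [hb]
    · by_cases hb1 : b.1 = 0
      · rw [hcoh b.2 fun hb2 => hb (Prod.ext hb1 hb2), mul_zero]
      · rw [hcoh b.1 hb1, zero_mul]
  | succ i ih =>
    have hin : i < n := by omega
    -- the joint sum over the intermediate state, the new partition and the previous partitions;
    -- summing over the intermediate state last gives the matrix product, summing over it first
    -- applies the vertex operators to coherent states
    obtain ⟨x, hx, -⟩ := exists_hasHSum_of_inCone (g := wtPair b • g (i + 1)) h.pos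
      (fun p : (FockIdx × FockIdx) × (YoungDiagram × (Fin i → YoungDiagram)) =>
        Pi.single (jg i) (wtPair p.1) + (Pi.single (jt i) p.2.1.card +
          ∑ α : Fin i, Pi.single (jt α) (p.2.2 α).card))
      (fun c => by
        refine ((finite_wtPair_le (c (jg i))).prod ((finite_card_le (c (jt i))).prod
          (finite_forall_card_le fun α : Fin i => c (jt α)))).subset ?_
        rintro ⟨b', mu, lam⟩ hp
        refine ⟨?_, ?_, fun α => ?_⟩
        · have := (le_trans le_self_add hp : Pi.single (jg i) (wtPair b') ≤ c) (jg i)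
          simpa using this
        · have := (le_trans (le_trans le_self_add le_add_self) hp :
            Pi.single (jt i) mu.card ≤ c) (jt i)
          simpa using this
        · have h1 : Pi.single (jt α) (lam α).card ≤
              ∑ α : Fin i, Pi.single (M := fun _ => ℕ) (jt α) (lam α).card :=
            Finset.single_le_sum (f := fun α : Fin i =>
              Pi.single (M := fun _ => ℕ) (jt α) (lam α).card) (fun _ _ => zero_le)
              (Finset.mem_univ α)
          have := (le_trans (le_trans h1 (le_trans le_add_self le_add_self)) hp :
            Pi.single (jt α) (lam α).card ≤ c) (jt α)
          simpa using this)
      (f := fun p => τ i p.2.1 * (A i p.2.1 b.1 p.1.1 * B i p.2.1 b.2 p.1.2) *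
        (chainCoeff τ (fun α β lam mu => EA α β lam mu * EB α β lam mu) i p.2.2 *
        (coh (cohPar κ cA i p.2.2) p.1.1 * coh (cohPar κ cB i p.2.2) p.1.2)))
      fun p => by
        have hA := InCone.coh (inCone_cohPar (g := g) (n := n) (c := cA) h.kap_mem hstep
          (fun i hi => (h.famA i hi).ann_mem) i hin.le p.2.2) p.1.1
        have hB := InCone.coh (inCone_cohPar (g := g) (n := n) (c := cB) h.kap_mem hstep
          (fun i hi => (h.famB i hi).ann_mem) i hin.le p.2.2) p.1.2
        refine ((h.inCone_term hin p.2.1 b p.1).mul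
          ((h.inCone_chainCoeff hE i hin.le p.2.2).mul (hA.mul hB))).of_eq ?_
        rw [map_add, map_add, map_sum, coneHom_single, coneHom_single, ← h.step i hin, ← add_smul]
        simp only [coneHom_single]
        rw [smul_sub]
        change _ + (_ + wtPair p.1 • g i) = _
        abel
    have h1 := hx.prod_fiber (y := fun b' => pairSum (τ i) (A i) (B i) b b' *
      chainProd (fun i => pairSum (τ i) (A i) (B i)) i b' 0) fun b' => by
      have h2 := (h.pairSum_spec hin b b').1.mul (ih hin.le b')
      exact h2.congr fun p => rfl
    rw [← ((h.chainProd_spec i hin.le b 0).2 hin).unique h1] at hx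
    have h2 := hx.prod_fiber' (y := fun p => τ i p.1 *
      chainCoeff τ (fun α β lam mu => EA α β lam mu * EB α β lam mu) i p.2 *
      ((coh (fun m => cohPar κ cA i p.2 m + cA i p.1 m / κ m) b.1 * ∏ α : Fin i, EA α i (p.2 α) p.1) *
      (coh (fun m => cohPar κ cB i p.2 m + cB i p.1 m / κ m) b.2 *
        ∏ α : Fin i, EB α i (p.2 α) p.1))) fun p => by
      have hA := ((h.famA i hin).vop p.1).hasHSum_mul_coh ((h.famA i hin).vac p.1) h.kap_ne
        (hEA i hin p.2 p.1) b.1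
      have hB := ((h.famB i hin).vop p.1).hasHSum_mul_coh ((h.famB i hin).vac p.1) h.kap_ne
        (hEB i hin p.2 p.1) b.2
      exact ((hA.mul hB).mul_left _).congr fun b' => by ring
    refine (h2.equiv (Fin.snocEquiv fun _ => YoungDiagram).symm).congr fun lam => ?_
    rw [cohPar_succ, cohPar_succ, chainCoeff, Finset.prod_mul_distrib]
    simp only [Fin.snocEquiv_symm_apply]
    ring

end IsVertexChain

end ChainSum

/-! ### The coefficient field and the indeterminates -/

section Parameters

theorem Generic.map {K K' : Type*} [Field K] [Field K'] {r s : K} (h : Generic r s)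
    (φ : K →+* K') : Generic (φ r) (φ s) where
  r_ne := (map_ne_zero φ).2 h.r_ne
  s_ne := (map_ne_zero φ).2 h.s_ne
  indep a b hab := h.indep a b <| φ.injective <| by
    rwa [map_mul, map_zpow₀, map_zpow₀, map_one]

theorem generic_root : Generic qRoot tRoot where
  r_ne := by
    rw [qRoot, Ne, FaithfulSMul.algebraMap_eq_zero_iff]
    exact MvPolynomial.X_ne_zero _
  s_ne := by
    rw [tRoot, Ne, FaithfulSMul.algebraMap_eq_zero_iff]
    exact MvPolynomial.X_ne_zero _
  indep a b hab := by
    have hq : qRoot ≠ 0 := by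
      rw [qRoot, Ne, FaithfulSMul.algebraMap_eq_zero_iff]
      exact MvPolynomial.X_ne_zero _
    have ht : tRoot ≠ 0 := by
      rw [tRoot, Ne, FaithfulSMul.algebraMap_eq_zero_iff]
      exact MvPolynomial.X_ne_zero _
    -- the positive and negative parts of the exponents are compared as monomials
    have h1 : qRoot ^ a.toNat * tRoot ^ b.toNat = qRoot ^ (-a).toNat * tRoot ^ (-b).toNat := by
      have ha : (a.toNat : ℤ) = a + (-a).toNat := by omega
      have hb : (b.toNat : ℤ) = b + (-b).toNat := by omega
      rw [← zpow_natCast, ← zpow_natCast, ha, hb, zpow_add₀ hq, zpow_add₀ ht, mul_mul_mul_comm, hab,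
        one_mul, zpow_natCast, zpow_natCast]
    simp only [qRoot, tRoot] at h1
    simp only [← map_pow, ← map_mul] at h1
    have h2 := FaithfulSMul.algebraMap_injective (MvPolynomial (Fin 2) ℚ) BaseField h1
    rw [MvPolynomial.X_pow_eq_monomial, MvPolynomial.X_pow_eq_monomial,
      MvPolynomial.X_pow_eq_monomial, MvPolynomial.X_pow_eq_monomial, MvPolynomial.monomial_mul,
      MvPolynomial.monomial_mul, mul_one] at h2
    have h3 := MvPolynomial.monomial_left_injective (one_ne_zero (α := ℚ)) h2
    have h4 := DFunLike.congr_fun h3 0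
    have h5 := DFunLike.congr_fun h3 1
    simp at h4 h5
    omega

theorem generic_series (n : ℕ) : Generic (qR n) (tR n) := generic_root.map (HahnSeries.C : BaseField →+* Series n)

variable {n : ℕ}

/-- The exponent of the indeterminate with the given index. -/
def expVec (i : Fin (n + 2)) : Lex (Fin (n + 2) → ℤ) := toLex (Pi.single i 1)

theorem indet_ne_zero (i : Fin (n + 2)) : indet i ≠ (0 : Series n) :=
  HahnSeries.single_ne_zero one_ne_zero

theorem toLex_pos {γ : Lex (Fin (n + 2) → ℤ)} (i : Fin (n + 2)) (h : ∀ j < i, ofLex γ j = 0)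
    (hi : 0 < ofLex γ i) : 0 < γ :=
  ⟨i, fun j hj => (h j hj).symm, hi⟩

theorem expVec_sub_pos {i j : Fin (n + 2)} (h : i < j) : 0 < expVec i - expVec j := by
  refine toLex_pos i (fun l hl => ?_) ?_
  · change (Pi.single i 1 : Fin (n + 2) → ℤ) l - (Pi.single j 1 : Fin (n + 2) → ℤ) l = 0
    simp [hl.ne, (hl.trans h).ne]
  · change 0 < (Pi.single i 1 : Fin (n + 2) → ℤ) i - (Pi.single j 1 : Fin (n + 2) → ℤ) i
    simp [h.ne]

/-- The exponent of `u` for `i = 0` and of `w_i` for `i > 0`. -/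
def oscExp (n i : ℕ) : Lex (Fin (n + 2) → ℤ) := if h : i + 1 < n + 2 then expVec ⟨i + 1, h⟩ else 0

theorem oscExp_sub_pos {i j : ℕ} (h : i < j) (hj : j ≤ n) : 0 < oscExp n i - oscExp n j := by
  rw [oscExp, oscExp, dif_pos (by omega), dif_pos (by omega)]
  exact expVec_sub_pos (by simpa using h)

theorem wVar_eq_single (i : Fin n) : wVar i = HahnSeries.single (oscExp n (i + 1)) 1 := by
  rw [oscExp, dif_pos (by omega)]
  rfl

theorem wVar_ne_zero (i : Fin n) : wVar i ≠ 0 := indet_ne_zero _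

theorem wVar_div_wVar (i j : Fin n) :
    wVar i / wVar j = HahnSeries.single (oscExp n (i + 1) - oscExp n (j + 1)) 1 := by
  rw [wVar_eq_single, wVar_eq_single, HahnSeries.single_div_single, div_one]

theorem single_one_zpow (γ : Lex (Fin (n + 2) → ℤ)) (m : ℤ) :
    (HahnSeries.single γ (1 : BaseField)) ^ m = HahnSeries.single (m • γ) 1 := by
  cases m with
  | ofNat m => simp [HahnSeries.single_pow]
  | negSucc m =>
    rw [zpow_negSucc, HahnSeries.single_pow, HahnSeries.inv_single, negSucc_zsmul, one_pow, inv_one]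

theorem prod_single_one {A : Type*} (s : Finset A) (γ : A → Lex (Fin (n + 2) → ℤ)) :
    ∏ a ∈ s, HahnSeries.single (γ a) (1 : BaseField) = HahnSeries.single (∑ a ∈ s, γ a) 1 := by
  classical
  induction s using Finset.induction_on with
  | empty => simp
  | insert a s ha ih =>
    rw [Finset.prod_insert ha, Finset.sum_insert ha, ih, HahnSeries.single_mul_single, one_mul]

/-- Every box of a partition contributes a monomial containing `v / u`. -/
theorem exists_boxExp (i : Fin n) (m : ℤ) : ∃ γ : Lex (Fin (n + 2) → ℤ), 0 < γ ∧
    vSeq n (i + 1) / uSeq n (i + 1) * wVar i ^ m = HahnSeries.single γ 1 := by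
  set e : Lex (Fin (n + 2) → ℤ) := ∑ k ∈ Finset.univ.filter (fun k : Fin n => (k : ℕ) < i + 1),
    expVec k.succ.succ with he
  have hw : ∀ k : Fin n, wVar k = HahnSeries.single (expVec k.succ.succ) 1 := fun _ => rfl
  refine ⟨expVec 0 + e - (expVec 1 - e) + m • expVec i.succ.succ, toLex_pos 0 (by simp) ?_, ?_⟩
  · have h0 : ofLex e 0 = 0 := by
      have : ∀ s : Finset (Fin n), ofLex (∑ k ∈ s, expVec (n := n) k.succ.succ) 0 = 0 := by
        classical
        intro s
        induction s using Finset.induction_on with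
        | empty => rfl
        | insert a s ha ih =>
          rw [Finset.sum_insert ha, ofLex_add, Pi.add_apply, ih, add_zero]
          change (Pi.single a.succ.succ 1 : Fin (n + 2) → ℤ) 0 = 0
          simp
      exact this _
    change 0 < (Pi.single 0 1 : Fin (n + 2) → ℤ) 0 + ofLex e 0 -
      ((Pi.single 1 1 : Fin (n + 2) → ℤ) 0 - ofLex e 0) +
      m • (Pi.single i.succ.succ 1 : Fin (n + 2) → ℤ) 0
    simp [h0]
  · rw [vSeq, uSeq, Finset.prod_inv_distrib]
    simp only [hw]
    rw [prod_single_one, ← he, HahnSeries.inv_single, single_one_zpow]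
    rw [show vVar n = HahnSeries.single (expVec 0) 1 from rfl,
      show uVar n = HahnSeries.single (expVec 1) 1 from rfl,
      HahnSeries.single_mul_single, HahnSeries.single_mul_single, HahnSeries.single_div_single,
      HahnSeries.single_mul_single]
    simp [sub_eq_add_neg]

theorem uSeq_ne_zero (i : ℕ) : uSeq n i ≠ 0 :=
  mul_ne_zero (indet_ne_zero _) (Finset.prod_ne_zero_iff.2 fun k _ => inv_ne_zero (wVar_ne_zero k))

theorem vSeq_ne_zero (i : ℕ) : vSeq n i ≠ 0 :=
  mul_ne_zero (indet_ne_zero _) (Finset.prod_ne_zero_iff.2 fun k _ => wVar_ne_zero k)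

end Parameters

/-! ### The chain of trivalent intertwining operators -/

section Contraction

variable {n : ℕ}

theorem qR_pow (m : ℕ) : qR n ^ m = HahnSeries.C (qRoot ^ m) := (map_pow _ _ _).symm

theorem tR_pow (m : ℕ) : tR n ^ m = HahnSeries.C (tRoot ^ m) := (map_pow _ _ _).symm

theorem heval_lin {x : Series n} (hx : 0 < x.orderTop) (c : BaseField) :
    PowerSeries.heval x (lin c) = 1 - x * HahnSeries.C c := by
  rw [lin, map_sub, map_one, PowerSeries.heval_mul, PowerSeries.heval_C, PowerSeries.heval_X _ hx,
    mul_comm x, ← HahnSeries.C_mul_eq_smul, mul_one]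

theorem map_boxWeight₁ (lam mu : YoungDiagram) (b : ℕ × ℕ) :
    boxWeight₁ (qR n ^ 4) (tR n ^ 4) lam mu b =
      HahnSeries.C (boxWeight₁ (qRoot ^ 4) (tRoot ^ 4) lam mu b) := by
  rw [qR_pow, tR_pow, boxWeight₁, boxWeight₁, map_mul, map_zpow₀, map_zpow₀]

theorem map_boxWeight₂ (lam mu : YoungDiagram) (b : ℕ × ℕ) :
    boxWeight₂ (qR n ^ 4) (tR n ^ 4) lam mu b =
      HahnSeries.C (boxWeight₂ (qRoot ^ 4) (tRoot ^ 4) lam mu b) := by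
  rw [qR_pow, tR_pow, boxWeight₂, boxWeight₂, map_mul, map_zpow₀, map_zpow₀]

theorem heval_pairSeries_mul_nek {x : Series n} (hx : 0 < x.orderTop) (lam mu : YoungDiagram) :
    PowerSeries.heval x (pairSeries (qRoot ^ 4) (tRoot ^ 4) lam mu) *
      nek (qR n ^ 4) (tR n ^ 4) lam mu x = evalG x := by
  rw [evalG, ← generic_root.pairSeries_mul lam mu, PowerSeries.heval_mul, PowerSeries.heval_mul,
    map_prod, map_prod, nek_eq]
  simp only [heval_lin hx, map_boxWeight₁, map_boxWeight₂]

theorem evalG_ne_zero (x : Series n) : evalG x ≠ 0 := by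
  have h : IsUnit (calG (qRoot ^ 4) (tRoot ^ 4)) := by
    rw [PowerSeries.isUnit_iff_constantCoeff, ← PowerSeries.coeff_zero_eq_constantCoeff_apply,
      calG, coeff_zero_expSeries]
    exact isUnit_one
  obtain ⟨f, hf⟩ := h
  rw [evalG, ← hf]
  exact (PowerSeries.heval_unit x f).ne_zero

theorem InCone.heval {S : AddSubmonoid (Lex (Fin (n + 2) → ℤ))} {γ : Lex (Fin (n + 2) → ℤ)}
    (hγ : γ ∈ S) {x : Series n} (h : InCone S γ x) (hx : 0 < x.orderTop)
    (f : PowerSeries BaseField) : InCone S 0 (PowerSeries.heval x f) :=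
  InCone.of_hasHSum (hasHSum_heval hx f) fun m => ((InCone.C _).const_mul (h.pow m)).mono <| by
    rw [sub_zero]
    exact AddSubmonoid.nsmul_mem _ hγ _

variable {S : AddSubmonoid (Lex (Fin (n + 2) → ℤ))}

theorem C_mul_single (γ : Lex (Fin (n + 2) → ℤ)) (a b : BaseField) :
    (HahnSeries.C a : Series n) * HahnSeries.single γ b = HahnSeries.single γ (a * b) := by
  rw [HahnSeries.C_apply, HahnSeries.single_mul_single, zero_add]

theorem inCone_phiAnn (γ : Lex (Fin (n + 2) → ℤ)) (c : BaseField) (lam : YoungDiagram) (m : ℕ+) :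
    InCone S ((m : ℕ) • γ) (phiAnn (qR n ^ 4) (tR n ^ 4) (HahnSeries.single γ c) lam m) := by
  have h : phiAnn (qR n ^ 4) (tR n ^ 4) (HahnSeries.single γ c) lam m =
      -(HahnSeries.single γ c ^ (m : ℕ) * HahnSeries.C (partChar ((qRoot ^ 4) ^ (m : ℕ))
        ((tRoot ^ 4) ^ (m : ℕ)) lam / (1 - (tRoot ^ 4) ^ (m : ℕ)))) := by
    simp only [phiAnn, qR, tR, map_div₀, map_partChar, map_pow, map_sub, map_one, mul_div_assoc]
  rw [h]
  exact (((InCone.single c).pow _).mul_const (InCone.C _)).neg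

theorem inCone_phiCre (γ : Lex (Fin (n + 2) → ℤ)) (c : BaseField) (lam : YoungDiagram) (m : ℕ+) :
    InCone S (-((m : ℕ) • γ)) (phiCre (qR n ^ 4) (tR n ^ 4) (HahnSeries.single γ c) lam m) := by
  have h : phiCre (qR n ^ 4) (tR n ^ 4) (HahnSeries.single γ c) lam m =
      -((HahnSeries.C (qRoot ^ 4 / tRoot ^ 4) * HahnSeries.single (-γ) c⁻¹) ^ (m : ℕ) *
        HahnSeries.C (partChar ((qRoot ^ 4)⁻¹ ^ (m : ℕ)) ((tRoot ^ 4)⁻¹ ^ (m : ℕ)) lam /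
          (1 - (tRoot ^ 4)⁻¹ ^ (m : ℕ)))) := by
    rw [← HahnSeries.inv_single, ← div_eq_mul_inv]
    simp only [phiCre, qR, tR, map_div₀, map_inv₀, map_partChar, map_pow, map_sub, map_one,
      mul_div_assoc]
  rw [h]
  refine ((((InCone.C _).const_mul (InCone.single _)).pow _).mul_const (InCone.C _)).neg.of_eq ?_
  exact neg_nsmul γ (m : ℕ)

theorem inCone_kap_inv (m : ℕ+) : InCone S 0 (kap (qR n ^ 4) (tR n ^ 4) m)⁻¹ := by
  have : kap (qR n ^ 4) (tR n ^ 4) m = HahnSeries.C (kap (qRoot ^ 4) (tRoot ^ 4) m) := by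
    simp only [kap, qR_pow, tR_pow, map_div₀, map_mul, map_sub, map_one, map_pow, map_natCast]
  rw [this, ← map_inv₀]
  exact InCone.C _

theorem map_framing (lam : YoungDiagram) :
    framing (qR n) (tR n) lam = HahnSeries.C (framing qRoot tRoot lam) := by
  simp only [framing, qR, tR, map_mul, map_zpow₀, map_pow, map_neg, map_one]

theorem map_nek_self (lam : YoungDiagram) : nek (qR n ^ 4) (tR n ^ 4) lam lam 1 =
    HahnSeries.C (nek (qRoot ^ 4) (tRoot ^ 4) lam lam 1) := by
  simp only [nek_eq, map_boxWeight₁, map_boxWeight₂, map_mul, map_prod, map_sub, map_one]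

theorem natSeq_pairCoeff (q t : BaseField) (lam mu : YoungDiagram) :
    (natSeq fun m : ℕ+ => pairCoeff q t lam mu m) = pairCoeff q t lam mu := by
  ext1 m
  rcases Nat.eq_zero_or_pos m with h | h
  · rw [h, natSeq_zero, pairCoeff_zero]
  · rw [natSeq_of_pos _ h]
    rfl

end Contraction

section Intertwiners

variable {n : ℕ}

theorem framing_ne_zero {K : Type*} [Field K] {r s : K} (hr : r ≠ 0) (hs : s ≠ 0)
    (lam : YoungDiagram) : framing r s lam ≠ 0 :=
  mul_ne_zero (mul_ne_zero (pow_ne_zero _ (neg_ne_zero.2 one_ne_zero)) (zpow_ne_zero _ hr))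
    (zpow_ne_zero _ hs)

/-- A matrix divided by its vacuum entry. -/
def vacuumNormalize (M : Matrix FockIdx FockIdx (Series n)) : Matrix FockIdx FockIdx (Series n) :=
  (M 0 0)⁻¹ • M

theorem vacuumNormalize_apply (M : Matrix FockIdx FockIdx (Series n)) (a b : FockIdx) :
    vacuumNormalize M a b = (M 0 0)⁻¹ * M a b := rfl

theorem vertexFamily_phi {M : ℤ} {i : Fin n} {u w : Series n}
    {T : Matrix FockIdx (YoungDiagram × FockIdx) (Series n)}
    (hT : IsPhi (qR n) (tR n) M (-wVar i) u w T) (h0 : ∀ lam, T 0 (lam, 0) ≠ 0)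
    (S : AddSubmonoid (Lex (Fin (n + 2) → ℤ))) :
    IsVertexFamily S (oscExp n (i + 1)) (kap (qR n ^ 4) (tR n ^ 4))
      (phiAnn (qR n ^ 4) (tR n ^ 4) (-wVar i)) (phiCre (qR n ^ 4) (tR n ^ 4) (-wVar i))
      (fun lam => vacuumNormalize fun a b => T a (lam, b)) where
  vop lam := (hT.isVertexOp (generic_series n) (neg_ne_zero.2 (wVar_ne_zero i)) lam).smul _
  vac lam := inv_mul_cancel₀ (h0 lam)
  ann_mem lam m := by
    have : -wVar i = HahnSeries.single (oscExp n (i + 1)) (-1 : BaseField) := by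
      rw [wVar_eq_single, HahnSeries.single_neg]
    rw [this]
    exact inCone_phiAnn _ _ _ _
  cre_mem lam m := by
    have : -wVar i = HahnSeries.single (oscExp n (i + 1)) (-1 : BaseField) := by
      rw [wVar_eq_single, HahnSeries.single_neg]
    rw [this]
    exact inCone_phiCre _ _ _ _

theorem vertexFamily_phiStar {M : ℤ} {i : Fin n} {v w : Series n}
    {T : Matrix (FockIdx × YoungDiagram) FockIdx (Series n)}
    (hT : IsPhiStar (qR n) (tR n) M w v (-wVar i) T) (h0 : ∀ lam, T (0, lam) 0 ≠ 0)
    (S : AddSubmonoid (Lex (Fin (n + 2) → ℤ))) :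
    IsVertexFamily S (oscExp n (i + 1)) (kap (qR n ^ 4) (tR n ^ 4))
      (fun lam m => -phiAnn (qR n ^ 4) (tR n ^ 4) (-wVar i * tR n ^ 2 / qR n ^ 2) lam m)
      (fun lam m => -phiCre (qR n ^ 4) (tR n ^ 4) (-wVar i * qR n ^ 2 / tR n ^ 2) lam m)
      (fun lam => vacuumNormalize fun a b => T (a, lam) b) where
  vop lam := (hT.isVertexOp (generic_series n) (neg_ne_zero.2 (wVar_ne_zero i)) lam).smul _
  vac lam := inv_mul_cancel₀ (h0 lam)
  ann_mem lam m := by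
    have : -wVar i * tR n ^ 2 / qR n ^ 2 =
        HahnSeries.single (oscExp n (i + 1)) (-(tRoot ^ 2 / qRoot ^ 2)) := by
      rw [mul_div_assoc, qR_pow, tR_pow, ← map_div₀, wVar_eq_single, ← HahnSeries.single_neg,
        mul_comm, C_mul_single, mul_neg, mul_one]
    rw [this]
    exact (inCone_phiAnn _ _ _ _).neg
  cre_mem lam m := by
    have : -wVar i * qR n ^ 2 / tR n ^ 2 =
        HahnSeries.single (oscExp n (i + 1)) (-(qRoot ^ 2 / tRoot ^ 2)) := by
      rw [mul_div_assoc, qR_pow, tR_pow, ← map_div₀, wVar_eq_single, ← HahnSeries.single_neg,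
        mul_comm, C_mul_single, mul_neg, mul_one]
    rw [this]
    exact (inCone_phiCre _ _ _ _).neg

/-- The product of the vacuum entries of `Φ_λ` and `Φ^*_λ` is a constant times the `|λ|`-th power
of the monomial with exponent `γ`. -/
theorem inCone_vacuum_mul_vacuum {N N' : ℤ} {i : Fin n} {u w' : Series n}
    {T : Matrix FockIdx (YoungDiagram × FockIdx) (Series n)}
    {T' : Matrix (FockIdx × YoungDiagram) FockIdx (Series n)}
    (hT : IsPhi (qR n) (tR n) N (-wVar i) u (vSeq n (i + 1)) T)
    (hT' : IsPhiStar (qR n) (tR n) N' w' (uSeq n (i + 1)) (-wVar i) T')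
    {γ : Lex (Fin (n + 2) → ℤ)} (hγ : vSeq n (i + 1) / uSeq n (i + 1) * wVar i ^ (N' - N - 1) =
      HahnSeries.single γ 1) (S : AddSubmonoid (Lex (Fin (n + 2) → ℤ))) (lam : YoungDiagram) :
    InCone S (lam.card • γ) (T' (0, lam) 0 * T 0 (lam, 0)) := by
  rw [vacuum_mul_vacuum (generic_series n) (neg_ne_zero.2 (wVar_ne_zero i)) (vSeq_ne_zero _)
    (uSeq_ne_zero _) hT hT', neg_neg, mul_right_comm, hγ, map_framing, map_nek_self, ← map_zpow₀,
    mul_div_assoc, ← map_div₀, qR_pow, tR_pow, ← map_div₀, ← map_inv₀]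
  exact (((InCone.single _).mul_const (InCone.C _)).pow _).mul_const (InCone.C _)

theorem vacuum_mul_vacuum_ne_zero {N N' : ℤ} {i : Fin n} {u w' : Series n}
    {T : Matrix FockIdx (YoungDiagram × FockIdx) (Series n)}
    {T' : Matrix (FockIdx × YoungDiagram) FockIdx (Series n)}
    (hT : IsPhi (qR n) (tR n) N (-wVar i) u (vSeq n (i + 1)) T)
    (hT' : IsPhiStar (qR n) (tR n) N' w' (uSeq n (i + 1)) (-wVar i) T') (lam : YoungDiagram) :
    T' (0, lam) 0 * T 0 (lam, 0) ≠ 0 := by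
  have hG := generic_series n
  have hr := hG.r_ne
  have hs := hG.s_ne
  rw [vacuum_mul_vacuum hG (neg_ne_zero.2 (wVar_ne_zero i)) (vSeq_ne_zero _)
    (uSeq_ne_zero _) hT hT', neg_neg]
  refine div_ne_zero (mul_ne_zero (pow_ne_zero _ (mul_ne_zero (mul_ne_zero (div_ne_zero
    (vSeq_ne_zero _) (uSeq_ne_zero _)) (inv_ne_zero (div_ne_zero (pow_ne_zero _ hr)
    (pow_ne_zero _ hs)))) (zpow_ne_zero _ (wVar_ne_zero i)))) (zpow_ne_zero _
    (framing_ne_zero hr hs lam))) (hG.nek_self_ne lam)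

/-- The generators of the cone of exponents: the ratios of consecutive indeterminates among
`u, w_1, …, w_n` and the exponents `γ i` of the boxes of the `i`-th partition. -/
def stepExp (γ : Fin n → Lex (Fin (n + 2) → ℤ)) : Fin n ⊕ Fin n → Lex (Fin (n + 2) → ℤ) :=
  Sum.elim (fun i => oscExp n i - oscExp n (i + 1)) γ

theorem oscExp_sub_mem (γ : Fin n → Lex (Fin (n + 2) → ℤ)) {i j : ℕ} (hij : i ≤ j) (hj : j ≤ n) :
    oscExp n i - oscExp n j ∈ cone (stepExp γ) := by
  induction j, hij using Nat.le_induction with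
  | base => rw [sub_self]; exact AddSubmonoid.zero_mem _
  | succ j _ ih =>
    rw [← sub_add_sub_cancel _ (oscExp n j)]
    exact AddSubmonoid.add_mem _ (ih (by omega))
      (mem_cone (stepExp γ) (Sum.inl (⟨j, by omega⟩ : Fin n)))

/-- A ratio `w_α / w_i` with `α < i` has order at least that of the last consecutive ratio. -/
theorem inCone_wVar_div (γ : Fin n → Lex (Fin (n + 2) → ℤ)) {i j : Fin n} (h : i < j)
    (c : BaseField) : InCone (cone (stepExp γ)) (stepExp γ (Sum.inl j))
      (HahnSeries.C c * (wVar i / wVar j)) := by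
  rw [wVar_div_wVar, C_mul_single]
  refine (InCone.single _).mono ?_
  have : oscExp n (i + 1) - oscExp n (j + 1) - stepExp γ (Sum.inl j) =
      oscExp n (i + 1) - oscExp n j := by
    simp only [stepExp, Sum.elim_inl]
    abel
  rw [this]
  exact oscExp_sub_mem γ h j.2.le

theorem orderTop_wVar_div {i j : Fin n} (h : i < j) {c : BaseField} (hc : c ≠ 0) :
    0 < (HahnSeries.C c * (wVar i / wVar j)).orderTop := by
  rw [wVar_div_wVar, C_mul_single, HahnSeries.orderTop_single (by simpa using hc)]
  exact WithTop.coe_pos.2 (oscExp_sub_pos (by simpa using h) (by omega))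

theorem fin_ofNat_eq [NeZero n] {i : ℕ} (h : i < n) : Fin.ofNat n i = ⟨i, h⟩ :=
  Fin.ext (Nat.mod_eq_of_lt h)

/-- The sum of `coh` over all contractions of one operator of a chain with its predecessors. -/
theorem hasHSum_contraction [NeZero n] {γ : Fin n → Lex (Fin (n + 2) → ℤ)} (hγ : ∀ i, 0 < γ i)
    {i : ℕ} (hi : i < n) {c : ℕ → YoungDiagram → ℕ+ → Series n} {c' : ℕ+ → Series n}
    {x : BaseField} (hx : x ≠ 0) (lam : Fin i → YoungDiagram) (mu : YoungDiagram)
    (hc : ∀ (α : Fin i) (m : ℕ+), -c' m * (c α (lam α) m / kap (qR n ^ 4) (tR n ^ 4) m) =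
      pairCoeff (qR n ^ 4) (tR n ^ 4) (lam α) mu m *
        (HahnSeries.C x * (wVar (Fin.ofNat n α) / wVar (Fin.ofNat n i))) ^ (m : ℕ)) :
    HasHSum (coh fun m => -c' m * cohPar (kap (qR n ^ 4) (tR n ^ 4)) c i lam m)
      (∏ α : Fin i, PowerSeries.heval
        (HahnSeries.C x * (wVar (Fin.ofNat n α) / wVar (Fin.ofNat n i)))
        (pairSeries (qRoot ^ 4) (tRoot ^ 4) (lam α) mu)) := by
  have hσ : ∀ j, 0 < stepExp γ j := by
    rintro (j | j)
    · exact oscExp_sub_pos (Nat.lt_succ_self _) (by omega)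
    · exact hγ j
  have hlt : ∀ α : Fin i, Fin.ofNat n α < Fin.ofNat n i := fun α => by
    rw [fin_ofNat_eq hi, fin_ofNat_eq (α.2.trans hi)]
    exact α.2
  have h := hasHSum_coh_sum hσ (Sum.inl (Fin.ofNat n i)) Finset.univ
    (fun (α : Fin i) (m : ℕ+) => pairCoeff (qRoot ^ 4) (tRoot ^ 4) (lam α) mu m)
    (fun α => inCone_wVar_div γ (hlt α) x) (fun α => orderTop_wVar_div (hlt α) hx)
  simp only [natSeq_pairCoeff] at h
  have hz : (fun m => -c' m * cohPar (kap (qR n ^ 4) (tR n ^ 4)) c i lam m) = fun m : ℕ+ =>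
      ∑ α : Fin i, HahnSeries.C (pairCoeff (qRoot ^ 4) (tRoot ^ 4) (lam α) mu m) *
        (HahnSeries.C x * (wVar (Fin.ofNat n α) / wVar (Fin.ofNat n i))) ^ (m : ℕ) := by
    funext m
    rw [cohPar, Finset.mul_sum]
    refine Finset.sum_congr rfl fun α _ => ?_
    rw [hc, map_pairCoeff, qR_pow, tR_pow]
  rw [hz]
  exact h

end Intertwiners

/-! ### Comparison with the instanton summand -/

section Summand

theorem prod_Ioi_eq_prod_ite {M : Type*} [CommMonoid M] {n : ℕ} (i : Fin n) (f : Fin n → M) :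
    ∏ j ∈ Finset.Ioi i, f j = ∏ j, if i < j then f j else 1 := by
  rw [← Finset.prod_filter]
  congr 1
  ext j
  simp

theorem chainCoeff_eq {Γ k : Type*} [AddCommGroup Γ] [LinearOrder Γ] [IsOrderedAddMonoid Γ]
    [Field k] (τ : ℕ → YoungDiagram → HahnSeries Γ k)
    (E : ℕ → ℕ → YoungDiagram → YoungDiagram → HahnSeries Γ k) (i : ℕ)
    (lam : Fin i → YoungDiagram) :
    chainCoeff τ E i lam = (∏ β : Fin i, τ β (lam β)) *
      ∏ α : Fin i, ∏ β ∈ Finset.Ioi α, E α β (lam α) (lam β) := by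
  induction i with
  | zero => simp [chainCoeff]
  | succ i ih =>
    have hlast : ∀ f : Fin (i + 1) → HahnSeries Γ k,
        ∏ β ∈ Finset.Ioi (Fin.last i), f β = 1 := fun f =>
      Finset.prod_eq_one fun β hβ => absurd (Finset.mem_Ioi.1 hβ) (Fin.le_last β).not_gt
    have hsucc : ∀ (α : Fin i) (f : Fin (i + 1) → HahnSeries Γ k),
        ∏ β ∈ Finset.Ioi α.castSucc, f β =
          (∏ β ∈ Finset.Ioi α, f β.castSucc) * f (Fin.last i) := by
      intro α f
      rw [prod_Ioi_eq_prod_ite, prod_Ioi_eq_prod_ite, Fin.prod_univ_castSucc,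
        if_pos (Fin.castSucc_lt_last α)]
      simp only [Fin.castSucc_lt_castSucc_iff]
    rw [chainCoeff, ih, Fin.prod_univ_castSucc, Fin.prod_univ_castSucc (n := i)
      (f := fun α => ∏ β ∈ Finset.Ioi α, E α β (lam α) (lam β)), hlast]
    simp only [hsucc, Finset.prod_mul_distrib, Fin.val_castSucc, Fin.val_last, Fin.init]
    ring

variable {K : Type*} [Field K] {n : ℕ}

theorem prod_prod_eq_diag_mul (F : Fin n → Fin n → K) :
    ∏ α, ∏ β, F α β = (∏ α, F α α) * ∏ α, ∏ β ∈ Finset.Ioi α, (F β α * F α β) := by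
  rw [Finset.prod_prod_Ioi_mul_eq_prod_prod_off_diag F, Finset.prod_comm,
    ← Finset.prod_mul_distrib]
  exact Finset.prod_congr rfl fun α _ => Fintype.prod_eq_mul_prod_compl α _

theorem prod_Ioi_comm (G : Fin n → Fin n → K) :
    ∏ α, ∏ β ∈ Finset.Ioi α, G α β = ∏ β, ∏ α ∈ Finset.Iio β, G α β :=
  Finset.prod_comm' fun α β => by simp

theorem prod_eq_Iio_mul_Ioi (w : Fin n → K) (i : Fin n) :
    ∏ k, w k = (∏ k ∈ Finset.Iio i, w k) * w i * ∏ k ∈ Finset.Ioi i, w k := by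
  have h1 : (Finset.univ : Finset (Fin n)) = Finset.Iic i ∪ Finset.Ioi i := by
    ext k
    simp [le_or_gt]
  rw [h1, Finset.prod_union, ← Finset.Iio_insert, Finset.prod_insert (by simp), mul_comm (w i)]
  exact Finset.disjoint_left.2 fun k hk hk' =>
    absurd (Finset.mem_Ioi.1 hk') (Finset.mem_Iic.1 hk).not_gt

theorem prod_Iic_eq (w : Fin n → K) (i : Fin n) :
    ∏ k ∈ Finset.Iic i, w k = (∏ k ∈ Finset.Iio i, w k) * w i := by
  rw [← Finset.Iio_insert, Finset.prod_insert (by simp), mul_comm (w i)]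

/-- The power of the indeterminates carried by each box of the `γ`-th partition: the vacuum entry
contributes the first three factors, the reflections `N_{μ,λ}(1/x) ∝ N_{λ,μ}(q x / t)` the
other two. -/
theorem box_weight_eq {ρ u v : K} (hρ : ρ ≠ 0) {w : Fin n → K} (hw : ∀ i, w i ≠ 0) (L M : ℤ)
    (γ : Fin n) :
    v * (∏ k ∈ Finset.Iic γ, w k) / (u * ∏ k ∈ Finset.Iic γ, (w k)⁻¹) * ρ⁻¹ *
        w γ ^ (L - γ - 1 - (M + γ) - 1) *
      ((∏ β ∈ Finset.Ioi γ, (w γ / w β * ρ)⁻¹) * ∏ α ∈ Finset.Iio γ, (w α / w γ * ρ)⁻¹) =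
    ρ ^ (-(n : ℤ)) * (v / u * ∏ k, w k) * w γ ^ (-(-L + M + n)) := by
  have hn : ((n - 1 - (γ : ℕ) : ℕ) : ℤ) = n - 1 - (γ : ℕ) := by omega
  have hg := hw γ
  rw [Finset.prod_inv_distrib, Finset.prod_inv_distrib, Finset.prod_inv_distrib, prod_Iic_eq,
    prod_eq_Iio_mul_Ioi w γ]
  simp only [Finset.prod_mul_distrib, Finset.prod_div_distrib, Finset.prod_const, Fin.card_Ioi,
    Fin.card_Iio]
  have ha : ∏ k ∈ Finset.Iio γ, w k ≠ 0 := Finset.prod_ne_zero_iff.2 fun k _ => hw k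
  have hb : ∏ k ∈ Finset.Ioi γ, w k ≠ 0 := Finset.prod_ne_zero_iff.2 fun k _ => hw k
  have e1 : L - γ - 1 - (M + γ) - 1 = (n - 1 - γ : ℕ) - (γ : ℕ) - 1 + -(-L + M + n) := by
    rw [hn]
    ring
  have e2 : -(n : ℤ) = -((n - 1 - γ : ℕ) : ℤ) - (γ : ℕ) - 1 := by
    rw [hn]
    ring
  rw [e1, e2, zpow_add₀ hg, zpow_sub₀ hg, zpow_sub₀ hg, zpow_one,
    zpow_sub₀ hρ, zpow_sub₀ hρ, zpow_neg ρ, zpow_one, zpow_natCast, zpow_natCast, zpow_natCast,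
    zpow_natCast]
  generalize w γ ^ (-(-L + M + (n : ℤ))) = W
  generalize n - 1 - (γ : ℕ) = c
  generalize ∏ k ∈ Finset.Iio γ, w k = a at *
  generalize ∏ k ∈ Finset.Ioi γ, w k = b at *
  have h1 : w γ ^ c ≠ 0 := pow_ne_zero _ hg
  have h2 : w γ ^ (γ : ℕ) ≠ 0 := pow_ne_zero _ hg
  have h3 : ρ ^ c ≠ 0 := pow_ne_zero _ hρ
  have h4 : ρ ^ (γ : ℕ) ≠ 0 := pow_ne_zero _ hρ
  generalize w γ ^ c = A at *
  generalize w γ ^ (γ : ℕ) = B at *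
  generalize ρ ^ c = C at *
  generalize ρ ^ (γ : ℕ) = D at *
  generalize w γ = g at *
  rcases eq_or_ne u 0 with rfl | hu
  · simp
  field_simp

theorem framing_exponent_eq {f : K} (hf : f ≠ 0) (L M : ℤ) (γ : Fin n) :
    f ^ (L - γ - 1 - (M + γ)) * ((f⁻¹) ^ (n - 1 - (γ : ℕ)) * f ^ (γ : ℕ)) =
      f ^ (-(-L + M + n)) := by
  have hn : ((n - 1 - (γ : ℕ) : ℕ) : ℤ) = n - 1 - (γ : ℕ) := by omega
  rw [inv_pow, ← zpow_natCast, ← zpow_natCast, ← zpow_neg, ← zpow_add₀ hf, ← zpow_add₀ hf, hn]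
  congr 1
  ring

/-- The product of the vacuum entries and of the Nekrasov factors of all pairs `α < β`, at `x` and
at `q x / t`, is the summand of the instanton partition function. -/
theorem prod_nek_eq {r s u v : K} (hr : r ≠ 0) (hs : s ≠ 0) {w : Fin n → K} (hw : ∀ i, w i ≠ 0)
    (L M : ℤ) (lam : Fin n → YoungDiagram) :
    (∏ γ, (v * (∏ k ∈ Finset.Iic γ, w k) / (u * ∏ k ∈ Finset.Iic γ, (w k)⁻¹) * (r ^ 2 / s ^ 2)⁻¹ *
        w γ ^ (L - γ - 1 - (M + γ) - 1)) ^ (lam γ).card *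
        framing r s (lam γ) ^ (L - γ - 1 - (M + γ)) / nek (r ^ 4) (s ^ 4) (lam γ) (lam γ) 1) *
      ∏ α, ∏ β ∈ Finset.Ioi α, ((nek (r ^ 4) (s ^ 4) (lam α) (lam β) (w α / w β))⁻¹ *
        (nek (r ^ 4) (s ^ 4) (lam α) (lam β) (r ^ 4 / s ^ 4 * (w α / w β)))⁻¹) =
    (∏ γ, (((r ^ 2 / s ^ 2) ^ (-(n : ℤ)) * (v / u * ∏ k, w k) * w γ ^ (-(-L + M + n))) ^
        (lam γ).card * framing r s (lam γ) ^ (-(-L + M + n)))) /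
      ∏ α, ∏ β, nek (r ^ 4) (s ^ 4) (lam α) (lam β) (w α / w β) := by
  have hρ : r ^ 2 / s ^ 2 ≠ 0 := div_ne_zero (pow_ne_zero _ hr) (pow_ne_zero _ hs)
  set ρ := r ^ 2 / s ^ 2 with hρdef
  have hf0 : ∀ γ, framing r s (lam γ) ≠ 0 := fun γ => framing_ne_zero hr hs _
  have hrefl : ∀ α β, (nek (r ^ 4) (s ^ 4) (lam α) (lam β) (r ^ 4 / s ^ 4 * (w α / w β)))⁻¹ =
      (nek (r ^ 4) (s ^ 4) (lam β) (lam α) (w β / w α))⁻¹ *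
        (((framing r s (lam α))⁻¹ * (w α / w β * ρ)⁻¹ ^ (lam α).card) *
          (framing r s (lam β) * (w α / w β * ρ)⁻¹ ^ (lam β).card)) := by
    intro α β
    have h := nek_inv hr hs (lam α) (lam β) (div_ne_zero (hw α) (hw β))
    rw [inv_div] at h
    have hx : (w α / w β * ρ)⁻¹ ≠ 0 :=
      inv_ne_zero (mul_ne_zero (div_ne_zero (hw α) (hw β)) hρ)
    have h1 := pow_ne_zero (lam α).card hx
    have h2 := pow_ne_zero (lam β).card hx
    have h3 := hf0 α
    have h4 := hf0 β
    rw [h, pow_add]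
    generalize (w α / w β * ρ)⁻¹ ^ (lam α).card = X at *
    generalize (w α / w β * ρ)⁻¹ ^ (lam β).card = Y at *
    generalize framing r s (lam α) = a at *
    generalize framing r s (lam β) = b at *
    rw [mul_inv]
    have : (a⁻¹ * b * (X * Y))⁻¹ * (a⁻¹ * X * (b * Y)) = 1 := by field_simp
    rw [mul_assoc, this, mul_one]
  have hnum : ∀ γ, ((ρ ^ (-(n : ℤ)) * (v / u * ∏ k, w k) * w γ ^ (-(-L + M + n))) ^
        (lam γ).card * framing r s (lam γ) ^ (-(-L + M + n))) =
      (v * (∏ k ∈ Finset.Iic γ, w k) / (u * ∏ k ∈ Finset.Iic γ, (w k)⁻¹) * ρ⁻¹ *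
        w γ ^ (L - γ - 1 - (M + γ) - 1)) ^ (lam γ).card * framing r s (lam γ) ^ (L - γ - 1 - (M + γ)) *
      ((∏ β ∈ Finset.Ioi γ, ((framing r s (lam γ))⁻¹ * (w γ / w β * ρ)⁻¹ ^ (lam γ).card)) *
        ∏ α ∈ Finset.Iio γ, (framing r s (lam γ) * (w α / w γ * ρ)⁻¹ ^ (lam γ).card)) := by
    intro γ
    rw [← box_weight_eq hρ hw L M γ, ← framing_exponent_eq (hf0 γ) L M γ,
      Finset.prod_mul_distrib, Finset.prod_mul_distrib, Finset.prod_const, Finset.prod_const,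
      Fin.card_Ioi, Fin.card_Iio, Finset.prod_pow, Finset.prod_pow, mul_pow _ (_ * _), mul_pow (∏ _ ∈ _, _)]
    ring
  have hden : ∏ α, ∏ β, nek (r ^ 4) (s ^ 4) (lam α) (lam β) (w α / w β) =
      (∏ α, nek (r ^ 4) (s ^ 4) (lam α) (lam α) 1) * ∏ α, ∏ β ∈ Finset.Ioi α,
        (nek (r ^ 4) (s ^ 4) (lam β) (lam α) (w β / w α) *
          nek (r ^ 4) (s ^ 4) (lam α) (lam β) (w α / w β)) := by
    rw [prod_prod_eq_diag_mul]
    simp only [div_self (hw _)]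
  simp only [hrefl]
  rw [hden]
  simp only [hnum]
  simp only [Finset.prod_mul_distrib, Finset.prod_div_distrib, Finset.prod_inv_distrib]
  rw [← prod_Ioi_comm fun _ β => framing r s (lam β), ← prod_Ioi_comm fun α β => ((w α / w β * ρ)⁻¹ ^ (lam β).card)]
  simp only [div_eq_mul_inv, mul_inv]
  ring

end Summand

/-! ### The chain of four-point operators -/

section FourPointChain

variable {n : ℕ}

theorem fin_ofNat_val [NeZero n] (i : Fin n) : Fin.ofNat n (i : ℕ) = i :=
  Fin.ext (Nat.mod_eq_of_lt i.2)

theorem vSeq_succ (i : Fin n) : vSeq n (i + 1) = vVar n * ∏ k ∈ Finset.Iic i, wVar k := by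
  rw [vSeq]
  congr 2
  ext k
  simp

theorem uSeq_succ (i : Fin n) : uSeq n (i + 1) = uVar n * ∏ k ∈ Finset.Iic i, (wVar k)⁻¹ := by
  rw [uSeq]
  congr 2
  ext k
  simp

theorem neg_wVar_div (i j : Fin n) : -wVar i / -wVar j = wVar i / wVar j := by
  have h := neg_div_neg_eq (wVar i) (wVar j)
  exact h

/-- The contraction of the `α`-th and the `β`-th operator `Φ^*` (`x = 1`) or `Φ` (`x = q / t`) of
the chain. The indices are natural numbers, as in `IsVertexChain`, and are reduced modulo `n`. -/
def contraction [NeZero n] (x : BaseField) (α β : ℕ) (lam mu : YoungDiagram) : Series n :=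
  PowerSeries.heval (HahnSeries.C x * (wVar (Fin.ofNat n α) / wVar (Fin.ofNat n β)))
    (pairSeries (qRoot ^ 4) (tRoot ^ 4) lam mu)

theorem contraction_eq [NeZero n] {x : BaseField} (hx : x ≠ 0) {α β : Fin n} (h : α < β)
    (lam mu : YoungDiagram) : contraction x α β lam mu =
      evalG (HahnSeries.C x * (wVar α / wVar β)) *
        (nek (qR n ^ 4) (tR n ^ 4) lam mu (HahnSeries.C x * (wVar α / wVar β)))⁻¹ := by
  have h1 := heval_pairSeries_mul_nek (orderTop_wVar_div h hx) lam mu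
  have h2 : nek (qR n ^ 4) (tR n ^ 4) lam mu (HahnSeries.C x * (wVar α / wVar β)) ≠ 0 := by
    intro h0
    rw [h0, mul_zero] at h1
    exact evalG_ne_zero _ h1.symm
  rw [contraction, fin_ofNat_val, fin_ofNat_val, ← h1, mul_inv_cancel_right₀ h2]

/-- The product of the vacuum entries of `Φ^*_λ` and `Φ_λ`. -/
def vacuumEntry [NeZero n]
    (Phis : Fin n → Matrix (FockIdx × YoungDiagram) FockIdx (Series n))
    (Phi : Fin n → Matrix FockIdx (YoungDiagram × FockIdx) (Series n)) (i : ℕ)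
    (lam : YoungDiagram) : Series n :=
  Phis (Fin.ofNat n i) (0, lam) 0 * Phi (Fin.ofNat n i) 0 (lam, 0)

theorem isVertexChain [NeZero n] {L M : ℤ}
    {Phis : Fin n → Matrix (FockIdx × YoungDiagram) FockIdx (Series n)}
    {Phi : Fin n → Matrix FockIdx (YoungDiagram × FockIdx) (Series n)}
    (hPhis : ∀ i : Fin n, IsPhiStar (qR n) (tR n) (L - i - 1)
      (uSeq n i) (uSeq n (i + 1)) (-wVar i) (Phis i))
    (hPhi : ∀ i : Fin n, IsPhi (qR n) (tR n) (M + i)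
      (-wVar i) (vSeq n i) (vSeq n (i + 1)) (Phi i))
    {γ : Fin n → Lex (Fin (n + 2) → ℤ)} (hγ0 : ∀ i, 0 < γ i)
    (hγ : ∀ i : Fin n, vSeq n (i + 1) / uSeq n (i + 1) * wVar i ^ (L - i - 1 - (M + i) - 1) =
      HahnSeries.single (γ i) 1) :
    IsVertexChain n (stepExp γ) (oscExp n) (fun i => Sum.inl (Fin.ofNat n i))
      (fun i => Sum.inr (Fin.ofNat n i)) (kap (qR n ^ 4) (tR n ^ 4))
      (fun i lam m => -phiAnn (qR n ^ 4) (tR n ^ 4)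
        (-wVar (Fin.ofNat n i) * tR n ^ 2 / qR n ^ 2) lam m)
      (fun i lam m => -phiCre (qR n ^ 4) (tR n ^ 4)
        (-wVar (Fin.ofNat n i) * qR n ^ 2 / tR n ^ 2) lam m)
      (fun i => phiAnn (qR n ^ 4) (tR n ^ 4) (-wVar (Fin.ofNat n i)))
      (fun i => phiCre (qR n ^ 4) (tR n ^ 4) (-wVar (Fin.ofNat n i)))
      (fun i lam => vacuumNormalize fun a b => Phis (Fin.ofNat n i) (a, lam) b)
      (fun i lam => vacuumNormalize fun a b => Phi (Fin.ofNat n i) a (lam, b))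
      (vacuumEntry Phis Phi) where
  pos := by
    rintro (j | j)
    · exact oscExp_sub_pos (Nat.lt_succ_self _) (by omega)
    · exact hγ0 j
  kap_ne := (generic_series n).kap_ne
  kap_mem := inCone_kap_inv
  step i hi := by rw [fin_ofNat_eq hi]; rfl
  famA i hi := by
    simp only [fin_ofNat_eq hi]
    exact vertexFamily_phiStar (i := ⟨i, hi⟩) (hPhis _) (fun lam => left_ne_zero_of_mul
      (vacuum_mul_vacuum_ne_zero (hPhi _) (hPhis _) lam)) _
  famB i hi := by
    simp only [fin_ofNat_eq hi]
    exact vertexFamily_phi (i := ⟨i, hi⟩) (hPhi _) (fun lam => right_ne_zero_of_mul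
      (vacuum_mul_vacuum_ne_zero (hPhi _) (hPhis _) lam)) _
  tau_mem i hi lam := by
    simp only [vacuumEntry, fin_ofNat_eq hi]
    exact inCone_vacuum_mul_vacuum (hPhi ⟨i, hi⟩) (hPhis ⟨i, hi⟩) (hγ ⟨i, hi⟩) _ lam

theorem inCone_contraction [NeZero n] (γ : Fin n → Lex (Fin (n + 2) → ℤ)) {x : BaseField}
    (hx : x ≠ 0) {α β : ℕ} (hβ : β < n) (h : α < β) (lam mu : YoungDiagram) :
    InCone (cone (stepExp γ)) 0 (contraction (n := n) x α β lam mu) := by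
  have hlt : Fin.ofNat n α < Fin.ofNat n β := by
    rw [fin_ofNat_eq hβ, fin_ofNat_eq (h.trans hβ)]
    exact h
  exact InCone.heval (mem_cone _ _) (inCone_wVar_div γ hlt x) (orderTop_wVar_div hlt hx) _

end FourPointChain

end

end RefinedVertex

theorem proposition5 (n : ℕ) (hn : 1 ≤ n) (L M : ℤ)
    (Phis : Fin n → Matrix (FockIdx × YoungDiagram) FockIdx (Series n))
    (Phi : Fin n → Matrix FockIdx (YoungDiagram × FockIdx) (Series n))
    (hPhis : ∀ i : Fin n, IsPhiStar (qR n) (tR n) (L - i - 1)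
      (uSeq n i) (uSeq n (i + 1)) (-wVar i) (Phis i))
    (hPhi : ∀ i : Fin n, IsPhi (qR n) (tR n) (M + i)
      (-wVar i) (vSeq n i) (vSeq n (i + 1)) (Phi i))
    (e : Fin n → Series n) (he : ∀ i, e i = -wVar i)
    (x : Series n) (hx : x = vVar n / uVar n * ∏ i : Fin n, wVar i)
    (m : ℤ) (hm : m = -L + M + n) :
    ∃ (T : Fin n → Matrix (FockIdx × FockIdx) (FockIdx × FockIdx) (Series n))
      (R : Fin (n + 1) → Matrix (FockIdx × FockIdx) (FockIdx × FockIdx) (Series n))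
      (Z : Series n),
      (∀ i, IsFourPoint (Phis i) (Phi i) (T i)) ∧
      R 0 = 1 ∧ (∀ i : Fin n, IsComp (T i) (R i.castSucc) (R i.succ)) ∧
      IsZinst (qR n) (tR n) n m e x Z ∧
      R (Fin.last n) (0, 0) (0, 0) =
        (∏ i : Fin n, ∏ j ∈ Finset.Ioi i,
          (evalG (e i / e j) * evalG (qR n ^ 4 * (tR n ^ 4)⁻¹ * (e i / e j)))) * Z := by
  have : NeZero n := ⟨by omega⟩
  choose γ hγ0 hγ using fun i : Fin n => exists_boxExp i (L - i - 1 - (M + i) - 1)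
  have hch := isVertexChain hPhis hPhi hγ0 hγ
  have hG := generic_series n
  have hr := hG.r_ne
  have hs := hG.s_ne
  have hqt : qRoot ^ 4 / tRoot ^ 4 ≠ 0 :=
    div_ne_zero (pow_ne_zero _ generic_root.r_ne) (pow_ne_zero _ generic_root.s_ne)
  have hC : (HahnSeries.C (qRoot ^ 4 / tRoot ^ 4) : Series n) = qR n ^ 4 / tR n ^ 4 := by
    rw [map_div₀, qR_pow, tR_pow]
  have hsum := hch.hasHSum_vacuum (EA := contraction 1)
    (EB := contraction (qRoot ^ 4 / tRoot ^ 4))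
    (fun i hi α hα lam mu => by
      simpa using (inCone_contraction γ one_ne_zero hi hα lam mu).mul
        (inCone_contraction γ hqt hi hα lam mu))
    (fun i hi lam mu => hasHSum_contraction hγ0 hi one_ne_zero lam mu fun α k => by
      rw [hG.phiStar_contraction (neg_ne_zero.2 (wVar_ne_zero _)), neg_wVar_div, map_one, one_mul])
    (fun i hi lam mu => hasHSum_contraction hγ0 hi hqt lam mu fun α k => by
      rw [hG.phi_contraction (neg_ne_zero.2 (wVar_ne_zero _)), neg_wVar_div, hC])
    n le_rfl 0
  set R := chainProd fun i => pairSum (vacuumEntry Phis Phi i)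
    (fun lam => vacuumNormalize fun a b => Phis (Fin.ofNat n i) (a, lam) b)
    (fun lam => vacuumNormalize fun a b => Phi (Fin.ofNat n i) a (lam, b)) with hR
  set GG : Series n := ∏ i : Fin n, ∏ j ∈ Finset.Ioi i,
    (evalG (e i / e j) * evalG (qR n ^ 4 * (tR n ^ 4)⁻¹ * (e i / e j))) with hGG
  have hGG0 : GG ≠ 0 := Finset.prod_ne_zero_iff.2 fun i _ => Finset.prod_ne_zero_iff.2 fun j _ =>
    mul_ne_zero (evalG_ne_zero _) (evalG_ne_zero _)
  -- `𝒢` is invertible, so `Z^inst` may be introduced as the quotient, and its defining sum is the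
  -- sum over coherent states divided by the product of the `𝒢`
  refine ⟨fun i => pairSum (vacuumEntry Phis Phi i)
    (fun lam => vacuumNormalize fun a b => Phis (Fin.ofNat n i) (a, lam) b)
    (fun lam => vacuumNormalize fun a b => Phi (Fin.ofNat n i) a (lam, b)), fun i => R i,
    GG⁻¹ * R n 0 0, fun i a b => ?_, rfl, fun i a c => ?_, ?_, ?_⟩
  · refine (hch.pairSum_spec i.2 a b).1.congr fun lam => ?_
    have h1 := vacuum_mul_vacuum_ne_zero (hPhi i) (hPhis i) lam
    have h2 := left_ne_zero_of_mul h1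
    have h3 := right_ne_zero_of_mul h1
    have h4 := vacuumNormalize_apply (fun a b => Phis i (a, lam) b) a.1 b.1
    have h5 := vacuumNormalize_apply (fun a b => Phi i a (lam, b)) a.2 b.2
    simp only [vacuumEntry, fin_ofNat_val]
    refine Eq.trans ?_ (congrArg₂ (fun y z => _ * (y * z)) h4 h5).symm
    field_simp
  · exact (hch.chainProd_spec i i.2.le a c).2 i.2
  · refine (hsum.mul_left GG⁻¹).congr fun lam => ?_
    have hdiv : ∀ i j, e i / e j = wVar i / wVar j := fun i j => by
      rw [he, he, neg_wVar_div]
    have hfac : ∀ i : Fin n, ∀ j ∈ Finset.Ioi i,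
        contraction 1 i j (lam i) (lam j) * contraction (qRoot ^ 4 / tRoot ^ 4) i j (lam i) (lam j) =
        (evalG (e i / e j) * evalG (qR n ^ 4 * (tR n ^ 4)⁻¹ * (e i / e j))) *
        ((nek (qR n ^ 4) (tR n ^ 4) (lam i) (lam j) (wVar i / wVar j))⁻¹ *
        (nek (qR n ^ 4) (tR n ^ 4) (lam i) (lam j)
          (qR n ^ 4 / tR n ^ 4 * (wVar i / wVar j)))⁻¹) := by
      intro i j hj
      rw [contraction_eq one_ne_zero (Finset.mem_Ioi.1 hj), contraction_eq hqt (Finset.mem_Ioi.1 hj),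
        hC, map_one, one_mul, hdiv, ← div_eq_mul_inv (qR n ^ 4)]
      ring
    have hvac : ∀ i : Fin n, vacuumEntry Phis Phi i (lam i) =
        (vVar n * (∏ k ∈ Finset.Iic i, wVar k) / (uVar n * ∏ k ∈ Finset.Iic i, (wVar k)⁻¹) *
          (qR n ^ 2 / tR n ^ 2)⁻¹ * wVar i ^ (L - i - 1 - (M + i) - 1)) ^ (lam i).card *
        framing (qR n) (tR n) (lam i) ^ (L - i - 1 - (M + i)) /
        nek (qR n ^ 4) (tR n ^ 4) (lam i) (lam i) 1 := by
      intro i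
      rw [vacuumEntry, fin_ofNat_val, vacuum_mul_vacuum hG (neg_ne_zero.2 (wVar_ne_zero i))
        (vSeq_ne_zero _) (uSeq_ne_zero _) (hPhi i) (hPhis i), neg_neg, vSeq_succ, uSeq_succ]
    have hnek := prod_nek_eq (u := uVar n) (v := vVar n) hr hs (wVar_ne_zero (n := n)) L M lam
    have hsplit : ∏ i : Fin n, ∏ j ∈ Finset.Ioi i, contraction 1 i j (lam i) (lam j) *
        contraction (qRoot ^ 4 / tRoot ^ 4) i j (lam i) (lam j) =
        GG * ∏ i : Fin n, ∏ j ∈ Finset.Ioi i,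
          ((nek (qR n ^ 4) (tR n ^ 4) (lam i) (lam j) (wVar i / wVar j))⁻¹ *
          (nek (qR n ^ 4) (tR n ^ 4) (lam i) (lam j)
            (qR n ^ 4 / tR n ^ 4 * (wVar i / wVar j)))⁻¹) := by
      rw [hGG, ← Finset.prod_mul_distrib]
      refine Finset.prod_congr rfl fun i _ => ?_
      rw [← Finset.prod_mul_distrib]
      exact Finset.prod_congr rfl (hfac i)
    rw [chainCoeff_eq, hsplit, Finset.prod_congr rfl fun i _ => hvac i, mul_left_comm _ GG, mul_assoc GG,
      inv_mul_cancel_left₀ hGG0, hnek, hx, hm]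
    simp only [hdiv]
    simp only [he, neg_neg, Prod.fst_zero, Prod.snd_zero, coh_zero_idx, mul_one,
      ← div_eq_mul_inv (qR n ^ 2)]
  · exact (mul_inv_cancel_left₀ hGG0 _).symm
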